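/- Let $\mathbb K=\mathbb R$ or $\mathbb C$ and $m,n\ge 0$. A change of coordinates $(x^i,\xi^\alpha)\mapsto(X^i(x,\xi),\Xi^\alpha(x,\xi))$ from the $m|n$-dimensional superdomain over an open set $U\subset\mathbb R^m$ onto the one over an open set $V\subset\mathbb R^m$ is an isomorphism of superdomains, i.e. it is given by smooth real superfunctions ($X^i$ even, $\Xi^\alpha$ odd) and has an inverse of the same kind. The odd tangent bundle $\Pi T$ of the superdomain over $U$ is the superdomain over $U\times\mathbb R^n$ with even coordinates $(x^i,y^\alpha)$ and odd coordinates $(\xi^\alpha,\psi^i)$. The coordinate change induces on $\Pi T$ the transformation $\Phi:(x,\xi,\psi,y)\mapsto(X,\Xi,\Psi,Y)$ with $$\Psi^i=\psi^k\frac{\partial X^i}{\partial x^k}+y^\beta\frac{\partial X^i}{\partial\xi^\beta},\qquad Y^\alpha=\psi^k\frac{\partial \Xi^\alpha}{\partial x^k}+y^\beta\frac{\partial \Xi^\alpha}{\partial\xi^\beta}$$ (left derivatives in $\xi$). A pseudodifferential form is a smooth $\mathbb K$-valued superfunction $f(x,\xi,\psi,y)$ on $\Pi T$. Its integral over the superdomain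 over $U$ is $I_U[f]=\int_U\overline{dx\,d\xi}\int_{\mathbb R^{n|m}}\overline{d\psi\,dy}\,f$, i.e. the Lebesgue integral over $U\times\mathbb R^n$ of the coefficient of $\xi^1\cdots\xi^n\psi^1\cdots\psi^m$ in $f$. Call $f$ decaying if it has compact support along the base $U$ and all its coefficient functions, with all their derivatives, decrease faster than any power of $|y|$, locally uniformly in $x$. For a form on a supermanifold, "decaying" means compact support along the underlying manifold together with this decrease in $y$ in every chart. Put $\sigma(x)=\operatorname{sgn}\bigl(\det\frac{\partial X}{\partial x}\,\det\frac{\partial\Xi}{\partial\xi}\bigr)\big|_{\xi=0}$; this is the sign of the Jacobian determinant of the map $(x,y)\mapsto(X,Y)$ between the underlying spaces of the odd tangent bundles. 1. For every coordinate change, $\Phi$ is a coordinate change from the superdomain over $U\times\mathbb R^n$ onto that over $V\times\mathbb R^n$, and its Berezinian is identically $1$. 2. If $f$ is a decaying form on the superdomain over $V$, then $\Phi^*f$ is a decaying form on the one over $U$, the top coefficients of both are Lebesgue integrable, and $I_V[f]=I_U[\sigma\,\Phi^*f]$. In particular $I_V[f]=I_U[\Phi^*f]$ whenever $\sigma=1$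 everywhere. 3. Let $\mathfrak M$ be a smooth $m|n$-dimensional supermanifold with Hausdorff underlying space, given by an atlas (possibly a maximal one) all of whose coordinate changes have $\sigma=1$. Then every decaying pseudodifferential form $f$ on $\mathfrak M$ has a well-defined integral $I[f]$, independent of the choice of coordinates: $f$ is a finite sum of decaying forms $g_j$, each with compact support along the domain of some chart $a_j$ of the atlas, and the sum of the integrals of the $g_j$, each computed in the coordinates of $a_j$, is the same for all such choices of $g_j$ and $a_j$. -/

import Mathlib

open scoped ContDiff

noncomputable section

namespace SuperGeom

/-- The Grassmann algebra over `𝕜` with `q` odd generators. -/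
abbrev Grassmann (𝕜 : Type*) [RCLike 𝕜] (q : ℕ) : Type _ := ExteriorAlgebra 𝕜 (Fin q → 𝕜)

/-- The superfunctions of `p` real (even) and `q` odd variables, as functions of the even variables
with values in the Grassmann algebra of the odd ones. Only the values over some open set
will matter, and smoothness there is imposed separately. -/
abbrev SFun (𝕜 : Type*) [RCLike 𝕜] (p q : ℕ) : Type _ := (Fin p → ℝ) → Grassmann 𝕜 q

section Grassmann

variable {𝕜 : Type*} [RCLike 𝕜] {p q : ℕ}

/-- The `j`-th odd generator. -/
def oddGen (j : Fin q) : Grassmann 𝕜 q := ExteriorAlgebra.ι 𝕜 (Pi.single j 1)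

/-- The basis of ordered monomials `ξ^{j₁} ⋯ ξ^{jᵣ}`, `j₁ < ⋯ < jᵣ`, indexed by `{j₁, …, jᵣ}`. -/
def monomialBasis (𝕜 : Type*) [RCLike 𝕜] (q : ℕ) :
    Module.Basis (Finset (Fin q)) 𝕜 (Grassmann 𝕜 q) :=
  (Pi.basisFun 𝕜 (Fin q)).ExteriorAlgebra

/-- The coefficient of the ordered monomial indexed by `A`. -/
def coeff (A : Finset (Fin q)) (w : Grassmann 𝕜 q) : 𝕜 := (monomialBasis 𝕜 q).repr w A

/-- The body (term without odd generators) of an element. -/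
def body (w : Grassmann 𝕜 q) : 𝕜 := ExteriorAlgebra.algebraMapInv w

/-- The nilpotent part of an element. -/
def soul (w : Grassmann 𝕜 q) : Grassmann 𝕜 q := w - algebraMap 𝕜 (Grassmann 𝕜 q) (body w)

/-- All coefficients of `w` are real. -/
def IsRealElt (w : Grassmann 𝕜 q) : Prop := ∀ A, ∃ r : ℝ, coeff A w = (r : 𝕜)

/-- `w` is homogeneous of parity `ε`. -/
def HasParity (ε : ZMod 2) (w : Grassmann 𝕜 q) : Prop :=
  w ∈ CliffordAlgebra.evenOdd (0 : QuadraticForm 𝕜 (Fin q → 𝕜)) ε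

/-- Smoothness of a superfunction over a set. -/
def SmoothOn (f : SFun 𝕜 p q) (U : Set (Fin p → ℝ)) : Prop :=
  ∀ A, ContDiffOn ℝ ∞ (fun x => coeff A (f x)) U

/-- The partial derivative in the `i`-th even variable. -/
def evenDeriv (i : Fin p) (f : SFun 𝕜 p q) : SFun 𝕜 p q := fun x =>
  ∑ A, (fderiv ℝ (fun x' => coeff A (f x')) x (Pi.single i 1)) • monomialBasis 𝕜 q A

/-- The left partial derivative in the `j`-th odd variable. -/
def oddDeriv (j : Fin q) (f : SFun 𝕜 p q) : SFun 𝕜 p q := fun x =>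
  CliffordAlgebra.contractLeft (LinearMap.proj j : Module.Dual 𝕜 (Fin q → 𝕜)) (f x)

end Grassmann

/-- The components `X^i` (even) and `Ξ^α` (odd) of a map from `p|q`-dimensional to
`p'|q'`-dimensional superspace. -/
structure SuperMap (𝕜 : Type*) [RCLike 𝕜] (p q p' q' : ℕ) where
  /-- the even components -/
  even : Fin p' → SFun 𝕜 p q
  /-- the odd components -/
  odd : Fin q' → SFun 𝕜 p q

namespace SuperMap

variable {𝕜 : Type*} [RCLike 𝕜] {p q p' q' p'' q'' : ℕ}

/-- The underlying map of ordinary spaces. -/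
def bodyMap (φ : SuperMap 𝕜 p q p' q') (x : Fin p → ℝ) : Fin p' → ℝ :=
  fun i => RCLike.re (body (φ.even i x))

/-- The ordered product of the odd components with index in `A`. -/
def oddMonomial (φ : SuperMap 𝕜 p q p' q') (A : Finset (Fin q')) (x : Fin p → ℝ) : Grassmann 𝕜 q :=
  ((A.sort (· ≤ ·)).map fun j => φ.odd j x).prod

/-- The pullback (substitution) `f(X(x,ξ), Ξ(x,ξ))`, defined by the Taylor expansion of the
coefficients of `f` at the body of `X` in powers of the nilpotent part of `X`; the
expansion is finite, since products of more than `q` nilpotent parts vanish. -/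
def pullback (φ : SuperMap 𝕜 p q p' q') (f : SFun 𝕜 p' q') : SFun 𝕜 p q := fun x =>
  ∑ A : Finset (Fin q'), ∑ k ∈ Finset.range (q + 1), ∑ i : Fin k → Fin p',
    (((k.factorial : 𝕜)⁻¹ *
        iteratedFDeriv ℝ k (fun x' => coeff A (f x')) (φ.bodyMap x) (fun l => Pi.single (i l) 1)) •
      ((List.ofFn fun l => soul (φ.even (i l) x)).prod * φ.oddMonomial A x))

/-- The composition "first `φ`, then `χ`". -/
def comp (χ : SuperMap 𝕜 p' q' p'' q'') (φ : SuperMap 𝕜 p q p' q') : SuperMap 𝕜 p q p'' q'' where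
  even i := φ.pullback (χ.even i)
  odd j := φ.pullback (χ.odd j)

/-- The identity map. -/
def id (𝕜 : Type*) [RCLike 𝕜] (p q : ℕ) : SuperMap 𝕜 p q p q where
  even i := fun x => algebraMap 𝕜 (Grassmann 𝕜 q) (x i : 𝕜)
  odd j := fun _ => oddGen j

/-- Two maps agree over `U`. -/
def EqOver (φ χ : SuperMap 𝕜 p q p' q') (U : Set (Fin p → ℝ)) : Prop :=
  (∀ i, Set.EqOn (φ.even i) (χ.even i) U) ∧ (∀ j, Set.EqOn (φ.odd j) (χ.odd j) U)

/-- `φ` is a smooth map from the superdomain over `U` to the superdomain over `V`. -/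
structure IsMorphism (φ : SuperMap 𝕜 p q p' q') (U : Set (Fin p → ℝ)) (V : Set (Fin p' → ℝ)) :
    Prop where
  isOpen_source : IsOpen U
  isOpen_target : IsOpen V
  smooth_even : ∀ i, SmoothOn (φ.even i) U
  smooth_odd : ∀ j, SmoothOn (φ.odd j) U
  real_even : ∀ i, ∀ x ∈ U, IsRealElt (φ.even i x)
  real_odd : ∀ j, ∀ x ∈ U, IsRealElt (φ.odd j x)
  parity_even : ∀ i, ∀ x ∈ U, HasParity 0 (φ.even i x)
  parity_odd : ∀ j, ∀ x ∈ U, HasParity 1 (φ.odd j x)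
  mapsTo : Set.MapsTo φ.bodyMap U V

/-- `φ` is a coordinate change: an isomorphism of the superdomain over `U` onto that over `V`. -/
def IsCoordChange (φ : SuperMap 𝕜 p q p q) (U V : Set (Fin p → ℝ)) : Prop :=
  φ.IsMorphism U V ∧ ∃ χ : SuperMap 𝕜 p q p q, χ.IsMorphism V U ∧
    (χ.comp φ).EqOver (SuperMap.id 𝕜 p q) U ∧ (φ.comp χ).EqOver (SuperMap.id 𝕜 p q) V

/-- The Jacobian supermatrix at `x`; rows are indexed by the old variables, columns by the new. -/
def jacobian (φ : SuperMap 𝕜 p q p' q') (x : Fin p → ℝ) :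
    Matrix (Fin p ⊕ Fin q) (Fin p' ⊕ Fin q') (Grassmann 𝕜 q) :=
  Matrix.fromBlocks
    (Matrix.of fun i j => evenDeriv i (φ.even j) x) (Matrix.of fun i j => evenDeriv i (φ.odd j) x)
    (Matrix.of fun i j => oddDeriv i (φ.even j) x) (Matrix.of fun i j => oddDeriv i (φ.odd j) x)

/-- The product `det(∂X/∂x) · det(∂Ξ/∂ξ)` at vanishing odd variables; this is the Jacobian
determinant of the map `(x, y) ↦ (X, Y)` induced between the bodies of the odd tangent bundles. -/
def orientationDet (φ : SuperMap 𝕜 p q p q) (x : Fin p → ℝ) : ℝ :=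
  (Matrix.of fun i j => RCLike.re (body (evenDeriv i (φ.even j) x))).det *
    (Matrix.of fun i j => RCLike.re (body (oddDeriv i (φ.odd j) x))).det

end SuperMap

section Berezinian

variable {R : Type*} [Ring R] {p q : ℕ}

/-- The determinant by the Leibniz formula, for a matrix whose entries commute with each other
(such as even elements of a Grassmann algebra) over a ring that need not be commutative. -/
def leibnizDet (A : Matrix (Fin p) (Fin p) R) : R :=
  ∑ σ : Equiv.Perm (Fin p), (Equiv.Perm.sign σ : ℤ) • (List.ofFn fun i => A (σ i) i).prod

/-- The Berezinian `det(A - B D⁻¹ C) · (det D)⁻¹` of the supermatrix with blocks `A B; C D`. -/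
def berezinian (S : Matrix (Fin p ⊕ Fin q) (Fin p ⊕ Fin q) R) : R :=
  leibnizDet (S.toBlocks₁₁ - S.toBlocks₁₂ * Ring.inverse S.toBlocks₂₂ * S.toBlocks₂₁) *
    Ring.inverse (leibnizDet S.toBlocks₂₂)

end Berezinian

section OddTangent

/-! The odd tangent bundle of an `m|n`-dimensional superdomain has the `m + n` even coordinates
`(x, y)` and the `n + m` odd coordinates `(ξ, ψ)`. -/

variable {𝕜 : Type*} [RCLike 𝕜] {m n : ℕ}

/-- The coordinates `x` of `(x, y)`. -/
def basePt (z : Fin (m + n) → ℝ) : Fin m → ℝ := fun i => z (Fin.castAdd n i)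

/-- The coordinates `y` of `(x, y)`. -/
def fibrePt (z : Fin (m + n) → ℝ) : Fin n → ℝ := fun j => z (Fin.natAdd m j)

/-- The points `(x, y)` with `x ∈ U`. -/
def tangentDomain (n : ℕ) (U : Set (Fin m → ℝ)) : Set (Fin (m + n) → ℝ) :=
  {z | basePt z ∈ U}

/-- A superfunction of `(x, ξ)`, regarded as a superfunction of `(x, y, ξ, ψ)`. -/
def liftFun (f : SFun 𝕜 m n) : SFun 𝕜 (m + n) (n + m) := fun z =>
  ExteriorAlgebra.map
    ((Pi.basisFun 𝕜 (Fin n)).constr 𝕜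
      (fun j => (Pi.single (Fin.castAdd m j) 1 : Fin (n + m) → 𝕜)))
    (f (basePt z))

/-- The de Rham differential `ψ^k ∂f/∂x^k + y^β ∂f/∂ξ^β` of a superfunction of `(x, ξ)`. -/
def dFun (f : SFun 𝕜 m n) : SFun 𝕜 (m + n) (n + m) := fun z =>
  ∑ k : Fin m, oddGen (Fin.natAdd n k) * liftFun (evenDeriv k f) z +
    ∑ b : Fin n, (fibrePt z b : 𝕜) • liftFun (oddDeriv b f) z

/-- The transformation `(x, ξ; ψ, y) ↦ (X, Ξ; Ψ, Y)` of the odd tangent bundle induced by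
`(x, ξ) ↦ (X, Ξ)`, with `Ψ^i = ψ^k ∂X^i/∂x^k + y^β ∂X^i/∂ξ^β` and
`Y^α = ψ^k ∂Ξ^α/∂x^k + y^β ∂Ξ^α/∂ξ^β`. -/
def SuperMap.oddTangent (φ : SuperMap 𝕜 m n m n) :
    SuperMap 𝕜 (m + n) (n + m) (m + n) (n + m) where
  even := Fin.addCases (fun i => liftFun (φ.even i)) (fun a => dFun (φ.odd a))
  odd := Fin.addCases (fun a => liftFun (φ.odd a)) (fun i => dFun (φ.even i))

/-- The coefficient of the top monomial `ξ^1 ⋯ ξ^n ψ^1 ⋯ ψ^m`. -/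
def topCoeff (f : SFun 𝕜 (m + n) (n + m)) : (Fin (m + n) → ℝ) → 𝕜 :=
  fun z => coeff Finset.univ (f z)

/-- The Berezin integral `∫ dx dξ ∫ dψ dy f(x, ξ, ψ, y)` over the odd tangent bundle of the
superdomain over `U`: Lebesgue integration in `(x, y)` of the top coefficient in `(ξ, ψ)`. -/
def berezinIntegral (U : Set (Fin m → ℝ)) (f : SFun 𝕜 (m + n) (n + m)) : 𝕜 :=
  ∫ z in tangentDomain n U, topCoeff f z

/-- `f` and all its derivatives decrease faster than any power of `y`, locally uniformly in
`x ∈ U`. -/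
def RapidlyDecreasing (U : Set (Fin m → ℝ)) (f : SFun 𝕜 (m + n) (n + m)) : Prop :=
  ∀ L ⊆ U, IsCompact L → ∀ (A : Finset (Fin (n + m))) (k l : ℕ), ∃ C : ℝ,
    ∀ z, basePt z ∈ L → ‖fibrePt z‖ ^ k * ‖iteratedFDeriv ℝ l (fun z' => coeff A (f z')) z‖ ≤ C

/-- A pseudodifferential form on the superdomain over `U` that is well behaved at infinity:
smooth, with compact support along the base, and rapidly decreasing in `y`. -/
structure IsDecayingForm (U : Set (Fin m → ℝ)) (f : SFun 𝕜 (m + n) (n + m)) : Prop where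
  smooth : SmoothOn f (tangentDomain n U)
  support : ∃ K ⊆ U, IsCompact K ∧ ∀ z, basePt z ∈ U \ K → f z = 0
  decay : RapidlyDecreasing U f

end OddTangent

/-- A smooth `m|n`-dimensional supermanifold with underlying space `M`, given by an atlas (of any
size) indexed by `I`: charts of `M` and, on overlaps, transition maps of superdomains
which lie over the transition maps of `M` and satisfy the cocycle condition. -/
structure Supermanifold (𝕜 : Type*) [RCLike 𝕜] (m n : ℕ) (M : Type*) [TopologicalSpace M]
    (I : Type*) where
  /-- the underlying charts of `M` -/
  chart : I → OpenPartialHomeomorph M (Fin m → ℝ)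
  /-- the coordinate change from chart `a` to chart `b` -/
  trans : I → I → SuperMap 𝕜 m n m n
  cover : ∀ P : M, ∃ a, P ∈ (chart a).source
  trans_morphism : ∀ a b, (trans a b).IsMorphism
    ((chart a).target ∩ (chart a).symm ⁻¹' (chart b).source)
    ((chart b).target ∩ (chart b).symm ⁻¹' (chart a).source)
  trans_body : ∀ a b, ∀ x ∈ (chart a).target ∩ (chart a).symm ⁻¹' (chart b).source,
    (trans a b).bodyMap x = chart b ((chart a).symm x)
  trans_self : ∀ a, (trans a a).EqOver (SuperMap.id 𝕜 m n) (chart a).target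
  trans_comp : ∀ a b c, ((trans b c).comp (trans a b)).EqOver (trans a c)
    ((chart a).target ∩ (chart a).symm ⁻¹' ((chart b).source ∩ (chart c).source))

namespace Supermanifold

variable {𝕜 : Type*} [RCLike 𝕜] {m n : ℕ} {M : Type*} [TopologicalSpace M] {I : Type*}

/-- The charts of the atlas are oriented coherently: every coordinate change preserves the
orientation of the even coordinates `(x, y)` of the odd tangent bundle. -/
def IsOriented (S : Supermanifold 𝕜 m n M I) : Prop :=
  ∀ a b, ∀ x ∈ (S.chart a).target ∩ (S.chart a).symm ⁻¹' (S.chart b).source,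
    0 < (S.trans a b).orientationDet x

/-- The coordinate expressions `f a` all vanish over the complement of `K`. -/
def VanishesOff (S : Supermanifold 𝕜 m n M I) (f : I → SFun 𝕜 (m + n) (n + m)) (K : Set M) : Prop :=
  ∀ a, ∀ z ∈ tangentDomain n (S.chart a).target, (S.chart a).symm (basePt z) ∉ K → f a z = 0

/-- `f`, given by its coordinate expressions `f a`, is a pseudodifferential form (a smooth function
on the odd tangent bundle). -/
structure IsForm (S : Supermanifold 𝕜 m n M I) (f : I → SFun 𝕜 (m + n) (n + m)) : Prop where
  smooth : ∀ a, SmoothOn (f a) (tangentDomain n (S.chart a).target)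
  compat : ∀ a b, Set.EqOn (f a) ((S.trans a b).oddTangent.pullback (f b))
    (tangentDomain n ((S.chart a).target ∩ (S.chart a).symm ⁻¹' (S.chart b).source))

/-- A pseudodifferential form with compact support along `M` that is rapidly decreasing along the
fibres of the odd tangent bundle. -/
structure IsDecayingForm (S : Supermanifold 𝕜 m n M I) (f : I → SFun 𝕜 (m + n) (n + m)) :
    Prop where
  isForm : S.IsForm f
  support : ∃ K : Set M, IsCompact K ∧ S.VanishesOff f K
  decay : ∀ a, RapidlyDecreasing (S.chart a).target (f a)

/-- The form `f` is supported in a compact subset of the domain of the chart `a`. -/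
def SupportedInChart (S : Supermanifold 𝕜 m n M I) (f : I → SFun 𝕜 (m + n) (n + m)) (a : I) :
    Prop :=
  ∃ K ⊆ (S.chart a).source, IsCompact K ∧ S.VanishesOff f K

/-- `c` is a value of the integral of `f`: for some way of writing `f` as a finite sum of forms
`g j`, each supported in the domain of some chart `a j`, it is the sum of the Berezin integrals
of the `g j`, computed in the coordinates of the charts `a j`. -/
def IsIntegral (S : Supermanifold 𝕜 m n M I) (f : I → SFun 𝕜 (m + n) (n + m)) (c : 𝕜) : Prop :=
  ∃ (N : ℕ) (a : Fin N → I) (g : Fin N → I → SFun 𝕜 (m + n) (n + m)),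
    (∀ j, S.IsDecayingForm (g j) ∧ S.SupportedInChart (g j) (a j)) ∧
    (∀ b, ∀ z ∈ tangentDomain n (S.chart b).target, f b z = ∑ j, g j b z) ∧
    c = ∑ j, berezinIntegral (S.chart (a j)).target (g j (a j))

end Supermanifold

end SuperGeom

end

/-! Substitution of coordinates is a homomorphism of the algebras of smooth superfunctions and obeys
the chain rule for even and odd derivatives (`IsMorphism.pullback_mul`,
`IsSuperDerivation.pullback`). Elements of order above the number of odd generators vanish, so two
superfunctions agree once their bodies agree and their odd derivatives agree to every order; this
gives functoriality of pullbacks (`IsMorphism.pullback_pullback`). On the odd tangent bundle the odd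
vector field d = ψ^k ∂/∂x^k + y^β ∂/∂ξ^β sends the base coordinates to the fibre coordinates and
annihilates the latter. The induced transformation Φ is built so that Φ* commutes with d
(`IsMorphism.oddTangent_pullback_deRham`), hence it depends functorially on the coordinate change,
and inverses go to inverses.

Berezinian. In the Jacobian of Φ each block of the Jacobian of (X, Ξ) occurs twice, once for the
base and once, with parity exchanged, for the fibre. The Schur complement and the odd-odd block are
block triangular, and the Berezinian reduces to det(1 + bc) · det(1 + cb) for matrices b, c with odd
entries. This product is 1 (`oddSwap`, by induction on the sizes).

Local invariance. The Berezinian is not used here. The form f is split into monomials. A monomial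
other than the top one lacks some odd generator and is therefore an odd derivative, so it suffices
that ∫ σ Φ*(∂f) = 0 for every odd ∂. Fibre derivatives transform into combinations of fibre
derivatives whose coefficients depend on the base only; their integrals vanish
(`IsInverse.berezinIntegral_vertical`). The remaining derivative ∂/∂ξ is the commutator of ∂/∂y with
d, and d commutes with Φ* and integrates to zero. What is left is the top monomial, where the
determinant of the odd components and the Jacobian of (x, y) ↦ (X, Y) are the same function; its
sign is σ, and the ordinary change of variables finishes the proof
(`IsInverse.berezinIntegral_pullback`).

Decay. The map (x, y) ↦ (X, Y) grows at most linearly in y, and so does its inverse, so rapid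
decrease is preserved (`IsInverse.isSchwartzOn_pullback`).

Globalization. Bump functions of a chart, pulled back as superfunctions, cut a form into pieces
supported in charts. Independence is the statement that pieces adding up to zero have integrals
adding up to zero (`sum_berezinIntegral_eq_zero`): multiplying by a cutoff equal to 1 near the
support of one piece moves a part of the sum into a single chart, and the rest has one piece fewer.
-/

open scoped ContDiff

noncomputable section

namespace SuperGeom

/-! ### The Grassmann algebra: parity, left derivatives, coefficients, order filtration. -/

section GrassmannAlgebra

variable {𝕜 : Type*} [RCLike 𝕜] {q q' : ℕ}

/-- The grade involution. -/
def gradeInv : Grassmann 𝕜 q →ₐ[𝕜] Grassmann 𝕜 q := CliffordAlgebra.involute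

/-- The left derivative in the `j`-th odd generator. -/
def leftDer (j : Fin q) : Grassmann 𝕜 q →ₗ[𝕜] Grassmann 𝕜 q :=
  CliffordAlgebra.contractLeft (LinearMap.proj j : Module.Dual 𝕜 (Fin q → 𝕜))

/-- The coefficient of a monomial as a linear functional. -/
def coeffₗ (A : Finset (Fin q)) : Grassmann 𝕜 q →ₗ[𝕜] 𝕜 := (monomialBasis 𝕜 q).coord A

theorem coeffₗ_apply (A : Finset (Fin q)) (w : Grassmann 𝕜 q) : coeffₗ A w = coeff A w := rfl

theorem sum_coeff_smul (w : Grassmann 𝕜 q) : ∑ A, coeff A w • monomialBasis 𝕜 q A = w :=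
  (monomialBasis 𝕜 q).sum_repr w

theorem coeff_ext {u w : Grassmann 𝕜 q} (h : ∀ A, coeff A u = coeff A w) : u = w :=
  (monomialBasis 𝕜 q).ext_elem h

@[simp] theorem coeff_add (A : Finset (Fin q)) (u w : Grassmann 𝕜 q) :
    coeff A (u + w) = coeff A u + coeff A w := map_add (coeffₗ A) u w

@[simp] theorem coeff_sub (A : Finset (Fin q)) (u w : Grassmann 𝕜 q) :
    coeff A (u - w) = coeff A u - coeff A w := map_sub (coeffₗ A) u w

@[simp] theorem coeff_zero (A : Finset (Fin q)) : coeff A (0 : Grassmann 𝕜 q) = 0 :=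
  map_zero (coeffₗ A)

@[simp] theorem coeff_smul (A : Finset (Fin q)) (c : 𝕜) (u : Grassmann 𝕜 q) :
    coeff A (c • u) = c * coeff A u := map_smul (coeffₗ A) c u

theorem coeff_zsmul (A : Finset (Fin q)) (c : ℤ) (u : Grassmann 𝕜 q) :
    coeff A (c • u) = c • coeff A u := map_zsmul (coeffₗ A) c u

theorem coeff_sum (A : Finset (Fin q)) {ι : Type*} (s : Finset ι) (u : ι → Grassmann 𝕜 q) :
    coeff A (∑ i ∈ s, u i) = ∑ i ∈ s, coeff A (u i) := map_sum (coeffₗ A) u s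

theorem coeff_monomialBasis (A B : Finset (Fin q)) :
    coeff A (monomialBasis 𝕜 q B) = if B = A then 1 else 0 := by
  simp only [coeff, Module.Basis.repr_self]
  exact Finsupp.single_apply

theorem linear_apply_eq_sum {V : Type*} [AddCommGroup V] [Module 𝕜 V]
    (l : Grassmann 𝕜 q →ₗ[𝕜] V) (w : Grassmann 𝕜 q) :
    l w = ∑ A, coeff A w • l (monomialBasis 𝕜 q A) := by
  conv_lhs => rw [← sum_coeff_smul w]
  simp only [map_sum, map_smul]

theorem monomialBasis_eq_prod (A : Finset (Fin q)) :
    monomialBasis 𝕜 q A = ((A.sort (· ≤ ·)).map oddGen).prod := by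
  unfold monomialBasis
  rw [ExteriorAlgebra.basis_apply]
  change ExteriorAlgebra.ιMulti 𝕜 A.card _ = _
  rw [ExteriorAlgebra.ιMulti_apply]
  congr 1
  apply List.ext_getElem
  · simp
  · intro i h1 h2
    simp [oddGen]
    rfl

@[simp] theorem gradeInv_gradeInv (w : Grassmann 𝕜 q) : gradeInv (gradeInv w) = w :=
  CliffordAlgebra.involute_involute w

theorem gradeInv_ι (v : Fin q → 𝕜) :
    gradeInv (ExteriorAlgebra.ι 𝕜 v) = -ExteriorAlgebra.ι 𝕜 v :=
  CliffordAlgebra.involute_ι v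

@[simp] theorem gradeInv_oddGen (j : Fin q) : gradeInv (oddGen j : Grassmann 𝕜 q) = -oddGen j :=
  gradeInv_ι _

theorem ι_eq_sum (v : Fin q → 𝕜) : ExteriorAlgebra.ι 𝕜 v = ∑ j, v j • (oddGen j : Grassmann 𝕜 q) := by
  conv_lhs => rw [pi_eq_sum_univ' v]
  simp only [map_sum, map_smul, oddGen]

/-- Induction along multiplication by generators on the left. -/
theorem grassmann_induction {P : Grassmann 𝕜 q → Prop} (one : P 1)
    (add : ∀ u w, P u → P w → P (u + w)) (smul : ∀ (c : 𝕜) u, P u → P (c • u))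
    (gen_mul : ∀ j u, P u → P (oddGen j * u)) (w : Grassmann 𝕜 q) : P w := by
  have zero : P 0 := by simpa using smul 0 1 one
  refine CliffordAlgebra.left_induction (Q := 0) (P := P) (fun r => ?_) add ?_ w
  · rw [Algebra.algebraMap_eq_smul_one]; exact smul r 1 one
  · intro x v hx
    have : CliffordAlgebra.ι (0 : QuadraticForm 𝕜 (Fin q → 𝕜)) v = ∑ j, v j • (oddGen j : Grassmann 𝕜 q) := ι_eq_sum v
    rw [this, Finset.sum_mul]
    refine Finset.sum_induction _ P add zero fun j _ => ?_
    rw [smul_mul_assoc]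
    exact smul _ _ (gen_mul j x hx)

theorem leftDer_oddGen_mul (i j : Fin q) (w : Grassmann 𝕜 q) :
    leftDer i (oddGen j * w) = (if i = j then w else 0) - oddGen j * leftDer i w := by
  have := CliffordAlgebra.contractLeft_ι_mul (Q := (0 : QuadraticForm 𝕜 (Fin q → 𝕜)))
    (LinearMap.proj i : Module.Dual 𝕜 (Fin q → 𝕜)) (Pi.single j 1) w
  refine this.trans ?_
  congr 1
  by_cases h : i = j
  · subst h; simp
  · simp [h]

@[simp] theorem leftDer_one (i : Fin q) : leftDer i (1 : Grassmann 𝕜 q) = 0 :=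
  CliffordAlgebra.contractLeft_one (Q := 0) (LinearMap.proj i : Module.Dual 𝕜 (Fin q → 𝕜))

@[simp] theorem leftDer_algebraMap (i : Fin q) (c : 𝕜) :
    leftDer i (algebraMap 𝕜 (Grassmann 𝕜 q) c) = 0 :=
  CliffordAlgebra.contractLeft_algebraMap (Q := 0) (LinearMap.proj i : Module.Dual 𝕜 (Fin q → 𝕜)) c

theorem leftDer_oddGen (i j : Fin q) :
    leftDer i (oddGen j : Grassmann 𝕜 q) = if i = j then 1 else 0 := by
  have := leftDer_oddGen_mul i j (1 : Grassmann 𝕜 q)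
  simpa using this

theorem leftDer_comm (i j : Fin q) (w : Grassmann 𝕜 q) :
    leftDer i (leftDer j w) = -leftDer j (leftDer i w) :=
  CliffordAlgebra.contractLeft_comm _ _ _

theorem leftDer_mul (i : Fin q) (u w : Grassmann 𝕜 q) :
    leftDer i (u * w) = leftDer i u * w + gradeInv u * leftDer i w := by
  induction u using grassmann_induction with
  | one => simp
  | add u v hu hv => simp only [add_mul, map_add, hu, hv]; abel
  | smul c u hu => simp only [smul_mul_assoc, map_smul, hu, smul_add]
  | gen_mul j u hu =>
    rw [mul_assoc, leftDer_oddGen_mul, hu, leftDer_oddGen_mul, map_mul, gradeInv_oddGen]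
    split_ifs <;> noncomm_ring

theorem leftDer_gradeInv (i : Fin q) (w : Grassmann 𝕜 q) :
    leftDer i (gradeInv w) = -gradeInv (leftDer i w) := by
  induction w using grassmann_induction with
  | one => simp
  | add u v hu hv => simp only [map_add, hu, hv]; abel
  | smul c u hu => simp only [map_smul, hu, smul_neg]
  | gen_mul j u hu =>
    rw [map_mul, leftDer_mul, hu, leftDer_mul]
    simp only [gradeInv_oddGen, map_neg, map_add, map_mul, leftDer_oddGen]
    split_ifs <;> simp [add_comm]

theorem eq_zero_of_eq_neg {w : Grassmann 𝕜 q} (h : w = -w) : w = 0 := by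
  have h2 : (2 : 𝕜) • w = 0 := by
    rw [two_smul]
    exact add_eq_zero_iff_eq_neg.2 h
  exact (smul_eq_zero.1 h2).resolve_left two_ne_zero

/-- Splitting into even and odd parts, the involution negates the odd part, which vanishes since 2
is invertible. Parity thus becomes an equation for the involution, in which form it is used
throughout. -/
theorem hasParity_zero_iff {w : Grassmann 𝕜 q} : HasParity 0 w ↔ gradeInv w = w := by
  refine ⟨CliffordAlgebra.involute_eq_of_mem_even, fun h => ?_⟩
  obtain ⟨a, ha, b, hb, rfl⟩ := Submodule.mem_sup.1
    ((CliffordAlgebra.evenOdd_isCompl (0 : QuadraticForm 𝕜 (Fin q → 𝕜))).sup_eq_top ▸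
      Submodule.mem_top (x := w))
  rw [map_add, show gradeInv a = a from CliffordAlgebra.involute_eq_of_mem_even ha,
    show gradeInv b = -b from CliffordAlgebra.involute_eq_of_mem_odd hb] at h
  have hb0 : b = 0 := eq_zero_of_eq_neg (add_left_cancel h).symm
  rw [hb0, add_zero]; exact ha

theorem hasParity_one_iff {w : Grassmann 𝕜 q} : HasParity 1 w ↔ gradeInv w = -w := by
  refine ⟨CliffordAlgebra.involute_eq_of_mem_odd, fun h => ?_⟩
  obtain ⟨a, ha, b, hb, rfl⟩ := Submodule.mem_sup.1
    ((CliffordAlgebra.evenOdd_isCompl (0 : QuadraticForm 𝕜 (Fin q → 𝕜))).sup_eq_top ▸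
      Submodule.mem_top (x := w))
  rw [map_add, show gradeInv a = a from CliffordAlgebra.involute_eq_of_mem_even ha,
    show gradeInv b = -b from CliffordAlgebra.involute_eq_of_mem_odd hb, neg_add] at h
  have ha0 : a = 0 := eq_zero_of_eq_neg (add_right_cancel h)
  rw [ha0, zero_add]; exact hb

theorem mul_oddGen (j : Fin q) (w : Grassmann 𝕜 q) : w * oddGen j = oddGen j * gradeInv w := by
  induction w using grassmann_induction with
  | one => simp
  | add u v hu hv => simp only [add_mul, map_add, hu, hv, mul_add]
  | smul c u hu => simp only [smul_mul_assoc, map_smul, hu, mul_smul_comm]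
  | gen_mul i u hu =>
    have h : (oddGen i * oddGen j : Grassmann 𝕜 q) = -(oddGen j * oddGen i) :=
      eq_neg_of_add_eq_zero_left (ExteriorAlgebra.ι_add_mul_swap _ _)
    rw [mul_assoc, hu, map_mul, gradeInv_oddGen, ← mul_assoc, h]
    noncomm_ring

theorem oddGen_mul_self (j : Fin q) : (oddGen j * oddGen j : Grassmann 𝕜 q) = 0 :=
  ExteriorAlgebra.ι_sq_zero _

theorem mul_comm_of_even {u : Grassmann 𝕜 q} (hu : gradeInv u = u) (w : Grassmann 𝕜 q) :
    u * w = w * u := by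
  induction w using grassmann_induction with
  | one => simp
  | add v w hv hw => simp only [add_mul, mul_add, hv, hw]
  | smul c w hw => simp only [smul_mul_assoc, hw, mul_smul_comm]
  | gen_mul i w hw => rw [← mul_assoc, mul_oddGen, hu, mul_assoc, hw, mul_assoc]

/-- Supercommutativity need only be checked against generators, where it is `mul_oddGen`. The sign
is carried by the involution of the other factor, so that factor need not be homogeneous. -/
theorem mul_comm_of_odd {u : Grassmann 𝕜 q} (hu : gradeInv u = -u) (w : Grassmann 𝕜 q) :
    u * w = gradeInv w * u := by
  induction w using grassmann_induction with
  | one => simp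
  | add v w hv hw => simp only [add_mul, mul_add, hv, hw, map_add]
  | smul c w hw => simp only [smul_mul_assoc, hw, mul_smul_comm, map_smul]
  | gen_mul i w hw =>
    rw [← mul_assoc, mul_oddGen, hu, mul_assoc, neg_mul, hw, map_mul, gradeInv_oddGen]
    noncomm_ring

theorem body_oddGen (j : Fin q) : body (oddGen j : Grassmann 𝕜 q) = 0 := by
  simp [body, oddGen, ExteriorAlgebra.algebraMapInv]

/-- The body as an algebra homomorphism. -/
def bodyₐ : Grassmann 𝕜 q →ₐ[𝕜] 𝕜 := ExteriorAlgebra.algebraMapInv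

theorem bodyₐ_apply (w : Grassmann 𝕜 q) : bodyₐ w = body w := rfl

@[simp] theorem body_add (u w : Grassmann 𝕜 q) : body (u + w) = body u + body w :=
  map_add bodyₐ u w
@[simp] theorem body_mul (u w : Grassmann 𝕜 q) : body (u * w) = body u * body w :=
  map_mul bodyₐ u w
@[simp] theorem body_one : body (1 : Grassmann 𝕜 q) = 1 := map_one bodyₐ
@[simp] theorem body_zero : body (0 : Grassmann 𝕜 q) = 0 := map_zero bodyₐ
@[simp] theorem body_smul (c : 𝕜) (u : Grassmann 𝕜 q) : body (c • u) = c * body u :=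
  map_smul bodyₐ c u
@[simp] theorem body_algebraMap (c : 𝕜) : body (algebraMap 𝕜 (Grassmann 𝕜 q) c) = c :=
  bodyₐ.commutes c
theorem body_sum {ι : Type*} (s : Finset ι) (u : ι → Grassmann 𝕜 q) :
    body (∑ i ∈ s, u i) = ∑ i ∈ s, body (u i) := map_sum bodyₐ u s

theorem body_gradeInv (w : Grassmann 𝕜 q) : body (gradeInv w) = body w := by
  induction w using grassmann_induction with
  | one => simp
  | add v w hv hw => simp [hv, hw]
  | smul c w hw => simp [hw]
  | gen_mul i w hw =>
    rw [map_mul, body_mul, body_mul, gradeInv_oddGen, ← neg_one_smul 𝕜 (oddGen i), body_smul,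
      body_oddGen]
    simp

theorem monomialBasis_empty : monomialBasis 𝕜 q ∅ = 1 := by
  simp [monomialBasis_eq_prod]

theorem body_monomialBasis (A : Finset (Fin q)) :
    body (monomialBasis 𝕜 q A) = if A = ∅ then 1 else 0 := by
  split_ifs with h
  · simp [h, monomialBasis_empty]
  · rw [monomialBasis_eq_prod]
    rcases hl : A.sort (· ≤ ·) with _ | ⟨a, l⟩
    · exact absurd (by simpa using congrArg List.toFinset hl) h
    · simp [body_oddGen]

theorem coeff_empty (w : Grassmann 𝕜 q) : coeff ∅ w = body w := by
  rw [← bodyₐ_apply, ← AlgHom.toLinearMap_apply, linear_apply_eq_sum]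
  simp [bodyₐ_apply, body_monomialBasis]

theorem coeff_algebraMap (A : Finset (Fin q)) (c : 𝕜) :
    coeff A (algebraMap 𝕜 (Grassmann 𝕜 q) c) = if A = ∅ then c else 0 := by
  rw [Algebra.algebraMap_eq_smul_one, ← monomialBasis_empty, coeff_smul, coeff_monomialBasis]
  simp [eq_comm]

/-- Only the existence of a sign is recorded. Its value is never needed below. -/
theorem prod_oddGen_perm {l l' : List (Fin q)} (h : l.Perm l') :
    ∃ e : ℤˣ, ((l.map oddGen).prod : Grassmann 𝕜 q) = e • (l'.map oddGen).prod := by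
  induction h with
  | nil => exact ⟨1, by simp⟩
  | cons x _ ih =>
    obtain ⟨e, he⟩ := ih
    exact ⟨e, by simp only [List.map_cons, List.prod_cons, he, mul_smul_comm]⟩
  | swap x y l =>
    refine ⟨-1, ?_⟩
    simp only [List.map_cons, List.prod_cons, ← mul_assoc]
    rw [mul_oddGen, gradeInv_oddGen]
    simp
  | trans _ _ ih1 ih2 =>
    obtain ⟨e, he⟩ := ih1
    obtain ⟨e', he'⟩ := ih2
    exact ⟨e * e', by rw [he, he', mul_smul]⟩

theorem exists_oddGen_mul_monomialBasis {j : Fin q} {A : Finset (Fin q)} (h : j ∉ A) :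
    ∃ e : ℤˣ, oddGen j * monomialBasis 𝕜 q A = e • monomialBasis 𝕜 q (insert j A) := by
  have hp : (j :: A.sort (· ≤ ·)).Perm ((insert j A).sort (· ≤ ·)) := by
    rw [List.perm_ext_iff_of_nodup]
    · simp
    · simp [h]
    · simp
  obtain ⟨e, he⟩ := prod_oddGen_perm (𝕜 := 𝕜) hp
  exact ⟨e, by simpa [monomialBasis_eq_prod] using he⟩

theorem leftDer_monomialBasis_of_notMem {j : Fin q} {A : Finset (Fin q)} (h : j ∉ A) :
    leftDer j (monomialBasis 𝕜 q A) = 0 := by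
  rw [monomialBasis_eq_prod]
  have : ∀ l : List (Fin q), j ∉ l → leftDer j ((l.map oddGen).prod : Grassmann 𝕜 q) = 0 := by
    intro l
    induction l with
    | nil => simp
    | cons a l ih =>
      intro hl
      simp only [List.mem_cons, not_or] at hl
      simp [leftDer_oddGen_mul, hl.1, ih hl.2]
  exact this _ (by simpa using h)

theorem exists_leftDer_monomialBasis {j : Fin q} {A : Finset (Fin q)} (h : j ∉ A) :
    ∃ e : ℤˣ, leftDer j (monomialBasis 𝕜 q (insert j A)) = e • monomialBasis 𝕜 q A := by
  obtain ⟨e, he⟩ := exists_oddGen_mul_monomialBasis (𝕜 := 𝕜) h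
  refine ⟨e⁻¹, ?_⟩
  have := congrArg (fun w => e⁻¹ • leftDer j w) he
  simp only [leftDer_oddGen_mul, leftDer_monomialBasis_of_notMem h] at this
  rw [Units.smul_def e, map_zsmul, ← Units.smul_def, inv_smul_smul] at this
  simpa using this.symm

theorem leftDer_oddGen_mul_monomialBasis {j : Fin q} {A : Finset (Fin q)} (h : j ∉ A) :
    leftDer j (oddGen j * monomialBasis 𝕜 q A) = monomialBasis 𝕜 q A := by
  simp [leftDer_oddGen_mul, leftDer_monomialBasis_of_notMem h]

theorem coeff_leftDer_of_mem {j : Fin q} {A : Finset (Fin q)} (h : j ∈ A) (w : Grassmann 𝕜 q) :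
    coeff A (leftDer j w) = 0 := by
  rw [← coeffₗ_apply, ← LinearMap.comp_apply, linear_apply_eq_sum]
  refine Finset.sum_eq_zero fun B _ => ?_
  rw [LinearMap.comp_apply, coeffₗ_apply]
  by_cases hB : j ∈ B
  · obtain ⟨e, he⟩ := exists_leftDer_monomialBasis (𝕜 := 𝕜) (Finset.notMem_erase j B)
    rw [Finset.insert_erase hB] at he
    rw [he, Units.smul_def, coeff_zsmul, coeff_monomialBasis, if_neg]
    · simp
    · rintro rfl; simp at h
  · simp [leftDer_monomialBasis_of_notMem hB]

theorem exists_coeff_leftDer {j : Fin q} {A : Finset (Fin q)} (h : j ∉ A) :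
    ∃ e : ℤˣ, ∀ w : Grassmann 𝕜 q, coeff A (leftDer j w) = e • coeff (insert j A) w := by
  obtain ⟨e, he⟩ := exists_leftDer_monomialBasis (𝕜 := 𝕜) h
  refine ⟨e, fun w => ?_⟩
  rw [← coeffₗ_apply, ← LinearMap.comp_apply, linear_apply_eq_sum,
    Finset.sum_eq_single (insert j A)]
  · rw [LinearMap.comp_apply, he, Units.smul_def, Units.smul_def, map_zsmul, coeffₗ_apply,
      coeff_monomialBasis]
    simp [mul_comm]
  · intro B _ hB
    rw [LinearMap.comp_apply, coeffₗ_apply]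
    by_cases hjB : j ∈ B
    · obtain ⟨e', he'⟩ := exists_leftDer_monomialBasis (𝕜 := 𝕜) (Finset.notMem_erase j B)
      rw [Finset.insert_erase hjB] at he'
      rw [he', Units.smul_def, coeff_zsmul, coeff_monomialBasis, if_neg]
      · simp
      · rintro rfl; exact hB (by rw [Finset.insert_erase hjB])
    · simp [leftDer_monomialBasis_of_notMem hjB]
  · simp

/-- The elements of order at least `k` in the odd generators. -/
def orderGE : ℕ → Submodule 𝕜 (Grassmann 𝕜 q)
  | 0 => ⊤
  | k + 1 => LinearMap.ker bodyₐ.toLinearMap ⊓ ⨅ j, (orderGE k).comap (leftDer j)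

/-- The order is measured by derivatives and not by monomials, so that a bound on the order of a
difference of superfunctions follows from a comparison of bodies together with the chain rule. -/
theorem mem_orderGE_succ {k : ℕ} {w : Grassmann 𝕜 q} :
    w ∈ orderGE (k + 1) ↔ body w = 0 ∧ ∀ j, leftDer j w ∈ orderGE k := by
  simp [orderGE, Submodule.mem_iInf, bodyₐ_apply]

theorem mem_orderGE_zero (w : Grassmann 𝕜 q) : w ∈ orderGE 0 := Submodule.mem_top

theorem mem_orderGE_one {w : Grassmann 𝕜 q} : w ∈ orderGE 1 ↔ body w = 0 := by
  simp [mem_orderGE_succ, mem_orderGE_zero]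

theorem orderGE_succ_le (k : ℕ) : (orderGE (k + 1) : Submodule 𝕜 (Grassmann 𝕜 q)) ≤ orderGE k := by
  induction k with
  | zero => intro w _; exact mem_orderGE_zero w
  | succ k ih =>
    intro w hw
    rw [mem_orderGE_succ] at hw ⊢
    exact ⟨hw.1, fun j => ih (hw.2 j)⟩

theorem orderGE_antitone : Antitone (orderGE : ℕ → Submodule 𝕜 (Grassmann 𝕜 q)) :=
  antitone_nat_of_succ_le orderGE_succ_le

theorem gradeInv_mem_orderGE {k : ℕ} {w : Grassmann 𝕜 q} (h : w ∈ orderGE k) :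
    gradeInv w ∈ orderGE k := by
  induction k generalizing w with
  | zero => exact mem_orderGE_zero _
  | succ k ih =>
    rw [mem_orderGE_succ] at h ⊢
    refine ⟨by rw [body_gradeInv, h.1], fun j => ?_⟩
    rw [leftDer_gradeInv]
    exact Submodule.neg_mem _ (ih (h.2 j))

/-- Induction on the total order: by the Leibniz rule a left derivative lowers the order of one
factor by one, and the involution preserves orders. -/
theorem mul_mem_orderGE {k l : ℕ} {u w : Grassmann 𝕜 q} (hu : u ∈ orderGE k)
    (hw : w ∈ orderGE l) : u * w ∈ orderGE (k + l) := by
  induction h : k + l generalizing k l u w with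
  | zero => exact mem_orderGE_zero _
  | succ n ih =>
    rw [mem_orderGE_succ]
    constructor
    · rcases k with _ | k
      · rcases l with _ | l
        · simp at h
        · rw [body_mul, (mem_orderGE_succ.1 hw).1, mul_zero]
      · rw [body_mul, (mem_orderGE_succ.1 hu).1, zero_mul]
    · intro j
      rw [leftDer_mul]
      refine Submodule.add_mem _ ?_ ?_
      · rcases k with _ | k
        · have := ih (k := 0) (l := n) (mem_orderGE_zero (leftDer j u))
            (orderGE_antitone (by lia) hw) (by lia)
          exact this
        · exact ih ((mem_orderGE_succ.1 hu).2 j) hw (by lia)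
      · rcases l with _ | l
        · exact ih (k := n) (l := 0) (orderGE_antitone (by lia) (gradeInv_mem_orderGE hu))
            (mem_orderGE_zero _) (by lia)
        · exact ih (gradeInv_mem_orderGE hu) ((mem_orderGE_succ.1 hw).2 j) (by lia)

/-- Up to sign, the coefficient of a monomial is obtained by deriving away its generators one at a
time and taking the body at the end. -/
theorem coeff_eq_zero_of_mem_orderGE {k : ℕ} {w : Grassmann 𝕜 q} (h : w ∈ orderGE k)
    {A : Finset (Fin q)} (hA : A.card < k) : coeff A w = 0 := by
  induction A using Finset.induction generalizing k w with
  | empty =>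
    obtain ⟨k, rfl⟩ : ∃ l, k = l + 1 := ⟨k - 1, by simp at hA; lia⟩
    rw [coeff_empty, (mem_orderGE_succ.1 h).1]
  | insert j A hj ih =>
    rw [Finset.card_insert_of_notMem hj] at hA
    obtain ⟨k, rfl⟩ : ∃ l, k = l + 1 := ⟨k - 1, by lia⟩
    obtain ⟨e, he⟩ := exists_coeff_leftDer (𝕜 := 𝕜) hj
    have := ih ((mem_orderGE_succ.1 h).2 j) (by lia)
    rw [he] at this
    exact (smul_eq_zero_iff_eq e).1 this

theorem eq_zero_of_mem_orderGE {k : ℕ} (hk : q < k) {w : Grassmann 𝕜 q} (h : w ∈ orderGE k) :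
    w = 0 :=
  coeff_ext fun A => by
    rw [coeff_eq_zero_of_mem_orderGE h (lt_of_le_of_lt (by simpa using A.card_le_univ) hk),
      coeff_zero]

theorem prod_mem_orderGE {l : List (Grassmann 𝕜 q)} (h : ∀ w ∈ l, body w = 0) :
    l.prod ∈ orderGE l.length := by
  induction l with
  | nil => exact mem_orderGE_zero _
  | cons a l ih =>
    rw [List.prod_cons, List.length_cons, add_comm]
    exact mul_mem_orderGE (mem_orderGE_one.2 (h a (by simp))) (ih fun w hw => h w (by simp [hw]))

theorem body_soul (w : Grassmann 𝕜 q) : body (soul w) = 0 := by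
  have := map_sub bodyₐ w (algebraMap 𝕜 (Grassmann 𝕜 q) (body w))
  rw [bodyₐ_apply, bodyₐ_apply, bodyₐ_apply, body_algebraMap, sub_self] at this
  exact this

theorem body_eq_zero_of_odd {w : Grassmann 𝕜 q} (h : gradeInv w = -w) : body w = 0 := by
  have h1 := body_gradeInv w
  rw [h, ← bodyₐ_apply, map_neg, ← bodyₐ_apply] at h1
  exact self_eq_neg.1 h1.symm

end GrassmannAlgebra

/-! ### Smooth superfunctions and their derivatives. -/

section Calculus

open Topology

variable {𝕜 : Type*} [RCLike 𝕜] {p q p' q' : ℕ} {U : Set (Fin p → ℝ)} {x : Fin p → ℝ}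
  {f g : SFun 𝕜 p q}

theorem oddDeriv_apply (j : Fin q) (f : SFun 𝕜 p q) (x : Fin p → ℝ) :
    oddDeriv j f x = leftDer j (f x) := rfl

theorem coeff_evenDeriv (A : Finset (Fin q)) (i : Fin p) (f : SFun 𝕜 p q) (x : Fin p → ℝ) :
    coeff A (evenDeriv i f x) = fderiv ℝ (fun x' => coeff A (f x')) x (Pi.single i 1) := by
  rw [evenDeriv, coeff_sum, Finset.sum_eq_single A]
  · simp [coeff_monomialBasis]
  · intro B _ hB
    simp [coeff_monomialBasis, hB]
  · simp

/-- With these structure constants, smoothness of products and the product rule reduce to the scalar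
case. -/
theorem coeff_mul_eq_sum (C : Finset (Fin q)) (u w : Grassmann 𝕜 q) :
    coeff C (u * w) = ∑ A, ∑ B, coeff A u * coeff B w *
      coeff C (monomialBasis 𝕜 q A * monomialBasis 𝕜 q B) := by
  conv_lhs => rw [← sum_coeff_smul u, ← sum_coeff_smul w]
  simp only [Finset.sum_mul_sum, coeff_sum, smul_mul_smul_comm, coeff_smul]

theorem SmoothOn.contDiffAt (hf : SmoothOn f U) (hU : IsOpen U) (hx : x ∈ U)
    (A : Finset (Fin q)) : ContDiffAt ℝ ∞ (fun x' => coeff A (f x')) x :=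
  (hf A).contDiffAt (hU.mem_nhds hx)

theorem SmoothOn.differentiableAt (hf : SmoothOn f U) (hU : IsOpen U) (hx : x ∈ U)
    (A : Finset (Fin q)) : DifferentiableAt ℝ (fun x' => coeff A (f x')) x :=
  (hf.contDiffAt hU hx A).differentiableAt (by simp)

theorem SmoothOn.mono {V : Set (Fin p → ℝ)} (hf : SmoothOn f U) (h : V ⊆ U) : SmoothOn f V :=
  fun A => (hf A).mono h

theorem SmoothOn.congr (hf : SmoothOn f U) (h : Set.EqOn g f U) : SmoothOn g U :=
  fun A => (hf A).congr fun x hx => by rw [h hx]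

theorem SmoothOn.functional (hf : SmoothOn f U) (l : Grassmann 𝕜 q →ₗ[𝕜] 𝕜) :
    ContDiffOn ℝ ∞ (fun x => l (f x)) U := by
  have : (fun x => l (f x)) = fun x => ∑ A, coeff A (f x) * l (monomialBasis 𝕜 q A) := by
    funext x; exact linear_apply_eq_sum l (f x)
  rw [this]
  exact ContDiffOn.sum fun A _ => (hf A).mul contDiffOn_const

theorem SmoothOn.linear (hf : SmoothOn f U) (l : Grassmann 𝕜 q →ₗ[𝕜] Grassmann 𝕜 q') :
    SmoothOn (fun x => l (f x)) U :=
  fun A => hf.functional (coeffₗ A ∘ₗ l)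

theorem SmoothOn.body (hf : SmoothOn f U) : ContDiffOn ℝ ∞ (fun x => body (f x)) U :=
  hf.functional bodyₐ.toLinearMap

theorem smoothOn_const (w : Grassmann 𝕜 q) : SmoothOn (fun _ => w) U :=
  fun _ => contDiffOn_const

theorem SmoothOn.add (hf : SmoothOn f U) (hg : SmoothOn g U) :
    SmoothOn (fun x => f x + g x) U :=
  fun A => by simpa only [coeff_add] using (hf A).add (hg A)

theorem SmoothOn.sub (hf : SmoothOn f U) (hg : SmoothOn g U) :
    SmoothOn (fun x => f x - g x) U :=
  fun A => by simpa only [coeff_sub] using (hf A).sub (hg A)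

theorem SmoothOn.sum {ι : Type*} {s : Finset ι} {F : ι → SFun 𝕜 p q}
    (h : ∀ i ∈ s, SmoothOn (F i) U) : SmoothOn (fun x => ∑ i ∈ s, F i x) U :=
  fun A => by simpa only [coeff_sum] using ContDiffOn.sum fun i hi => h i hi A

theorem SmoothOn.smul {c : (Fin p → ℝ) → 𝕜} (hc : ContDiffOn ℝ ∞ c U) (hf : SmoothOn f U) :
    SmoothOn (fun x => c x • f x) U :=
  fun A => by simpa only [coeff_smul] using hc.mul (hf A)

theorem SmoothOn.mul (hf : SmoothOn f U) (hg : SmoothOn g U) :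
    SmoothOn (fun x => f x * g x) U := fun C => by
  rw [show (fun x => coeff C (f x * g x)) = _ from funext fun x => coeff_mul_eq_sum C (f x) (g x)]
  exact ContDiffOn.sum fun A _ => ContDiffOn.sum fun B _ => ((hf A).mul (hg B)).mul contDiffOn_const

theorem SmoothOn.algebraMap {c : (Fin p → ℝ) → 𝕜} (hc : ContDiffOn ℝ ∞ c U) :
    SmoothOn (fun x => algebraMap 𝕜 (Grassmann 𝕜 q) (c x)) U := by
  simpa only [Algebra.algebraMap_eq_smul_one] using SmoothOn.smul hc (smoothOn_const 1)

theorem SmoothOn.list_prod {F : List (SFun 𝕜 p q)} (h : ∀ f ∈ F, SmoothOn f U) :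
    SmoothOn (fun x => (F.map fun f => f x).prod) U := by
  induction F with
  | nil => exact smoothOn_const 1
  | cons a l ih =>
    simp only [List.map_cons, List.prod_cons]
    exact (h a (by simp)).mul (ih fun f hf => h f (by simp [hf]))

theorem SmoothOn.evenDeriv (hf : SmoothOn f U) (hU : IsOpen U) (i : Fin p) :
    SmoothOn (evenDeriv i f) U := fun A => by
  simp only [coeff_evenDeriv]
  exact ((hf A).fderiv_of_isOpen hU (by simp)).clm_apply contDiffOn_const

theorem SmoothOn.oddDeriv (hf : SmoothOn f U) (j : Fin q) : SmoothOn (oddDeriv j f) U :=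
  hf.linear (leftDer j)

theorem evenDeriv_congr_nhds (h : f =ᶠ[𝓝 x] g) (i : Fin p) : evenDeriv i f x = evenDeriv i g x :=
  coeff_ext fun A => by
    rw [coeff_evenDeriv, coeff_evenDeriv, Filter.EventuallyEq.fderiv_eq]
    filter_upwards [h] with y hy
    rw [hy]

theorem evenDeriv_congr (hU : IsOpen U) (h : Set.EqOn f g U) (i : Fin p) :
    Set.EqOn (evenDeriv i f) (evenDeriv i g) U := fun _ hx =>
  evenDeriv_congr_nhds (Filter.eventuallyEq_of_mem (hU.mem_nhds hx) h) i

theorem functional_evenDeriv (hU : IsOpen U) (hf : SmoothOn f U) (hx : x ∈ U)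
    (l : Grassmann 𝕜 q →ₗ[𝕜] 𝕜) (i : Fin p) :
    l (evenDeriv i f x) = fderiv ℝ (fun x' => l (f x')) x (Pi.single i 1) := by
  have : (fun x => l (f x)) = fun x => ∑ A, coeff A (f x) * l (monomialBasis 𝕜 q A) := by
    funext x; exact linear_apply_eq_sum l (f x)
  rw [this, linear_apply_eq_sum,
    fderiv_fun_sum fun A _ => (hf.differentiableAt hU hx A).mul_const _]
  simp only [FunLike.coe_sum, Finset.sum_apply]
  refine Finset.sum_congr rfl fun A _ => ?_
  rw [fderiv_mul_const (hf.differentiableAt hU hx A), coeff_evenDeriv]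
  simp [mul_comm]

/-- A fixed linear map has constant coefficients. Taking it to be a left derivative, the involution,
or multiplication by a generator shows that even derivatives commute with all of these. -/
theorem linear_evenDeriv (hU : IsOpen U) (hf : SmoothOn f U) (hx : x ∈ U)
    (l : Grassmann 𝕜 q →ₗ[𝕜] Grassmann 𝕜 q') (i : Fin p) :
    l (evenDeriv i f x) = evenDeriv i (fun x' => l (f x')) x :=
  coeff_ext fun A => by
    rw [coeff_evenDeriv]
    exact functional_evenDeriv hU hf hx (coeffₗ A ∘ₗ l) i

theorem evenDeriv_const (i : Fin p) (w : Grassmann 𝕜 q) :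
    evenDeriv i (fun _ => w) x = 0 :=
  coeff_ext fun A => by rw [coeff_evenDeriv]; simp

theorem evenDeriv_add (hU : IsOpen U) (hf : SmoothOn f U) (hg : SmoothOn g U) (hx : x ∈ U)
    (i : Fin p) : evenDeriv i (fun x => f x + g x) x = evenDeriv i f x + evenDeriv i g x :=
  coeff_ext fun A => by
    simp only [coeff_evenDeriv, coeff_add]
    rw [fderiv_fun_add (hf.differentiableAt hU hx A) (hg.differentiableAt hU hx A)]
    rfl

theorem evenDeriv_sum (hU : IsOpen U) {ι : Type*} {s : Finset ι} {F : ι → SFun 𝕜 p q}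
    (h : ∀ j ∈ s, SmoothOn (F j) U) (hx : x ∈ U) (i : Fin p) :
    evenDeriv i (fun x => ∑ j ∈ s, F j x) x = ∑ j ∈ s, evenDeriv i (F j) x :=
  coeff_ext fun A => by
    simp only [coeff_evenDeriv, coeff_sum]
    rw [fderiv_fun_sum fun j hj => (h j hj).differentiableAt hU hx A]
    simp

theorem evenDeriv_mul (hU : IsOpen U) (hf : SmoothOn f U) (hg : SmoothOn g U) (hx : x ∈ U)
    (i : Fin p) :
    evenDeriv i (fun x => f x * g x) x = evenDeriv i f x * g x + f x * evenDeriv i g x :=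
  coeff_ext fun C => by
    have hfA := fun A => hf.differentiableAt hU hx A
    have hgA := fun A => hg.differentiableAt hU hx A
    rw [coeff_evenDeriv, coeff_add,
      show (fun x => coeff C (f x * g x)) = _ from funext fun x => coeff_mul_eq_sum C (f x) (g x),
      coeff_mul_eq_sum C (evenDeriv i f x), coeff_mul_eq_sum C (f x)]
    simp only [coeff_evenDeriv]
    rw [fderiv_fun_sum fun A _ => DifferentiableAt.fun_sum fun B _ =>
      ((hfA A).fun_mul (hgA B)).mul_const _]
    simp only [FunLike.coe_sum, Finset.sum_apply, ← Finset.sum_add_distrib]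
    refine Finset.sum_congr rfl fun A _ => ?_
    rw [fderiv_fun_sum fun B _ => ((hfA A).fun_mul (hgA B)).mul_const _]
    simp only [FunLike.coe_sum, Finset.sum_apply]
    refine Finset.sum_congr rfl fun B _ => ?_
    rw [fderiv_mul_const ((hfA A).fun_mul (hgA B)), fderiv_fun_mul (hfA A) (hgA B)]
    simp only [add_apply, smul_apply, smul_eq_mul]
    ring

theorem evenDeriv_const_smul (hU : IsOpen U) (hf : SmoothOn f U) (hx : x ∈ U) (c : 𝕜)
    (i : Fin p) : evenDeriv i (fun x => c • f x) x = c • evenDeriv i f x :=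
  coeff_ext fun A => by
    simp only [coeff_evenDeriv, coeff_smul]
    rw [fderiv_const_mul (hf.differentiableAt hU hx A)]
    simp

theorem evenDeriv_comm (hU : IsOpen U) (hf : SmoothOn f U) (hx : x ∈ U) (i j : Fin p) :
    evenDeriv i (evenDeriv j f) x = evenDeriv j (evenDeriv i f) x :=
  coeff_ext fun A => by
    simp only [coeff_evenDeriv]
    have h := hf.contDiffAt hU hx A
    have hd : DifferentiableAt ℝ (fderiv ℝ fun x' => coeff A (f x')) x :=
      (h.fderiv_right (m := ∞) (by simp)).differentiableAt (by simp)
    have hs : IsSymmSndFDerivAt ℝ (fun x' => coeff A (f x')) x :=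
      h.isSymmSndFDerivAt (by rw [minSmoothness_of_isRCLikeNormedField]; exact WithTop.coe_le_coe.2 le_top)
    rw [fderiv_clm_apply hd (differentiableAt_const _),
      fderiv_clm_apply hd (differentiableAt_const _)]
    simpa using hs (Pi.single i 1) (Pi.single j 1)

theorem evenDeriv_oddDeriv (hU : IsOpen U) (hf : SmoothOn f U) (hx : x ∈ U) (i : Fin p)
    (j : Fin q) : evenDeriv i (oddDeriv j f) x = oddDeriv j (evenDeriv i f) x :=
  (linear_evenDeriv hU hf hx (leftDer j) i).symm

theorem isRealElt_algebraMap (r : ℝ) : IsRealElt (algebraMap 𝕜 (Grassmann 𝕜 q) (r : 𝕜)) :=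
  fun A => by
    rw [coeff_algebraMap]
    split_ifs
    · exact ⟨r, rfl⟩
    · exact ⟨0, by simp⟩

theorem isRealElt_iff {w : Grassmann 𝕜 q} :
    IsRealElt w ↔ ∀ A, ((RCLike.re (coeff A w) : ℝ) : 𝕜) = coeff A w :=
  forall_congr' fun A => ⟨fun ⟨r, hr⟩ => by rw [hr, RCLike.ofReal_re], fun h => ⟨_, h.symm⟩⟩

theorem IsRealElt.add {u w : Grassmann 𝕜 q} (hu : IsRealElt u) (hw : IsRealElt w) :
    IsRealElt (u + w) := fun A => by
  obtain ⟨r, hr⟩ := hu A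
  obtain ⟨s, hs⟩ := hw A
  exact ⟨r + s, by simp [hr, hs]⟩

theorem IsRealElt.sum {ι : Type*} {s : Finset ι} {u : ι → Grassmann 𝕜 q}
    (h : ∀ i ∈ s, IsRealElt (u i)) : IsRealElt (∑ i ∈ s, u i) :=
  Finset.sum_induction _ _ (fun _ _ => IsRealElt.add) (fun A => ⟨0, by simp⟩) h

theorem IsRealElt.smul {u : Grassmann 𝕜 q} (hu : IsRealElt u) (r : ℝ) :
    IsRealElt ((r : 𝕜) • u) := fun A => by
  obtain ⟨s, hs⟩ := hu A
  exact ⟨r * s, by rw [coeff_smul, hs, RCLike.ofReal_mul]⟩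

theorem isRealElt_monomialBasis (A : Finset (Fin q)) : IsRealElt (monomialBasis 𝕜 q A) := fun B => by
  rw [coeff_monomialBasis]
  split_ifs
  · exact ⟨1, by simp⟩
  · exact ⟨0, by simp⟩

theorem IsRealElt.induction_on {P : Grassmann 𝕜 q → Prop} (basis : ∀ A, P (monomialBasis 𝕜 q A))
    (add : ∀ u w, P u → P w → P (u + w)) (smul : ∀ (r : ℝ) u, P u → P ((r : 𝕜) • u))
    {w : Grassmann 𝕜 q} (hw : IsRealElt w) : P w := by
  have zero : P 0 := by
    have := smul 0 _ (basis ∅)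
    rwa [RCLike.ofReal_zero, zero_smul] at this
  rw [← sum_coeff_smul w]
  refine Finset.sum_induction _ P add zero fun A _ => ?_
  obtain ⟨r, hr⟩ := hw A
  rw [hr]
  exact smul r _ (basis A)

theorem IsRealElt.oddGen_mul {w : Grassmann 𝕜 q} (hw : IsRealElt w) (j : Fin q) :
    IsRealElt (oddGen j * w) := by
  refine IsRealElt.induction_on (P := fun w => IsRealElt (oddGen j * w)) (fun A => ?_)
    (fun u w hu hw => by rw [mul_add]; exact hu.add hw)
    (fun r u hu => by rw [mul_smul_comm]; exact hu.smul r) hw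
  by_cases h : j ∈ A
  · obtain ⟨e, he⟩ := exists_oddGen_mul_monomialBasis (𝕜 := 𝕜) (Finset.notMem_erase j A)
    rw [Finset.insert_erase h] at he
    have h2 : oddGen j * monomialBasis 𝕜 q A = 0 := by
      have := congrArg (fun w => oddGen j * (e⁻¹ • w)) he
      simp only [inv_smul_smul] at this
      rw [← this, mul_smul_comm, ← mul_assoc, oddGen_mul_self, zero_mul, smul_zero]
    rw [h2]
    exact fun A => ⟨0, by simp⟩
  · obtain ⟨e, he⟩ := exists_oddGen_mul_monomialBasis (𝕜 := 𝕜) h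
    rw [he]
    have : e • monomialBasis 𝕜 q (insert j A) =
        (((e : ℤ) : ℝ) : 𝕜) • monomialBasis 𝕜 q (insert j A) := by
      rw [Units.smul_def]
      push_cast
      exact (Int.cast_smul_eq_zsmul 𝕜 _ _).symm
    rw [this]
    exact (isRealElt_monomialBasis _).smul _

theorem IsRealElt.mul {u w : Grassmann 𝕜 q} (hu : IsRealElt u) (hw : IsRealElt w) :
    IsRealElt (u * w) := by
  refine IsRealElt.induction_on (P := fun u => IsRealElt (u * w)) (fun A => ?_)
    (fun u v hu hv => by rw [add_mul]; exact hu.add hv)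
    (fun r u hu => by rw [smul_mul_assoc]; exact hu.smul r) hu
  rw [monomialBasis_eq_prod]
  generalize A.sort (· ≤ ·) = l
  induction l with
  | nil => simpa using hw
  | cons a l ih =>
    rw [List.map_cons, List.prod_cons, mul_assoc]
    exact ih.oddGen_mul a

theorem IsRealElt.leftDer {w : Grassmann 𝕜 q} (hw : IsRealElt w) (j : Fin q) :
    IsRealElt (leftDer j w) := fun A => by
  by_cases h : j ∈ A
  · exact ⟨0, by simp [coeff_leftDer_of_mem h]⟩
  · obtain ⟨e, he⟩ := exists_coeff_leftDer (𝕜 := 𝕜) h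
    obtain ⟨r, hr⟩ := hw (insert j A)
    exact ⟨(e : ℤ) * r, by rw [he, hr, Units.smul_def]; simp⟩

theorem IsRealElt.body {w : Grassmann 𝕜 q} (hw : IsRealElt w) :
    ((RCLike.re (body w) : ℝ) : 𝕜) = body w := by
  rw [← coeff_empty]
  exact isRealElt_iff.1 hw ∅

/-- Near the point each coefficient equals its own real part, and taking real parts is real linear
and continuous, hence commutes with differentiation. -/
theorem isRealElt_evenDeriv (hU : IsOpen U) (hf : SmoothOn f U) (hr : ∀ x ∈ U, IsRealElt (f x))
    (hx : x ∈ U) (i : Fin p) : IsRealElt (evenDeriv i f x) := fun A => by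
  rw [coeff_evenDeriv]
  have hd := hf.differentiableAt hU hx A
  have h1 : (fun x' => coeff A (f x')) =ᶠ[𝓝 x]
      fun x' => ((RCLike.re (coeff A (f x')) : ℝ) : 𝕜) := by
    filter_upwards [hU.mem_nhds hx] with y hy
    exact (isRealElt_iff.1 (hr y hy) A).symm
  have h2 : HasFDerivAt (fun x' => ((RCLike.re (coeff A (f x')) : ℝ) : 𝕜))
      (RCLike.ofRealCLM.comp (RCLike.reCLM.comp (fderiv ℝ (fun x' => coeff A (f x')) x))) x :=
    RCLike.ofRealCLM.hasFDerivAt.comp x (RCLike.reCLM.hasFDerivAt.comp x hd.hasFDerivAt)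
  exact ⟨_, congrArg (fun L => L (Pi.single i 1)) (h1.fderiv_eq.trans h2.fderiv)⟩

theorem gradeInv_evenDeriv (hU : IsOpen U) (hf : SmoothOn f U) (hx : x ∈ U) (i : Fin p) :
    gradeInv (evenDeriv i f x) = evenDeriv i (fun x => gradeInv (f x)) x :=
  linear_evenDeriv hU hf hx gradeInv.toLinearMap i

end Calculus

/-! ### Pullback as an algebra homomorphism, through its Taylor terms. -/

section Substitution

open Topology

variable {𝕜 : Type*} [RCLike 𝕜] {p q p' q' : ℕ} {U : Set (Fin p → ℝ)} {V : Set (Fin p' → ℝ)}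
  {x : Fin p → ℝ} {φ : SuperMap 𝕜 p q p' q'}

namespace SuperMap

theorem IsMorphism.gradeInv_even (hφ : φ.IsMorphism U V) (hx : x ∈ U) (i : Fin p') :
    gradeInv (φ.even i x) = φ.even i x := hasParity_zero_iff.1 (hφ.parity_even i x hx)

theorem IsMorphism.gradeInv_odd (hφ : φ.IsMorphism U V) (hx : x ∈ U) (j : Fin q') :
    gradeInv (φ.odd j x) = -φ.odd j x := hasParity_one_iff.1 (hφ.parity_odd j x hx)

theorem IsMorphism.gradeInv_soul (hφ : φ.IsMorphism U V) (hx : x ∈ U) (i : Fin p') :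
    gradeInv (soul (φ.even i x)) = soul (φ.even i x) := by
  rw [soul, map_sub, hφ.gradeInv_even hx, AlgHom.commutes]

theorem IsMorphism.mono {U' : Set (Fin p → ℝ)} {V' : Set (Fin p' → ℝ)} (hφ : φ.IsMorphism U V)
    (hU : IsOpen U') (hV : IsOpen V') (hUU : U' ⊆ U) (hm : Set.MapsTo φ.bodyMap U' V') :
    φ.IsMorphism U' V' where
  isOpen_source := hU
  isOpen_target := hV
  smooth_even i := (hφ.smooth_even i).mono hUU
  smooth_odd i := (hφ.smooth_odd i).mono hUU
  real_even i x hx := hφ.real_even i x (hUU hx)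
  real_odd i x hx := hφ.real_odd i x (hUU hx)
  parity_even i x hx := hφ.parity_even i x (hUU hx)
  parity_odd i x hx := hφ.parity_odd i x (hUU hx)
  mapsTo := hm

theorem IsMorphism.algebraMap_bodyMap_add_soul (hφ : φ.IsMorphism U V) (hx : x ∈ U) (i : Fin p') :
    algebraMap 𝕜 (Grassmann 𝕜 q) (φ.bodyMap x i : 𝕜) + soul (φ.even i x) = φ.even i x := by
  rw [bodyMap, (hφ.real_even i x hx).body, soul, add_sub_cancel]

theorem IsMorphism.contDiffOn_bodyMap (hφ : φ.IsMorphism U V) : ContDiffOn ℝ ∞ φ.bodyMap U :=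
  contDiffOn_pi.2 fun i => (RCLike.reCLM (K := 𝕜)).contDiff.comp_contDiffOn (hφ.smooth_even i).body

theorem IsMorphism.smooth_soul (hφ : φ.IsMorphism U V) (i : Fin p') :
    SmoothOn (fun x => soul (φ.even i x)) U :=
  (hφ.smooth_even i).sub (SmoothOn.algebraMap (hφ.smooth_even i).body)

theorem IsMorphism.smooth_oddMonomial (hφ : φ.IsMorphism U V) (A : Finset (Fin q')) :
    SmoothOn (φ.oddMonomial A) U := by
  have := SmoothOn.list_prod (F := (A.sort (· ≤ ·)).map φ.odd) (U := U) (by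
    simp only [List.mem_map]
    rintro _ ⟨j, _, rfl⟩
    exact hφ.smooth_odd j)
  simp only [List.map_map] at this
  exact this

/-- Substitution of the odd components of `φ` for the generators. -/
def oddSubst (φ : SuperMap 𝕜 p q p' q') (x : Fin p → ℝ) : Grassmann 𝕜 q' →ₗ[𝕜] Grassmann 𝕜 q :=
  (monomialBasis 𝕜 q').constr 𝕜 fun A => φ.oddMonomial A x

theorem oddSubst_monomialBasis (φ : SuperMap 𝕜 p q p' q') (x : Fin p → ℝ) (A : Finset (Fin q')) :
    φ.oddSubst x (monomialBasis 𝕜 q' A) = φ.oddMonomial A x :=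
  (monomialBasis 𝕜 q').constr_basis 𝕜 _ A

theorem oddSubst_eq_sum (φ : SuperMap 𝕜 p q p' q') (x : Fin p → ℝ) (w : Grassmann 𝕜 q') :
    φ.oddSubst x w = ∑ A, coeff A w • φ.oddMonomial A x := by
  simp only [linear_apply_eq_sum (φ.oddSubst x) w, oddSubst_monomialBasis]

theorem mul_self_of_odd {w : Grassmann 𝕜 q} (h : gradeInv w = -w) : w * w = 0 := by
  apply eq_zero_of_eq_neg
  conv_lhs => rw [mul_comm_of_odd h, h, neg_mul]

/-- Every linear combination of odd elements is odd and so has square zero; the universal property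
of the exterior algebra applies, and the resulting homomorphism has the prescribed values on ordered
monomials. -/
theorem exists_algHom_oddSubst (h : ∀ j, gradeInv (φ.odd j x) = -φ.odd j x) :
    ∃ F : Grassmann 𝕜 q' →ₐ[𝕜] Grassmann 𝕜 q, ∀ w, φ.oddSubst x w = F w := by
  let l : (Fin q' → 𝕜) →ₗ[𝕜] Grassmann 𝕜 q := Fintype.linearCombination 𝕜 fun j => φ.odd j x
  have hl : ∀ v, l v * l v = 0 := fun v => by
    apply mul_self_of_odd
    simp [l, Fintype.linearCombination_apply, h]
  refine ⟨ExteriorAlgebra.lift 𝕜 ⟨l, hl⟩, fun w => ?_⟩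
  rw [← AlgHom.toLinearMap_apply]
  congr 1
  refine (monomialBasis 𝕜 q').ext fun A => ?_
  rw [oddSubst_monomialBasis, AlgHom.toLinearMap_apply, monomialBasis_eq_prod, map_list_prod,
    oddMonomial, List.map_map]
  congr 2
  funext j
  rw [Function.comp_apply, oddGen, ExteriorAlgebra.lift_ι_apply]
  simp [l, Fintype.linearCombination_apply_single]

theorem IsMorphism.oddSubst_mul (hφ : φ.IsMorphism U V) (hx : x ∈ U) (u w : Grassmann 𝕜 q') :
    φ.oddSubst x (u * w) = φ.oddSubst x u * φ.oddSubst x w := by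
  obtain ⟨F, hF⟩ := exists_algHom_oddSubst (hφ.gradeInv_odd hx)
  simp only [hF, map_mul]

theorem oddSubst_one : φ.oddSubst x 1 = 1 := by
  rw [← monomialBasis_empty, oddSubst_monomialBasis]
  simp [oddMonomial]

theorem oddSubst_oddGen (j : Fin q') : φ.oddSubst x (oddGen j) = φ.odd j x := by
  have : (oddGen j : Grassmann 𝕜 q') = monomialBasis 𝕜 q' {j} := by
    simp [monomialBasis_eq_prod]
  rw [this, oddSubst_monomialBasis]
  simp [oddMonomial]

theorem IsMorphism.gradeInv_oddSubst (hφ : φ.IsMorphism U V) (hx : x ∈ U) (w : Grassmann 𝕜 q') :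
    gradeInv (φ.oddSubst x w) = φ.oddSubst x (gradeInv w) := by
  induction w using grassmann_induction with
  | one => simp [oddSubst_one]
  | add u v hu hv => rw [map_add, map_add, map_add, map_add, hu, hv]
  | smul c u hu => rw [map_smul, map_smul, map_smul, map_smul, hu]
  | gen_mul j u hu =>
    simp only [hφ.oddSubst_mul hx, map_mul, hu, oddSubst_oddGen, hφ.gradeInv_odd hx,
      gradeInv_oddGen, map_neg]

theorem IsMorphism.body_oddSubst (hφ : φ.IsMorphism U V) (hx : x ∈ U) (w : Grassmann 𝕜 q') :
    body (φ.oddSubst x w) = body w := by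
  induction w using grassmann_induction with
  | one => simp [oddSubst_one]
  | add u v hu hv => simp [hu, hv]
  | smul c u hu => simp [hu]
  | gen_mul j u hu =>
    rw [hφ.oddSubst_mul hx, oddSubst_oddGen, body_mul, body_mul, body_oddGen,
      body_eq_zero_of_odd (hφ.gradeInv_odd hx j), zero_mul, zero_mul]

theorem IsMorphism.smooth_oddSubst (hφ : φ.IsMorphism U V) {f : SFun 𝕜 p' q'}
    (hf : SmoothOn f V) : SmoothOn (fun x => φ.oddSubst x (f (φ.bodyMap x))) U := by
  have h : SmoothOn (fun x => ∑ A, coeff A (f (φ.bodyMap x)) • φ.oddMonomial A x) U :=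
    SmoothOn.sum (F := fun A x => coeff A (f (φ.bodyMap x)) • φ.oddMonomial A x) fun A _ =>
      SmoothOn.smul (c := fun x => coeff A (f (φ.bodyMap x)))
        ((hf A).comp hφ.contDiffOn_bodyMap hφ.mapsTo) (hφ.smooth_oddMonomial A)
  exact h.congr fun x _ => oddSubst_eq_sum φ x _

theorem IsMorphism.smooth_oddSubst_const (hφ : φ.IsMorphism U V) (w : Grassmann 𝕜 q') :
    SmoothOn (fun x => φ.oddSubst x w) U :=
  hφ.smooth_oddSubst (f := fun _ => w) (smoothOn_const w)

/-- The `k`-th term, without the factor `1 / k!`, of the Taylor expansion defining the pullback. -/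
def taylorTerm (φ : SuperMap 𝕜 p q p' q') : ℕ → SFun 𝕜 p' q' → SFun 𝕜 p q
  | 0, f => fun x => φ.oddSubst x (f (φ.bodyMap x))
  | k + 1, f => fun x => ∑ j, soul (φ.even j x) * taylorTerm φ k (evenDeriv j f) x

theorem taylorTerm_zero (f : SFun 𝕜 p' q') :
    φ.taylorTerm 0 f x = φ.oddSubst x (f (φ.bodyMap x)) := rfl

theorem taylorTerm_succ (k : ℕ) (f : SFun 𝕜 p' q') :
    φ.taylorTerm (k + 1) f x = ∑ j, soul (φ.even j x) * φ.taylorTerm k (evenDeriv j f) x := rfl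

theorem iteratedFDeriv_fderiv_apply {F : (Fin p' → ℝ) → 𝕜} (hV : IsOpen V) (hF : ContDiffOn ℝ ∞ F V)
    {y : Fin p' → ℝ} (hy : y ∈ V) (k : ℕ) (v : Fin p' → ℝ) (w : Fin k → Fin p' → ℝ) :
    iteratedFDeriv ℝ k (fun y' => fderiv ℝ F y' v) y w =
      iteratedFDeriv ℝ (k + 1) F y (Fin.snoc w v) := by
  rw [iteratedFDeriv_succ_apply_right]
  have h : ContDiffAt ℝ k (fderiv ℝ F) y :=
    ((hF.contDiffAt (hV.mem_nhds hy)).fderiv_right (m := ∞) (by simp)).of_le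
      (by exact_mod_cast le_top)
  have := (ContinuousLinearMap.apply ℝ 𝕜 v).iteratedFDeriv_comp_left h le_rfl
  rw [show (fun y' => fderiv ℝ F y' v) = ContinuousLinearMap.apply ℝ 𝕜 v ∘ fderiv ℝ F from rfl, this]
  simp

/-- The recursive form suits inductions, the closed one is that of the definition of the pullback.
The derivative taken first sits in the last slot of the iterated derivative, so the corresponding
soul has to travel from the left end of the product to the right; it may, being even. -/
theorem IsMorphism.taylorTerm_eq_sum (hφ : φ.IsMorphism U V) (hx : x ∈ U) {f : SFun 𝕜 p' q'}
    (hf : SmoothOn f V) (k : ℕ) :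
    φ.taylorTerm k f x = ∑ A : Finset (Fin q'), ∑ i : Fin k → Fin p',
      iteratedFDeriv ℝ k (fun x' => coeff A (f x')) (φ.bodyMap x) (fun l => Pi.single (i l) 1) •
        ((List.ofFn fun l => soul (φ.even (i l) x)).prod * φ.oddMonomial A x) := by
  induction k generalizing f with
  | zero => simp [taylorTerm_zero, oddSubst_eq_sum]
  | succ k ih =>
    rw [taylorTerm_succ]
    simp only [ih (hf.evenDeriv hφ.isOpen_target _), Finset.mul_sum]
    rw [Finset.sum_comm]
    refine Finset.sum_congr rfl fun A _ => ?_
    rw [← (Fin.snocEquiv fun _ => Fin p').sum_comp, Fintype.sum_prod_type]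
    refine Finset.sum_congr rfl fun j _ => Finset.sum_congr rfl fun i _ => ?_
    have h1 : (fun x' => coeff A (evenDeriv j f x')) =
        fun y' => fderiv ℝ (fun x' => coeff A (f x')) y' (Pi.single j 1) := by
      funext y'; exact coeff_evenDeriv A j f y'
    have h2 : (fun l => Pi.single ((Fin.snocEquiv fun _ => Fin p') (j, i) l) (1 : ℝ)) =
        (Fin.snoc (fun l => Pi.single (i l) 1) (Pi.single j 1) : Fin (k + 1) → Fin p' → ℝ) := by
      funext l
      refine Fin.lastCases ?_ (fun l => ?_) l <;> simp [Fin.snocEquiv]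
    rw [h1, iteratedFDeriv_fderiv_apply hφ.isOpen_target (hf A) (hφ.mapsTo hx), h2, mul_smul_comm,
      ← mul_assoc, mul_comm_of_even (hφ.gradeInv_soul hx j), List.ofFn_succ']
    simp [Fin.snocEquiv]

theorem IsMorphism.taylorTerm_eq_zero (hφ : φ.IsMorphism U V) (hx : x ∈ U) {f : SFun 𝕜 p' q'}
    (hf : SmoothOn f V) {k : ℕ} (hk : q < k) : φ.taylorTerm k f x = 0 := by
  rw [hφ.taylorTerm_eq_sum hx hf]
  refine Finset.sum_eq_zero fun A _ => Finset.sum_eq_zero fun i _ => ?_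
  have h : (List.ofFn fun l => soul (φ.even (i l) x)).prod = 0 := by
    refine eq_zero_of_mem_orderGE hk ?_
    have := prod_mem_orderGE (l := List.ofFn fun l => soul (φ.even (i l) x)) (by
      intro w hw
      obtain ⟨l, rfl⟩ := List.mem_ofFn.1 hw
      exact body_soul _)
    simpa using this
  rw [h, zero_mul, smul_zero]

/-- Terms beyond the `q`-th contain more than `q` souls and vanish, so the truncation is free.
Longer truncations are convenient for products and for shifts of the index in the chain rule. -/
theorem IsMorphism.pullback_eq_sum (hφ : φ.IsMorphism U V) (hx : x ∈ U) {f : SFun 𝕜 p' q'}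
    (hf : SmoothOn f V) {N : ℕ} (hN : q < N) :
    φ.pullback f x = ∑ k ∈ Finset.range N, ((k.factorial : 𝕜)⁻¹) • φ.taylorTerm k f x := by
  have h1 : φ.pullback f x =
      ∑ k ∈ Finset.range (q + 1), ((k.factorial : 𝕜)⁻¹) • φ.taylorTerm k f x := by
    simp only [hφ.taylorTerm_eq_sum hx hf, Finset.smul_sum, smul_smul]
    rw [pullback, Finset.sum_comm]
  rw [h1]
  refine Finset.sum_subset (Finset.range_subset_range.2 hN) fun k _ hk => ?_
  rw [hφ.taylorTerm_eq_zero hx hf (by simpa using hk), smul_zero]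

theorem IsMorphism.smooth_taylorTerm (hφ : φ.IsMorphism U V) {f : SFun 𝕜 p' q'}
    (hf : SmoothOn f V) (k : ℕ) : SmoothOn (φ.taylorTerm k f) U := by
  induction k generalizing f with
  | zero => exact hφ.smooth_oddSubst hf
  | succ k ih =>
    exact SmoothOn.sum fun j _ => (hφ.smooth_soul j).mul (ih (hf.evenDeriv hφ.isOpen_target j))

theorem IsMorphism.smooth_pullback (hφ : φ.IsMorphism U V) {f : SFun 𝕜 p' q'}
    (hf : SmoothOn f V) : SmoothOn (φ.pullback f) U :=
  (SmoothOn.sum fun k _ => SmoothOn.smul contDiffOn_const (hφ.smooth_taylorTerm hf k)).congr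
    fun _ hx => hφ.pullback_eq_sum hx hf (Nat.lt_succ_self q)

theorem IsMorphism.taylorTerm_congr (hφ : φ.IsMorphism U V) (hx : x ∈ U) {f g : SFun 𝕜 p' q'}
    (h : Set.EqOn f g V) (k : ℕ) : φ.taylorTerm k f x = φ.taylorTerm k g x := by
  induction k generalizing f g with
  | zero => rw [taylorTerm_zero, taylorTerm_zero, h (hφ.mapsTo hx)]
  | succ k ih =>
    simp only [taylorTerm_succ]
    exact Finset.sum_congr rfl fun j _ => by rw [ih (evenDeriv_congr hφ.isOpen_target h j)]

theorem pullback_congr_nhds {f g : SFun 𝕜 p' q'} (h : f =ᶠ[𝓝 (φ.bodyMap x)] g) :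
    φ.pullback f x = φ.pullback g x := by
  unfold pullback
  refine Finset.sum_congr rfl fun A _ => Finset.sum_congr rfl fun k _ =>
    Finset.sum_congr rfl fun i _ => ?_
  have : (fun x' => coeff A (f x')) =ᶠ[𝓝 (φ.bodyMap x)] fun x' => coeff A (g x') := by
    filter_upwards [h] with y hy
    rw [hy]
  rw [(this.iteratedFDeriv ℝ k).eq_of_nhds]

theorem IsMorphism.pullback_congr (hφ : φ.IsMorphism U V) (hx : x ∈ U) {f g : SFun 𝕜 p' q'}
    (h : Set.EqOn f g V) : φ.pullback f x = φ.pullback g x :=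
  pullback_congr_nhds (Filter.eventuallyEq_of_mem
    (hφ.isOpen_target.mem_nhds (hφ.mapsTo hx)) h)

theorem pullback_eq_of_eq {χ : SuperMap 𝕜 p q p' q'} (he : ∀ i, φ.even i x = χ.even i x)
    (ho : ∀ j, φ.odd j x = χ.odd j x) (f : SFun 𝕜 p' q') : φ.pullback f x = χ.pullback f x := by
  have hb : φ.bodyMap x = χ.bodyMap x := funext fun i => by rw [bodyMap, bodyMap, he]
  simp only [pullback, hb, oddMonomial, he, ho]

theorem IsMorphism.taylorTerm_sum (hφ : φ.IsMorphism U V) (hx : x ∈ U) {ι : Type*} {s : Finset ι}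
    {F : ι → SFun 𝕜 p' q'} (hF : ∀ i ∈ s, SmoothOn (F i) V) (k : ℕ) :
    φ.taylorTerm k (fun y => ∑ i ∈ s, F i y) x = ∑ i ∈ s, φ.taylorTerm k (F i) x := by
  induction k generalizing F with
  | zero => simp only [taylorTerm_zero, map_sum]
  | succ k ih =>
    simp only [taylorTerm_succ]
    rw [Finset.sum_comm]
    refine Finset.sum_congr rfl fun j _ => ?_
    rw [← Finset.mul_sum, ← ih fun i hi => (hF i hi).evenDeriv hφ.isOpen_target j]
    congr 1
    exact hφ.taylorTerm_congr hx (fun y hy => evenDeriv_sum hφ.isOpen_target hF hy j) k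

/-- Without the factor 1 / k! the Taylor terms are iterates of a derivation, so they satisfy the
binomial Leibniz formula; Pascal's rule is the inductive step. -/
theorem IsMorphism.taylorTerm_mul (hφ : φ.IsMorphism U V) (hx : x ∈ U) {f g : SFun 𝕜 p' q'}
    (hf : SmoothOn f V) (hg : SmoothOn g V) (k : ℕ) :
    φ.taylorTerm k (fun y => f y * g y) x = ∑ ij ∈ Finset.HasAntidiagonal.antidiagonal k,
      (k.choose ij.1) • (φ.taylorTerm ij.1 f x * φ.taylorTerm ij.2 g x) := by
  induction k generalizing f g with
  | zero => simp [taylorTerm_zero, hφ.oddSubst_mul hx]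
  | succ k ih =>
    have hV := hφ.isOpen_target
    have h1 : ∀ j, φ.taylorTerm k (evenDeriv j fun y => f y * g y) x =
        φ.taylorTerm k (fun y => evenDeriv j f y * g y) x +
          φ.taylorTerm k (fun y => f y * evenDeriv j g y) x := fun j => by
      have h2 := hφ.taylorTerm_sum hx (s := Finset.univ)
        (F := fun b : Bool => bif b then (fun y => evenDeriv j f y * g y) else
          (fun y => f y * evenDeriv j g y)) (by
            rintro (_ | _) _
            · exact hf.mul (hg.evenDeriv hV j)
            · exact (hf.evenDeriv hV j).mul hg) k
      simp only [Fintype.sum_bool, cond_true, cond_false] at h2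
      rw [← h2]
      exact hφ.taylorTerm_congr hx (fun y hy => evenDeriv_mul hV hf hg hy j) k
    have hc : ∀ j u w, soul (φ.even j x) * (u * w) = u * (soul (φ.even j x) * w) :=
      fun j u w => by
        rw [← mul_assoc, mul_comm_of_even (hφ.gradeInv_soul hx j), mul_assoc]
    rw [taylorTerm_succ, Finset.sum_antidiagonal_choose_succ_nsmul
      (fun i j => φ.taylorTerm i f x * φ.taylorTerm j g x) k, add_comm]
    simp only [h1, ih (hf.evenDeriv hV _) hg, ih hf (hg.evenDeriv hV _), mul_add, Finset.mul_sum,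
      Finset.sum_add_distrib, mul_smul_comm]
    congr 1
    · rw [Finset.sum_comm]
      refine Finset.sum_congr rfl fun ij hij => ?_
      rw [taylorTerm_succ, Finset.sum_mul, Finset.smul_sum,
        Nat.choose_symm_of_eq_add (Finset.HasAntidiagonal.mem_antidiagonal.1 hij).symm]
      simp only [mul_assoc]
    · rw [Finset.sum_comm]
      refine Finset.sum_congr rfl fun ij _ => ?_
      rw [taylorTerm_succ, Finset.mul_sum, Finset.smul_sum]
      simp only [hc]

theorem IsMorphism.pullback_mul (hφ : φ.IsMorphism U V) (hx : x ∈ U) {f g : SFun 𝕜 p' q'}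
    (hf : SmoothOn f V) (hg : SmoothOn g V) :
    φ.pullback (fun y => f y * g y) x = φ.pullback f x * φ.pullback g x := by
  -- Two indices at most `q` have sum at most 2`q`. With this truncation the Cauchy product of the
  -- two expansions differs from the expansion of the product only by terms in which some index
  -- exceeds `q`, and these are zero.
  rw [hφ.pullback_eq_sum hx (hf.mul hg) (show q < 2 * q + 1 by lia),
    hφ.pullback_eq_sum hx hf (Nat.lt_succ_self q), hφ.pullback_eq_sum hx hg (Nat.lt_succ_self q),
    Finset.sum_mul_sum, ← Finset.sum_product', ← Finset.sum_fiberwise_of_maps_to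
      (t := Finset.range (2 * q + 1)) (g := fun ij : ℕ × ℕ => ij.1 + ij.2)]
  · refine Finset.sum_congr rfl fun k _ => ?_
    rw [hφ.taylorTerm_mul hx hf hg, Finset.smul_sum]
    symm
    refine Finset.sum_subset_zero_on_sdiff (fun ij h => ?_) (fun ij h => ?_) fun ij h => ?_
    · simp only [Finset.mem_filter] at h
      simpa using h.2
    · simp only [Finset.mem_sdiff, Finset.HasAntidiagonal.mem_antidiagonal, Finset.mem_filter, Finset.mem_product,
        Finset.mem_range, not_and] at h
      by_cases h1 : ij.1 < q + 1
      · rw [hφ.taylorTerm_eq_zero hx hg (k := ij.2) (by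
          by_contra h2; exact h.2 ⟨h1, by lia⟩ h.1)]
        simp
      · rw [hφ.taylorTerm_eq_zero hx hf (k := ij.1) (by lia)]
        simp
    · simp only [Finset.mem_filter] at h
      obtain ⟨_, rfl⟩ := h
      rw [smul_mul_smul_comm, ← Nat.cast_smul_eq_nsmul 𝕜, smul_smul]
      congr 1
      rw [Nat.cast_add_choose]
      have := Nat.cast_ne_zero (R := 𝕜).2 (Nat.factorial_ne_zero (ij.1 + ij.2))
      field_simp
  · intro ij h
    simp only [Finset.mem_product, Finset.mem_range] at h ⊢
    lia

theorem IsMorphism.pullback_sum (hφ : φ.IsMorphism U V) (hx : x ∈ U) {ι : Type*} {s : Finset ι}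
    {F : ι → SFun 𝕜 p' q'} (hF : ∀ i ∈ s, SmoothOn (F i) V) :
    φ.pullback (fun y => ∑ i ∈ s, F i y) x = ∑ i ∈ s, φ.pullback (F i) x := by
  rw [hφ.pullback_eq_sum hx (SmoothOn.sum hF) (Nat.lt_succ_self q)]
  simp only [hφ.taylorTerm_sum hx hF, Finset.smul_sum]
  rw [Finset.sum_comm]
  exact Finset.sum_congr rfl fun i hi => (hφ.pullback_eq_sum hx (hF i hi) (Nat.lt_succ_self q)).symm

theorem IsMorphism.pullback_add (hφ : φ.IsMorphism U V) (hx : x ∈ U) {f g : SFun 𝕜 p' q'}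
    (hf : SmoothOn f V) (hg : SmoothOn g V) :
    φ.pullback (fun y => f y + g y) x = φ.pullback f x + φ.pullback g x := by
  have h2 := hφ.pullback_sum hx (s := Finset.univ) (F := fun b : Bool => bif b then f else g) (by
    rintro (_ | _) _
    · exact hg
    · exact hf)
  simpa only [Fintype.sum_bool, cond_true, cond_false] using h2

theorem taylorTerm_zero_fun (k : ℕ) : φ.taylorTerm k (fun _ => 0) x = 0 := by
  induction k with
  | zero => simp [taylorTerm_zero]
  | succ k ih =>
    rw [taylorTerm_succ]
    have : ∀ j, evenDeriv j (fun _ => 0 : SFun 𝕜 p' q') = fun _ => 0 :=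
      fun j => funext fun y => evenDeriv_const j 0
    simp [this, ih]

theorem IsMorphism.pullback_const (hφ : φ.IsMorphism U V) (hx : x ∈ U) (w : Grassmann 𝕜 q') :
    φ.pullback (fun _ => w) x = φ.oddSubst x w := by
  rw [hφ.pullback_eq_sum hx (smoothOn_const w) (Nat.lt_succ_self q), Finset.sum_range_succ']
  have : ∀ j, evenDeriv j (fun _ => w : SFun 𝕜 p' q') = fun _ => 0 :=
    fun j => funext fun y => evenDeriv_const j w
  simp [taylorTerm_succ, this, taylorTerm_zero_fun, taylorTerm_zero]

theorem IsMorphism.pullback_const_smul (hφ : φ.IsMorphism U V) (hx : x ∈ U) {f : SFun 𝕜 p' q'}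
    (hf : SmoothOn f V) (c : 𝕜) :
    φ.pullback (fun y => c • f y) x = c • φ.pullback f x := by
  have h := hφ.pullback_mul hx (smoothOn_const (c • (1 : Grassmann 𝕜 q'))) hf
  rw [hφ.pullback_const hx, map_smul, oddSubst_one] at h
  simpa using h

theorem evenDeriv_coord (i j : Fin p') (y : Fin p' → ℝ) :
    evenDeriv j ((SuperMap.id 𝕜 p' q').even i) y = if i = j then 1 else 0 := by
  refine coeff_ext fun A => ?_
  have h1 : (fun y : Fin p' → ℝ => coeff A ((SuperMap.id 𝕜 p' q').even i y)) =
      fun y => if A = ∅ then (RCLike.ofRealCLM.comp (ContinuousLinearMap.proj i)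
        : (Fin p' → ℝ) →L[ℝ] 𝕜) y else 0 := by
    funext y
    simp [SuperMap.id, coeff_algebraMap]
  rw [coeff_evenDeriv, h1, ← map_one (algebraMap 𝕜 (Grassmann 𝕜 q')),
    ← map_zero (algebraMap 𝕜 (Grassmann 𝕜 q')), ← apply_ite, coeff_algebraMap]
  split_ifs with h h'
  · rw [ContinuousLinearMap.fderiv]
    simp [h']
  · rw [ContinuousLinearMap.fderiv]
    simp [h']
  · simp

theorem smooth_coord_even (i : Fin p') : SmoothOn ((SuperMap.id 𝕜 p' q').even i) V :=
  SmoothOn.algebraMap ((RCLike.ofRealCLM (K := 𝕜)).contDiff.comp (contDiff_apply ℝ ℝ i)).contDiffOn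

theorem IsMorphism.pullback_coord_even (hφ : φ.IsMorphism U V) (hx : x ∈ U) (i : Fin p') :
    φ.pullback ((SuperMap.id 𝕜 p' q').even i) x = φ.even i x := by
  -- The truncation at `q + 2` makes the constant and the linear term available even when `q = 0`;
  -- for a coordinate function they are the body and the soul, and all further terms vanish.
  rw [hφ.pullback_eq_sum hx (smooth_coord_even i) (show q < q + 2 by lia), Finset.sum_range_succ',
    Finset.sum_range_succ']
  have h1 : ∀ j, evenDeriv j ((SuperMap.id 𝕜 p' q').even i) = fun _ => if i = j then 1 else 0 :=
    fun j => funext fun y => evenDeriv_coord i j y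
  have h2 : ∀ j (w : Grassmann 𝕜 q'), evenDeriv j (fun _ => w : SFun 𝕜 p' q') = fun _ => 0 :=
    fun j w => funext fun y => evenDeriv_const j w
  simp only [taylorTerm_succ, h1, h2, taylorTerm_zero_fun, taylorTerm_zero]
  rw [← hφ.algebraMap_bodyMap_add_soul hx i]
  simp [SuperMap.id, apply_ite, oddSubst_one, Algebra.algebraMap_eq_smul_one, add_comm]

theorem IsMorphism.pullback_coord_odd (hφ : φ.IsMorphism U V) (hx : x ∈ U) (j : Fin q') :
    φ.pullback ((SuperMap.id 𝕜 p' q').odd j) x = φ.odd j x :=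
  (hφ.pullback_const hx (oddGen j)).trans (oddSubst_oddGen j)

theorem IsMorphism.gradeInv_taylorTerm (hφ : φ.IsMorphism U V) (hx : x ∈ U) {f : SFun 𝕜 p' q'}
    (hf : SmoothOn f V) (k : ℕ) :
    gradeInv (φ.taylorTerm k f x) = φ.taylorTerm k (fun y => gradeInv (f y)) x := by
  induction k generalizing f with
  | zero => exact hφ.gradeInv_oddSubst hx _
  | succ k ih =>
    simp only [taylorTerm_succ, map_sum, map_mul, hφ.gradeInv_soul hx,
      ih (hf.evenDeriv hφ.isOpen_target _)]
    refine Finset.sum_congr rfl fun j _ => ?_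
    rw [hφ.taylorTerm_congr hx fun y hy => gradeInv_evenDeriv hφ.isOpen_target hf hy j]

theorem IsMorphism.gradeInv_pullback (hφ : φ.IsMorphism U V) (hx : x ∈ U) {f : SFun 𝕜 p' q'}
    (hf : SmoothOn f V) :
    gradeInv (φ.pullback f x) = φ.pullback (fun y => gradeInv (f y)) x := by
  rw [hφ.pullback_eq_sum hx hf (Nat.lt_succ_self q),
    hφ.pullback_eq_sum hx (f := fun y => gradeInv (f y)) (hf.linear gradeInv.toLinearMap)
      (Nat.lt_succ_self q)]
  simp only [map_sum, map_smul, hφ.gradeInv_taylorTerm hx hf]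

theorem IsMorphism.body_pullback (hφ : φ.IsMorphism U V) (hx : x ∈ U) {f : SFun 𝕜 p' q'}
    (hf : SmoothOn f V) : body (φ.pullback f x) = body (f (φ.bodyMap x)) := by
  rw [hφ.pullback_eq_sum hx hf (Nat.lt_succ_self q), Finset.sum_range_succ', body_add,
    Nat.factorial_zero, Nat.cast_one, inv_one, one_smul, taylorTerm_zero, hφ.body_oddSubst hx,
    body_sum, Finset.sum_eq_zero, zero_add]
  intro k _
  rw [body_smul, taylorTerm_succ, body_sum, Finset.sum_eq_zero, mul_zero]
  intro j _
  rw [body_mul, body_soul, zero_mul]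

end SuperMap

end Substitution

/-! ### The chain rule and functoriality of pullbacks. -/

section ChainRule

open Topology

variable {𝕜 : Type*} [RCLike 𝕜] {p q p' q' p'' q'' : ℕ} {U : Set (Fin p → ℝ)}
  {V : Set (Fin p' → ℝ)} {W : Set (Fin p'' → ℝ)}
  {x : Fin p → ℝ} {φ : SuperMap 𝕜 p q p' q'} {χ : SuperMap 𝕜 p' q' p'' q''}

/-- The properties shared by the even and odd partial derivatives, as twisted derivations of the
algebra of smooth superfunctions over `U`. -/
structure IsSuperDerivation (U : Set (Fin p → ℝ)) (τ : Grassmann 𝕜 q → Grassmann 𝕜 q)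
    (D : SFun 𝕜 p q → SFun 𝕜 p q) : Prop where
  congr : ∀ {f g : SFun 𝕜 p q}, Set.EqOn f g U → Set.EqOn (D f) (D g) U
  sum : ∀ {ι : Type} (s : Finset ι) (F : ι → SFun 𝕜 p q), (∀ i ∈ s, SmoothOn (F i) U) →
    ∀ x ∈ U, D (fun x => ∑ i ∈ s, F i x) x = ∑ i ∈ s, D (F i) x
  const_smul : ∀ (c : 𝕜) {f : SFun 𝕜 p q}, SmoothOn f U → ∀ x ∈ U,
    D (fun x => c • f x) x = c • D f x
  mul : ∀ {f g : SFun 𝕜 p q}, SmoothOn f U → SmoothOn g U → ∀ x ∈ U,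
    D (fun x => f x * g x) x = D f x * g x + τ (f x) * D g x
  one : ∀ x ∈ U, D (fun _ => 1) x = 0
  comp : ∀ {p' : ℕ} {V : Set (Fin p' → ℝ)} (X : (Fin p → ℝ) → Fin p' → ℝ) (h : (Fin p' → ℝ) → 𝕜),
    IsOpen V → ContDiffOn ℝ ∞ X U → Set.MapsTo X U V → ContDiffOn ℝ ∞ h V → ∀ x ∈ U,
    D (fun x => algebraMap 𝕜 _ (h (X x))) x =
      ∑ j, fderiv ℝ h (X x) (Pi.single j 1) • D (fun x => algebraMap 𝕜 _ (X x j : 𝕜)) x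
  map_even : ∀ {w}, gradeInv w = w → τ w = w
  anticomm : ∀ {f : SFun 𝕜 p q}, SmoothOn f U → (∀ x ∈ U, gradeInv (f x) = -f x) →
    ∀ x ∈ U, ∀ w, gradeInv w = -w → τ w * D f x = -(D f x * w)

/-- There is no twist, and the sign in `anticomm` appears because an even derivative of an odd
function is odd. -/
theorem isSuperDerivation_evenDeriv (hU : IsOpen U) (i : Fin p) :
    IsSuperDerivation (𝕜 := 𝕜) (q := q) U (fun w => w) (evenDeriv i) where
  congr h := evenDeriv_congr hU h i
  sum s F h x hx := evenDeriv_sum hU h hx i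
  const_smul c f hf x hx := evenDeriv_const_smul hU hf hx c i
  mul hf hg x hx := evenDeriv_mul hU hf hg hx i
  one x hx := evenDeriv_const i 1
  comp {p' V} X h hV hX hm hh x hx := by
    have h1 : DifferentiableAt ℝ h (X x) :=
      (hh.contDiffAt (hV.mem_nhds (hm hx))).differentiableAt (by simp)
    have h2 : DifferentiableAt ℝ X x :=
      (hX.contDiffAt (hU.mem_nhds hx)).differentiableAt (by simp)
    have h3 : fderiv ℝ (fun x => h (X x)) x (Pi.single i 1) =
        ∑ j, fderiv ℝ h (X x) (Pi.single j 1) *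
          fderiv ℝ (fun x => ((X x j : ℝ) : 𝕜)) x (Pi.single i 1) := by
      have h4 : ∀ j, fderiv ℝ (fun x => ((X x j : ℝ) : 𝕜)) x (Pi.single i 1) =
          ((fderiv ℝ X x (Pi.single i 1) j : ℝ) : 𝕜) := fun j => by
        have := (RCLike.ofRealCLM (K := 𝕜)).hasFDerivAt.comp x
          ((ContinuousLinearMap.proj (R := ℝ) (φ := fun _ : Fin p' => ℝ) j).hasFDerivAt.comp x
            h2.hasFDerivAt)
        exact congrArg (fun L => L (Pi.single i 1)) this.fderiv
      have h5 := fderiv_comp x h1 h2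
      rw [show (fun x => h (X x)) = h ∘ X from rfl, h5, ContinuousLinearMap.comp_apply]
      conv_lhs => rw [pi_eq_sum_univ' (fderiv ℝ X x (Pi.single i 1))]
      rw [map_sum]
      refine Finset.sum_congr rfl fun j _ => ?_
      rw [map_smul, h4, RCLike.real_smul_eq_coe_mul, mul_comm]
    refine coeff_ext fun A => ?_
    simp only [coeff_sum, coeff_smul, coeff_evenDeriv, coeff_algebraMap]
    split_ifs
    · exact h3
    · simp
  map_even _ := rfl
  anticomm {f} hf ho x hx w hw := by
    have h1 : gradeInv (evenDeriv i f x) = -evenDeriv i f x := by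
      rw [gradeInv_evenDeriv hU hf hx, evenDeriv_congr hU (g := fun x => (-1 : 𝕜) • f x)
        (fun y hy => (ho y hy).trans (neg_one_smul 𝕜 (f y)).symm) i hx, evenDeriv_const_smul hU hf hx, neg_one_smul]
    rw [mul_comm_of_odd hw, h1, neg_mul]

/-- Here the derivative of an odd function is even, and the sign in `anticomm` comes from the twist.
The rule for functions of the body is trivial, both sides being zero. -/
theorem isSuperDerivation_oddDeriv (j : Fin q) :
    IsSuperDerivation (𝕜 := 𝕜) (p := p) U gradeInv (oddDeriv j) where
  congr h x hx := by rw [oddDeriv_apply, oddDeriv_apply, h hx]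
  sum s F _ x _ := by simp only [oddDeriv_apply, map_sum]
  const_smul c f _ x _ := by simp only [oddDeriv_apply, map_smul]
  mul _ _ x _ := by simp only [oddDeriv_apply, leftDer_mul]
  one x _ := by simp only [oddDeriv_apply, leftDer_one]
  comp X h _ _ _ _ x _ := by simp [oddDeriv_apply]
  map_even h := h
  anticomm {f} _ ho x hx w hw := by
    have h1 : gradeInv (oddDeriv j f x) = oddDeriv j f x := by
      have := leftDer_gradeInv j (f x)
      rw [ho x hx, map_neg, neg_inj] at this
      exact this.symm
    rw [hw, neg_mul, mul_comm_of_even h1]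

variable {τ : Grassmann 𝕜 q → Grassmann 𝕜 q} {D : SFun 𝕜 p q → SFun 𝕜 p q}

namespace IsSuperDerivation

theorem add (hD : IsSuperDerivation U τ D) {f g : SFun 𝕜 p q} (hf : SmoothOn f U)
    (hg : SmoothOn g U) (hx : x ∈ U) : D (fun x => f x + g x) x = D f x + D g x := by
  have h2 := hD.sum Finset.univ (fun b : Bool => bif b then f else g) (by
    rintro (_ | _) _
    · exact hg
    · exact hf) x hx
  simpa only [Fintype.sum_bool, cond_true, cond_false] using h2

/-- Induction on products of generators. In the Leibniz rule for Ξ^j times the rest, moving Ξ^j past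
D Ξ^b gives a minus sign, which is the one in the left derivative of a product. -/
theorem oddSubst (hD : IsSuperDerivation U τ D) (hφ : φ.IsMorphism U V) (hx : x ∈ U)
    (w : Grassmann 𝕜 q') :
    D (fun x => φ.oddSubst x w) x = ∑ b, D (φ.odd b) x * φ.oddSubst x (leftDer b w) := by
  have hs := fun w => hφ.smooth_oddSubst_const w
  induction w using grassmann_induction with
  | one =>
    simp only [SuperMap.oddSubst_one, leftDer_one, map_zero, mul_zero, Finset.sum_const_zero]
    exact hD.one x hx
  | add u v hu hv =>
    simp only [map_add, mul_add, Finset.sum_add_distrib, ← hu, ← hv]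
    exact hD.add (hs u) (hs v) hx
  | smul c u hu =>
    simp only [map_smul, mul_smul_comm, ← Finset.smul_sum, ← hu]
    exact hD.const_smul c (hs u) x hx
  | gen_mul j u hu =>
    have h1 : Set.EqOn (fun x => φ.oddSubst x (oddGen j * u))
        (fun x => φ.odd j x * φ.oddSubst x u) U := fun y hy => by
      simp only [hφ.oddSubst_mul hy, SuperMap.oddSubst_oddGen]
    rw [hD.congr h1 hx, hD.mul (hφ.smooth_odd j) (hs u) x hx, hu]
    simp only [leftDer_oddGen_mul, map_sub, hφ.oddSubst_mul hx, SuperMap.oddSubst_oddGen, mul_sub,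
      Finset.sum_sub_distrib, apply_ite (φ.oddSubst x), map_zero, mul_ite, mul_zero,
      Finset.sum_ite_eq', Finset.mem_univ, if_true, Finset.mul_sum]
    rw [sub_eq_add_neg, ← Finset.sum_neg_distrib]
    congr 1
    refine Finset.sum_congr rfl fun b _ => ?_
    rw [← mul_assoc, hD.anticomm (hφ.smooth_odd b) (fun y hy => hφ.gradeInv_odd hy b) x hx _
      (hφ.gradeInv_odd hx j), neg_mul, mul_assoc]

theorem smooth_bodyMap_coord (hφ : φ.IsMorphism U V) (i : Fin p') :
    SmoothOn (fun x => algebraMap 𝕜 (Grassmann 𝕜 q) (φ.bodyMap x i : 𝕜)) U :=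
  SmoothOn.algebraMap (c := fun x => (φ.bodyMap x i : 𝕜))
    ((RCLike.ofRealCLM (K := 𝕜)).contDiff.comp_contDiffOn
      (contDiffOn_pi.1 hφ.contDiffOn_bodyMap i))

theorem taylorTerm_zero (hD : IsSuperDerivation U τ D) (hφ : φ.IsMorphism U V) (hx : x ∈ U)
    {f : SFun 𝕜 p' q'} (hf : SmoothOn f V) :
    D (φ.taylorTerm 0 f) x =
      ∑ j, D (fun x => algebraMap 𝕜 _ (φ.bodyMap x j : 𝕜)) x * φ.taylorTerm 0 (evenDeriv j f) x +
      ∑ b, D (φ.odd b) x * φ.taylorTerm 0 (oddDeriv b f) x := by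
  have hc : ∀ A, SmoothOn (fun x => algebraMap 𝕜 (Grassmann 𝕜 q) (coeff A (f (φ.bodyMap x)))) U :=
    fun A => SmoothOn.algebraMap (c := fun x => coeff A (f (φ.bodyMap x)))
      ((hf A).comp hφ.contDiffOn_bodyMap hφ.mapsTo)
  have hs := fun A => hφ.smooth_oddSubst_const (monomialBasis 𝕜 q' A)
  have h1 : φ.taylorTerm 0 f = fun x => ∑ A, algebraMap 𝕜 (Grassmann 𝕜 q)
      (coeff A (f (φ.bodyMap x))) * φ.oddSubst x (monomialBasis 𝕜 q' A) := by
    funext y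
    rw [SuperMap.taylorTerm_zero, linear_apply_eq_sum]
    simp only [Algebra.smul_def]
  rw [h1, hD.sum _ _ (fun A _ => (hc A).mul (hs A)) x hx]
  have h2 : ∀ A, D (fun x => algebraMap 𝕜 (Grassmann 𝕜 q)
      (coeff A (f (φ.bodyMap x))) * φ.oddSubst x (monomialBasis 𝕜 q' A)) x =
      ∑ j, D (fun x => algebraMap 𝕜 _ (φ.bodyMap x j : 𝕜)) x *
        (coeff A (evenDeriv j f (φ.bodyMap x)) • φ.oddSubst x (monomialBasis 𝕜 q' A)) +
      ∑ b, D (φ.odd b) x *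
        (coeff A (f (φ.bodyMap x)) • φ.oddSubst x (leftDer b (monomialBasis 𝕜 q' A))) := fun A => by
    rw [hD.mul (hc A) (hs A) x hx, hD.map_even (AlgHom.commutes _ _), hD.oddSubst hφ hx,
      hD.comp φ.bodyMap (fun y => coeff A (f y)) hφ.isOpen_target hφ.contDiffOn_bodyMap hφ.mapsTo
        (hf A) x hx, Finset.sum_mul, Finset.mul_sum]
    simp only [coeff_evenDeriv, smul_mul_assoc, mul_smul_comm, ← Algebra.smul_def]
  simp only [h2, Finset.sum_add_distrib]
  congr 1
  · rw [Finset.sum_comm]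
    refine Finset.sum_congr rfl fun j _ => ?_
    rw [← Finset.mul_sum, SuperMap.taylorTerm_zero, linear_apply_eq_sum]
  · rw [Finset.sum_comm]
    refine Finset.sum_congr rfl fun b _ => ?_
    rw [← Finset.mul_sum, SuperMap.taylorTerm_zero, oddDeriv_apply,
      ← LinearMap.comp_apply, linear_apply_eq_sum (φ.oddSubst x ∘ₗ leftDer b)]
    rfl

/-- The derivative may fall on the body, on one of the `k` souls, or on an odd component. The `k`
contributions of the souls coincide because partial derivatives commute, hence the factor `k`. At `k
= 0` this factor makes the truncated index `k - 1` harmless. -/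
theorem taylorTerm (hD : IsSuperDerivation U τ D) (hφ : φ.IsMorphism U V) (hx : x ∈ U)
    {f : SFun 𝕜 p' q'} (hf : SmoothOn f V) (k : ℕ) :
    D (φ.taylorTerm k f) x =
      ∑ j, D (fun x => algebraMap 𝕜 _ (φ.bodyMap x j : 𝕜)) x * φ.taylorTerm k (evenDeriv j f) x +
      ∑ j, (k : 𝕜) • (D (fun x => soul (φ.even j x)) x * φ.taylorTerm (k - 1) (evenDeriv j f) x) +
      ∑ b, D (φ.odd b) x * φ.taylorTerm k (oddDeriv b f) x := by
  have hV := hφ.isOpen_target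
  induction k generalizing f with
  | zero => simp [hD.taylorTerm_zero hφ hx hf]
  | succ k ih =>
    have hs := fun j => hφ.smooth_soul j
    have hf' := fun j => hf.evenDeriv hV j
    have ht := fun j => hφ.smooth_taylorTerm (hf' j) k
    have hcomm : ∀ j u w, soul (φ.even j x) * (u * w) = u * (soul (φ.even j x) * w) :=
      fun j u w => by
        rw [← mul_assoc, mul_comm_of_even (hφ.gradeInv_soul hx j), mul_assoc]
    have h0 : φ.taylorTerm (k + 1) f =
      fun x => ∑ j, soul (φ.even j x) * φ.taylorTerm k (evenDeriv j f) x := rfl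
    have hk : ∀ j l, (k : 𝕜) • (soul (φ.even j x) * φ.taylorTerm (k - 1) (evenDeriv l (evenDeriv j f)) x)
        = (k : 𝕜) • (soul (φ.even j x) * φ.taylorTerm (k - 1) (evenDeriv j (evenDeriv l f)) x) :=
      fun j l => by
        rw [hφ.taylorTerm_congr hx (fun y hy => evenDeriv_comm hV hf hy l j)]
    -- For `k = 0` both sides carry the factor zero; otherwise this is the recursion defining the
    -- Taylor terms.
    have hk' : ∀ l, (k : 𝕜) • ∑ j, soul (φ.even j x) *
        φ.taylorTerm (k - 1) (evenDeriv j (evenDeriv l f)) x =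
        (k : 𝕜) • φ.taylorTerm k (evenDeriv l f) x := fun l => by
      rcases k with _ | k
      · simp
      · rfl
    rw [h0, hD.sum _ _ (fun j _ => (hs j).mul (ht j)) x hx]
    simp only [hD.mul (hs _) (ht _) x hx, hD.map_even (hφ.gradeInv_soul hx _), ih (hf' _), mul_add,
      Finset.mul_sum, mul_smul_comm, hcomm, Finset.sum_add_distrib]
    have e1 : ∑ j, ∑ l, D (fun x => algebraMap 𝕜 _ (φ.bodyMap x l : 𝕜)) x *
        (soul (φ.even j x) * φ.taylorTerm k (evenDeriv l (evenDeriv j f)) x) =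
        ∑ l, D (fun x => algebraMap 𝕜 _ (φ.bodyMap x l : 𝕜)) x *
          φ.taylorTerm (k + 1) (evenDeriv l f) x := by
      rw [Finset.sum_comm]
      refine Finset.sum_congr rfl fun l _ => ?_
      rw [SuperMap.taylorTerm_succ, Finset.mul_sum]
      refine Finset.sum_congr rfl fun j _ => ?_
      rw [hφ.taylorTerm_congr hx (fun y hy => evenDeriv_comm hV hf hy l j)]
    have e2 : ∑ j, ∑ l, (k : 𝕜) • (D (fun x => soul (φ.even l x)) x *
        (soul (φ.even j x) * φ.taylorTerm (k - 1) (evenDeriv l (evenDeriv j f)) x)) =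
        ∑ l, (k : 𝕜) • (D (fun x => soul (φ.even l x)) x * φ.taylorTerm k (evenDeriv l f) x) := by
      rw [Finset.sum_comm]
      refine Finset.sum_congr rfl fun l _ => ?_
      rw [← mul_smul_comm, ← hk', Finset.smul_sum, Finset.mul_sum]
      refine Finset.sum_congr rfl fun j _ => ?_
      rw [← mul_smul_comm, hk]
    have e3 : ∑ j, ∑ b, D (φ.odd b) x *
        (soul (φ.even j x) * φ.taylorTerm k (oddDeriv b (evenDeriv j f)) x) =
        ∑ b, D (φ.odd b) x * φ.taylorTerm (k + 1) (oddDeriv b f) x := by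
      rw [Finset.sum_comm]
      refine Finset.sum_congr rfl fun b _ => ?_
      rw [SuperMap.taylorTerm_succ, Finset.mul_sum]
      refine Finset.sum_congr rfl fun j _ => ?_
      rw [hφ.taylorTerm_congr hx (fun y hy => (evenDeriv_oddDeriv hV hf hy j b).symm)]
    rw [e1, e2, e3]
    simp only [Nat.add_sub_cancel, Nat.cast_add, Nat.cast_one, add_smul, one_smul,
      Finset.sum_add_distrib]
    abel

/-- The chain rule. -/
theorem pullback (hD : IsSuperDerivation U τ D) (hφ : φ.IsMorphism U V) (hx : x ∈ U)
    {f : SFun 𝕜 p' q'} (hf : SmoothOn f V) :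
    D (φ.pullback f) x = ∑ j, D (φ.even j) x * φ.pullback (evenDeriv j f) x +
      ∑ b, D (φ.odd b) x * φ.pullback (oddDeriv b f) x := by
  have hV := hφ.isOpen_target
  -- The truncation has one term more than necessary, because lowering the index by one in the terms
  -- with a differentiated soul loses a term.
  have h1 : Set.EqOn (φ.pullback f)
      (fun x => ∑ k ∈ Finset.range (q + 2), ((k.factorial : 𝕜)⁻¹) • φ.taylorTerm k f x) U :=
    fun y hy => hφ.pullback_eq_sum hy hf (by lia)
  have h2 : ∀ j, D (φ.even j) x = D (fun x => algebraMap 𝕜 _ (φ.bodyMap x j : 𝕜)) x +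
      D (fun x => soul (φ.even j x)) x := fun j => by
    rw [← hD.add (smooth_bodyMap_coord hφ j) (hφ.smooth_soul j) hx]
    exact hD.congr (fun y hy => (hφ.algebraMap_bodyMap_add_soul hy j).symm) hx
  rw [hD.congr h1 hx, hD.sum _ _ (fun k _ => SmoothOn.smul contDiffOn_const
    (hφ.smooth_taylorTerm hf k)) x hx]
  simp only [hD.const_smul _ (hφ.smooth_taylorTerm hf _) x hx, hD.taylorTerm hφ hx hf, smul_add,
    Finset.sum_add_distrib, h2, add_mul]
  congr 1
  · congr 1
    · simp only [Finset.smul_sum]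
      rw [Finset.sum_comm]
      refine Finset.sum_congr rfl fun j _ => ?_
      rw [hφ.pullback_eq_sum hx (hf.evenDeriv hV j) (show q < q + 2 by lia), Finset.mul_sum]
      simp only [mul_smul_comm]
    · simp only [Finset.smul_sum]
      rw [Finset.sum_comm]
      refine Finset.sum_congr rfl fun j _ => ?_
      -- Since k / k! = 1 / (k - 1)!, the terms with a differentiated soul form the expansion of the
      -- pulled-back derivative with index shifted by one. Together with the terms of the body they
      -- give the derivative of the whole even component.
      rw [hφ.pullback_eq_sum hx (hf.evenDeriv hV j) (Nat.lt_succ_self q), Finset.mul_sum,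
        Finset.sum_range_succ']
      simp only [mul_smul_comm, Nat.cast_zero, zero_smul, smul_zero, add_zero]
      refine Finset.sum_congr rfl fun k _ => ?_
      rw [smul_smul, Nat.factorial_succ, Nat.add_sub_cancel]
      congr 1
      have := Nat.cast_ne_zero (R := 𝕜).2 (Nat.factorial_ne_zero k)
      have := Nat.cast_add_one_ne_zero (R := 𝕜) k
      push_cast
      field_simp
  · simp only [Finset.smul_sum]
    rw [Finset.sum_comm]
    refine Finset.sum_congr rfl fun b _ => ?_
    rw [hφ.pullback_eq_sum hx (hf.oddDeriv b) (show q < q + 2 by lia), Finset.mul_sum]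
    simp only [mul_smul_comm]

end IsSuperDerivation

namespace SuperMap

theorem IsMorphism.evenDeriv_pullback (hφ : φ.IsMorphism U V) (hx : x ∈ U) {f : SFun 𝕜 p' q'}
    (hf : SmoothOn f V) (i : Fin p) :
    evenDeriv i (φ.pullback f) x = ∑ j, evenDeriv i (φ.even j) x * φ.pullback (evenDeriv j f) x +
      ∑ b, evenDeriv i (φ.odd b) x * φ.pullback (oddDeriv b f) x :=
  (isSuperDerivation_evenDeriv hφ.isOpen_source i).pullback hφ hx hf

theorem IsMorphism.oddDeriv_pullback (hφ : φ.IsMorphism U V) (hx : x ∈ U) {f : SFun 𝕜 p' q'}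
    (hf : SmoothOn f V) (i : Fin q) :
    oddDeriv i (φ.pullback f) x = ∑ j, oddDeriv i (φ.even j) x * φ.pullback (evenDeriv j f) x +
      ∑ b, oddDeriv i (φ.odd b) x * φ.pullback (oddDeriv b f) x :=
  (isSuperDerivation_oddDeriv i).pullback hφ hx hf

theorem IsMorphism.bodyMap_comp (hφ : φ.IsMorphism U V) (hχ : χ.IsMorphism V W) (hx : x ∈ U) :
    (χ.comp φ).bodyMap x = χ.bodyMap (φ.bodyMap x) :=
  funext fun i => by
    rw [bodyMap, bodyMap, comp, hφ.body_pullback hx (hχ.smooth_even i)]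

theorem IsMorphism.isRealElt_pullback (hφ : φ.IsMorphism U V) (hx : x ∈ U) {f : SFun 𝕜 p' q'}
    (hf : SmoothOn f V) (hr : ∀ y ∈ V, IsRealElt (f y)) : IsRealElt (φ.pullback f x) := by
  rw [hφ.pullback_eq_sum hx hf (Nat.lt_succ_self q)]
  refine IsRealElt.sum fun k _ => ?_
  have h1 : ∀ k, IsRealElt (φ.taylorTerm k f x) := fun k => by
    induction k generalizing f with
    | zero =>
      rw [taylorTerm_zero]
      refine IsRealElt.induction_on (P := fun w => IsRealElt (φ.oddSubst x w)) (fun A => ?_)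
        (fun u w hu hw => by rw [map_add]; exact hu.add hw)
        (fun r u hu => by rw [map_smul]; exact hu.smul r) (hr _ (hφ.mapsTo hx))
      rw [oddSubst_monomialBasis, oddMonomial]
      induction A.sort (· ≤ ·) with
      | nil => simpa [monomialBasis_empty] using isRealElt_monomialBasis (𝕜 := 𝕜) (q := q) ∅
      | cons a l ih => exact (hφ.real_odd a x hx).mul ih
    | succ k ih =>
      rw [taylorTerm_succ]
      refine IsRealElt.sum fun j _ => IsRealElt.mul ?_ (ih (hf.evenDeriv hφ.isOpen_target j)
        fun y hy => isRealElt_evenDeriv hφ.isOpen_target hf hr hy j)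
      have h2 := (hφ.real_even j x hx).add
        ((isRealElt_algebraMap (𝕜 := 𝕜) (q := q) (RCLike.re (body (φ.even j x)))).smul (-1))
      rw [(hφ.real_even j x hx).body] at h2
      simpa [soul, sub_eq_add_neg] using h2
  have h3 : ((k.factorial : 𝕜)⁻¹) = (((k.factorial : ℝ)⁻¹ : ℝ) : 𝕜) := by push_cast; rfl
  rw [h3]
  exact (h1 k).smul _

theorem IsMorphism.comp (hφ : φ.IsMorphism U V) (hχ : χ.IsMorphism V W) :
    (χ.comp φ).IsMorphism U W where
  isOpen_source := hφ.isOpen_source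
  isOpen_target := hχ.isOpen_target
  smooth_even i := hφ.smooth_pullback (hχ.smooth_even i)
  smooth_odd i := hφ.smooth_pullback (hχ.smooth_odd i)
  real_even i x hx := hφ.isRealElt_pullback hx (hχ.smooth_even i) (hχ.real_even i)
  real_odd i x hx := hφ.isRealElt_pullback hx (hχ.smooth_odd i) (hχ.real_odd i)
  parity_even i x hx := hasParity_zero_iff.2 (by
    refine (hφ.gradeInv_pullback hx (hχ.smooth_even i)).trans ?_
    exact hφ.pullback_congr hx fun y hy => hχ.gradeInv_even hy i)
  parity_odd i x hx := hasParity_one_iff.2 (by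
    refine (hφ.gradeInv_pullback hx (hχ.smooth_odd i)).trans ?_
    rw [hφ.pullback_congr hx (g := fun y => (-1 : 𝕜) • χ.odd i y) fun y hy => by
      simp [hχ.gradeInv_odd hy i], hφ.pullback_const_smul hx (hχ.smooth_odd i), neg_one_smul]
    rfl)
  mapsTo x hx := by
    rw [hφ.bodyMap_comp hχ hx]
    exact hχ.mapsTo (hφ.mapsTo hx)

/-- Re-expanding a Taylor series of Taylor series is avoided. Both sides have the same body, and by
the chain rule each odd derivative of their difference is a combination of the same differences for
derivatives of `f`; the order of the difference therefore exceeds every bound. -/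
theorem IsMorphism.pullback_pullback (hφ : φ.IsMorphism U V) (hχ : χ.IsMorphism V W) (hx : x ∈ U)
    {f : SFun 𝕜 p'' q''} (hf : SmoothOn f W) :
    φ.pullback (χ.pullback f) x = (χ.comp φ).pullback f x := by
  have hc := hφ.comp hχ
  -- The statement quantifies over `f` because the chain rule replaces `f` by its derivatives.
  have key : ∀ k, ∀ f : SFun 𝕜 p'' q'', SmoothOn f W →
      φ.pullback (χ.pullback f) x - (χ.comp φ).pullback f x ∈ orderGE k := by
    intro k
    induction k with
    | zero => intro f _; exact mem_orderGE_zero _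
    | succ k ih =>
      intro f hf
      have hp := hχ.smooth_pullback hf
      rw [mem_orderGE_succ]
      constructor
      · rw [← bodyₐ_apply, map_sub, bodyₐ_apply, bodyₐ_apply, hφ.body_pullback hx hp,
          hχ.body_pullback (hφ.mapsTo hx) hf, hc.body_pullback hx hf, hφ.bodyMap_comp hχ hx,
          sub_self]
      · intro a
        rw [map_sub, ← oddDeriv_apply, ← oddDeriv_apply, hφ.oddDeriv_pullback hx hp,
          hc.oddDeriv_pullback hx hf]
        have hE : ∀ j, φ.pullback (evenDeriv j (χ.pullback f)) x =
            ∑ l, φ.pullback (evenDeriv j (χ.even l)) x * φ.pullback (χ.pullback (evenDeriv l f)) x +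
            ∑ b, φ.pullback (evenDeriv j (χ.odd b)) x * φ.pullback (χ.pullback (oddDeriv b f)) x := by
          intro j
          have s1 : ∀ l, SmoothOn (fun y => evenDeriv j (χ.even l) y * χ.pullback (evenDeriv l f) y) V :=
            fun l => ((hχ.smooth_even l).evenDeriv hφ.isOpen_target j).mul
              (hχ.smooth_pullback (hf.evenDeriv hχ.isOpen_target l))
          have s2 : ∀ l, SmoothOn (fun y => evenDeriv j (χ.odd l) y * χ.pullback (oddDeriv l f) y) V :=
            fun l => ((hχ.smooth_odd l).evenDeriv hφ.isOpen_target j).mul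
              (hχ.smooth_pullback (hf.oddDeriv l))
          rw [hφ.pullback_congr hx fun y hy => hχ.evenDeriv_pullback hy hf j,
            hφ.pullback_add hx (SmoothOn.sum fun l _ => s1 l) (SmoothOn.sum fun l _ => s2 l),
            hφ.pullback_sum hx fun l _ => s1 l, hφ.pullback_sum hx fun l _ => s2 l]
          congr 1
          · exact Finset.sum_congr rfl fun l _ => hφ.pullback_mul hx
              ((hχ.smooth_even l).evenDeriv hφ.isOpen_target j)
              (hχ.smooth_pullback (hf.evenDeriv hχ.isOpen_target l))
          · exact Finset.sum_congr rfl fun l _ => hφ.pullback_mul hx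
              ((hχ.smooth_odd l).evenDeriv hφ.isOpen_target j) (hχ.smooth_pullback (hf.oddDeriv l))
        have hO : ∀ j, φ.pullback (oddDeriv j (χ.pullback f)) x =
            ∑ l, φ.pullback (oddDeriv j (χ.even l)) x * φ.pullback (χ.pullback (evenDeriv l f)) x +
            ∑ b, φ.pullback (oddDeriv j (χ.odd b)) x * φ.pullback (χ.pullback (oddDeriv b f)) x := by
          intro j
          have s1 : ∀ l, SmoothOn (fun y => oddDeriv j (χ.even l) y * χ.pullback (evenDeriv l f) y) V :=
            fun l => ((hχ.smooth_even l).oddDeriv j).mul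
              (hχ.smooth_pullback (hf.evenDeriv hχ.isOpen_target l))
          have s2 : ∀ l, SmoothOn (fun y => oddDeriv j (χ.odd l) y * χ.pullback (oddDeriv l f) y) V :=
            fun l => ((hχ.smooth_odd l).oddDeriv j).mul (hχ.smooth_pullback (hf.oddDeriv l))
          rw [hφ.pullback_congr hx fun y hy => hχ.oddDeriv_pullback hy hf j,
            hφ.pullback_add hx (SmoothOn.sum fun l _ => s1 l) (SmoothOn.sum fun l _ => s2 l),
            hφ.pullback_sum hx fun l _ => s1 l, hφ.pullback_sum hx fun l _ => s2 l]
          congr 1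
          · exact Finset.sum_congr rfl fun l _ => hφ.pullback_mul hx
              ((hχ.smooth_even l).oddDeriv j)
              (hχ.smooth_pullback (hf.evenDeriv hχ.isOpen_target l))
          · exact Finset.sum_congr rfl fun l _ => hφ.pullback_mul hx
              ((hχ.smooth_odd l).oddDeriv j) (hχ.smooth_pullback (hf.oddDeriv l))
        have hcE : ∀ l, oddDeriv a ((χ.comp φ).even l) x = _ :=
          fun l => hφ.oddDeriv_pullback hx (hχ.smooth_even l) a
        have hcO : ∀ l, oddDeriv a ((χ.comp φ).odd l) x = _ :=
          fun l => hφ.oddDeriv_pullback hx (hχ.smooth_odd l) a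
        have h3 : ∑ j, oddDeriv a (φ.even j) x * φ.pullback (evenDeriv j (χ.pullback f)) x +
            ∑ j, oddDeriv a (φ.odd j) x * φ.pullback (oddDeriv j (χ.pullback f)) x =
            ∑ l, oddDeriv a ((χ.comp φ).even l) x * φ.pullback (χ.pullback (evenDeriv l f)) x +
            ∑ b, oddDeriv a ((χ.comp φ).odd b) x * φ.pullback (χ.pullback (oddDeriv b f)) x := by
          simp only [hE, hO, hcE, hcO, mul_add, add_mul, Finset.mul_sum, Finset.sum_mul,
            Finset.sum_add_distrib, mul_assoc]
          rw [Finset.sum_comm (s := (Finset.univ : Finset (Fin p'))) (t := (Finset.univ : Finset (Fin p''))),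
            Finset.sum_comm (s := (Finset.univ : Finset (Fin p'))) (t := (Finset.univ : Finset (Fin q''))),
            Finset.sum_comm (s := (Finset.univ : Finset (Fin q'))) (t := (Finset.univ : Finset (Fin p''))),
            Finset.sum_comm (s := (Finset.univ : Finset (Fin q'))) (t := (Finset.univ : Finset (Fin q'')))]
          abel
        rw [h3, add_sub_add_comm, ← Finset.sum_sub_distrib, ← Finset.sum_sub_distrib]
        simp only [← mul_sub]
        have hm : ∀ u w : Grassmann 𝕜 q, w ∈ orderGE k → u * w ∈ orderGE k := fun u w h => by
          simpa using mul_mem_orderGE (mem_orderGE_zero u) h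
        exact Submodule.add_mem _
          (Submodule.sum_mem _ fun l _ => hm _ _ (ih _ (hf.evenDeriv hχ.isOpen_target l)))
          (Submodule.sum_mem _ fun l _ => hm _ _ (ih _ (hf.oddDeriv l)))
  exact sub_eq_zero.1 (eq_zero_of_mem_orderGE (Nat.lt_succ_self q) (key (q + 1) f hf))

theorem isMorphism_id (hU : IsOpen U) : (SuperMap.id 𝕜 p q).IsMorphism U U where
  isOpen_source := hU
  isOpen_target := hU
  smooth_even i := smooth_coord_even i
  smooth_odd i := smoothOn_const _
  real_even i x _ := isRealElt_algebraMap _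
  real_odd i x _ := by
    have := (isRealElt_monomialBasis (𝕜 := 𝕜) (q := q) ∅).oddGen_mul i
    rwa [monomialBasis_empty, mul_one] at this
  parity_even i x _ := hasParity_zero_iff.2 (AlgHom.commutes _ _)
  parity_odd i x _ := hasParity_one_iff.2 (gradeInv_oddGen i)
  mapsTo x hx := by
    have : (SuperMap.id 𝕜 p q).bodyMap x = x := funext fun i => by simp [bodyMap, SuperMap.id]
    rwa [this]

theorem pullback_id (hU : IsOpen U) (hx : x ∈ U) {f : SFun 𝕜 p q} (hf : SmoothOn f U) :
    (SuperMap.id 𝕜 p q).pullback f x = f x := by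
  have hm := isMorphism_id (𝕜 := 𝕜) (q := q) hU
  have hb : (SuperMap.id 𝕜 p q).bodyMap x = x := funext fun i => by simp [bodyMap, SuperMap.id]
  rw [hm.pullback_eq_sum hx hf (Nat.lt_succ_self q), Finset.sum_range_succ', Finset.sum_eq_zero,
    zero_add]
  · rw [Nat.factorial_zero, Nat.cast_one, inv_one, one_smul, taylorTerm_zero, hb]
    rw [← sum_coeff_smul (f x), map_sum]
    refine Finset.sum_congr rfl fun A _ => ?_
    rw [map_smul, oddSubst_monomialBasis, monomialBasis_eq_prod]
    rfl
  · intro k _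
    rw [taylorTerm_succ, Finset.sum_eq_zero, smul_zero]
    intro j _
    have : soul ((SuperMap.id 𝕜 p q).even j x) = 0 := by
      simp [soul, SuperMap.id]
    rw [this, zero_mul]

end SuperMap

end ChainRule

/-! ### The odd tangent bundle, the vector field d, and functoriality. -/

section OddTangentBundle

open Topology

variable {𝕜 : Type*} [RCLike 𝕜] {m n p' q' : ℕ} {U V W : Set (Fin m → ℝ)}
  {z : Fin (m + n) → ℝ} {φ χ : SuperMap 𝕜 m n m n}

/-- The inclusion of the functions of `ξ` into those of `(ξ, ψ)`. -/
def liftₐ (𝕜 : Type*) [RCLike 𝕜] (m n : ℕ) : Grassmann 𝕜 n →ₐ[𝕜] Grassmann 𝕜 (n + m) :=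
  ExteriorAlgebra.map ((Pi.basisFun 𝕜 (Fin n)).constr 𝕜
    (fun j => (Pi.single (Fin.castAdd m j) 1 : Fin (n + m) → 𝕜)))

theorem liftFun_apply (f : SFun 𝕜 m n) (z : Fin (m + n) → ℝ) :
    liftFun f z = liftₐ 𝕜 m n (f (basePt z)) := rfl

theorem liftₐ_oddGen (j : Fin n) : liftₐ 𝕜 m n (oddGen j) = oddGen (Fin.castAdd m j) := by
  rw [liftₐ, oddGen, ExteriorAlgebra.map_apply_ι, oddGen]
  congr 1
  have := (Pi.basisFun 𝕜 (Fin n)).constr_basis 𝕜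
    (fun j => (Pi.single (Fin.castAdd m j) 1 : Fin (n + m) → 𝕜)) j
  rwa [Pi.basisFun_apply] at this

theorem gradeInv_liftₐ (w : Grassmann 𝕜 n) :
    gradeInv (liftₐ 𝕜 m n w) = liftₐ 𝕜 m n (gradeInv w) := by
  induction w using grassmann_induction with
  | one => simp
  | add u v hu hv => rw [map_add, map_add, map_add, map_add, hu, hv]
  | smul c u hu => rw [map_smul, map_smul, map_smul, map_smul, hu]
  | gen_mul j u hu =>
    rw [map_mul, map_mul, map_mul, map_mul, hu, liftₐ_oddGen, gradeInv_oddGen, gradeInv_oddGen,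
      map_neg, liftₐ_oddGen]

theorem body_liftₐ (w : Grassmann 𝕜 n) : body (liftₐ 𝕜 m n w) = body w := by
  induction w using grassmann_induction with
  | one => simp
  | add u v hu hv => rw [map_add, body_add, body_add, hu, hv]
  | smul c u hu => rw [map_smul, body_smul, body_smul, hu]
  | gen_mul j u hu => rw [map_mul, body_mul, body_mul, liftₐ_oddGen, body_oddGen, body_oddGen,
      zero_mul, zero_mul]

theorem mem_tangentDomain : z ∈ tangentDomain n U ↔ basePt z ∈ U := Iff.rfl

theorem continuous_basePt : Continuous (basePt : (Fin (m + n) → ℝ) → Fin m → ℝ) :=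
  continuous_pi fun _ => continuous_apply _

theorem isOpen_tangentDomain (hU : IsOpen U) : IsOpen (tangentDomain n U) :=
  hU.preimage continuous_basePt

/-- The projection of the odd tangent bundle to its base. -/
def bundleProj (𝕜 : Type*) [RCLike 𝕜] (m n : ℕ) : SuperMap 𝕜 (m + n) (n + m) m n where
  even i := (SuperMap.id 𝕜 (m + n) (n + m)).even (Fin.castAdd n i)
  odd j := fun _ => oddGen (Fin.castAdd m j)

theorem bodyMap_bundleProj (z : Fin (m + n) → ℝ) : (bundleProj 𝕜 m n).bodyMap z = basePt z :=
  funext fun i => by simp [SuperMap.bodyMap, bundleProj, SuperMap.id, basePt]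

theorem isMorphism_bundleProj (hU : IsOpen U) :
    (bundleProj 𝕜 m n).IsMorphism (tangentDomain n U) U :=
  have h := SuperMap.isMorphism_id (𝕜 := 𝕜) (q := n + m) (isOpen_tangentDomain (n := n) hU)
  { isOpen_source := isOpen_tangentDomain hU
    isOpen_target := hU
    smooth_even := fun i => h.smooth_even _
    smooth_odd := fun j => h.smooth_odd (Fin.castAdd m j)
    real_even := fun i => h.real_even _
    real_odd := fun j => h.real_odd (Fin.castAdd m j)
    parity_even := fun i => h.parity_even _
    parity_odd := fun j => h.parity_odd (Fin.castAdd m j)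
    mapsTo := fun z hz => by rw [bodyMap_bundleProj]; exact hz }

theorem oddSubst_bundleProj (w : Grassmann 𝕜 n) :
    (bundleProj 𝕜 m n).oddSubst z w = liftₐ 𝕜 m n w := by
  have hm := isMorphism_bundleProj (𝕜 := 𝕜) (m := m) (n := n) isOpen_univ
  have hz : z ∈ tangentDomain n (Set.univ : Set (Fin m → ℝ)) := Set.mem_univ _
  induction w using grassmann_induction with
  | one => rw [SuperMap.oddSubst_one, map_one]
  | add u v hu hv => rw [map_add, map_add, hu, hv]
  | smul c u hu => rw [map_smul, map_smul, hu]
  | gen_mul j u hu =>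
    rw [hm.oddSubst_mul hz, map_mul, hu, liftₐ_oddGen, SuperMap.oddSubst_oddGen]
    rfl

/-- The projection has no soul, so the expansion stops at once. As a consequence smoothness, reality
and derivatives of lifted functions are instances of the general facts on pullbacks. -/
theorem pullback_bundleProj (hU : IsOpen U) (hz : z ∈ tangentDomain n U) {f : SFun 𝕜 m n}
    (hf : SmoothOn f U) : (bundleProj 𝕜 m n).pullback f z = liftFun f z := by
  rw [(isMorphism_bundleProj hU).pullback_eq_sum hz hf (Nat.lt_succ_self _),
    Finset.sum_range_succ', Finset.sum_eq_zero, zero_add, Nat.factorial_zero, Nat.cast_one,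
    inv_one, one_smul, SuperMap.taylorTerm_zero, oddSubst_bundleProj, bodyMap_bundleProj,
    liftFun_apply]
  intro k _
  rw [SuperMap.taylorTerm_succ, Finset.sum_eq_zero, smul_zero]
  intro j _
  have : soul ((bundleProj 𝕜 m n).even j z) = 0 := by
    simp [soul, SuperMap.id, bundleProj]
  rw [this, zero_mul]

theorem SmoothOn.liftFun (hU : IsOpen U) {f : SFun 𝕜 m n} (hf : SmoothOn f U) :
    SmoothOn (liftFun f) (tangentDomain n U) :=
  ((isMorphism_bundleProj hU).smooth_pullback hf).congr fun _ hz =>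
    (pullback_bundleProj hU hz hf).symm

theorem evenDeriv_castAdd_liftFun (hU : IsOpen U) {f : SFun 𝕜 m n} (hf : SmoothOn f U)
    (hz : z ∈ tangentDomain n U) (k : Fin m) :
    evenDeriv (Fin.castAdd n k) (liftFun f) z = liftFun (evenDeriv k f) z := by
  rw [evenDeriv_congr (isOpen_tangentDomain hU)
    (fun y hy => (pullback_bundleProj hU hy hf).symm) _ hz,
    (isMorphism_bundleProj hU).evenDeriv_pullback hz hf, Finset.sum_eq_single k,
    Finset.sum_eq_zero, pullback_bundleProj hU hz (hf.evenDeriv hU k)]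
  · simp [bundleProj, SuperMap.evenDeriv_coord]
  · intro b _
    simp [bundleProj, evenDeriv_const]
  · intro j _ hj
    simp [bundleProj, SuperMap.evenDeriv_coord, hj]
  · simp

theorem evenDeriv_natAdd_liftFun (hU : IsOpen U) {f : SFun 𝕜 m n} (hf : SmoothOn f U)
    (hz : z ∈ tangentDomain n U) (b : Fin n) :
    evenDeriv (Fin.natAdd m b) (liftFun f) z = 0 := by
  rw [evenDeriv_congr (isOpen_tangentDomain hU)
    (fun y hy => (pullback_bundleProj hU hy hf).symm) _ hz,
    (isMorphism_bundleProj hU).evenDeriv_pullback hz hf, Finset.sum_eq_zero,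
    Finset.sum_eq_zero, zero_add]
  · intro b _
    simp [bundleProj, evenDeriv_const]
  · intro j _
    have : Fin.castAdd n j ≠ Fin.natAdd m b := by
      intro h
      have := congrArg Fin.val h
      simp at this
      lia
    simp [bundleProj, SuperMap.evenDeriv_coord, this]

theorem leftDer_castAdd_liftₐ (w : Grassmann 𝕜 n) (a : Fin n) :
    leftDer (Fin.castAdd m a) (liftₐ 𝕜 m n w) = liftₐ 𝕜 m n (leftDer a w) := by
  induction w using grassmann_induction with
  | one => simp
  | add u v hu hv => rw [map_add, map_add, map_add, map_add, hu, hv]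
  | smul c u hu => rw [map_smul, map_smul, map_smul, map_smul, hu]
  | gen_mul j u hu =>
    rw [map_mul, liftₐ_oddGen, leftDer_oddGen_mul, leftDer_oddGen_mul, hu, map_sub, map_mul,
      liftₐ_oddGen, apply_ite (liftₐ 𝕜 m n), map_zero]
    simp only [Fin.castAdd_inj]

theorem leftDer_natAdd_liftₐ (w : Grassmann 𝕜 n) (k : Fin m) :
    leftDer (Fin.natAdd n k) (liftₐ 𝕜 m n w) = 0 := by
  induction w using grassmann_induction with
  | one => simp
  | add u v hu hv => rw [map_add, map_add, hu, hv, add_zero]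
  | smul c u hu => rw [map_smul, map_smul, hu, smul_zero]
  | gen_mul j u hu =>
    have : Fin.natAdd n k ≠ Fin.castAdd m j := by
      intro h
      have := congrArg Fin.val h
      simp at this
      lia
    rw [map_mul, liftₐ_oddGen, leftDer_oddGen_mul, hu, if_neg this, mul_zero, sub_zero]

theorem oddDeriv_castAdd_liftFun (f : SFun 𝕜 m n) (a : Fin n) :
    oddDeriv (Fin.castAdd m a) (liftFun f) z = liftFun (oddDeriv a f) z :=
  leftDer_castAdd_liftₐ _ _

theorem oddDeriv_natAdd_liftFun (f : SFun 𝕜 m n) (k : Fin m) :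
    oddDeriv (Fin.natAdd n k) (liftFun f) z = 0 :=
  leftDer_natAdd_liftₐ _ _

theorem castAdd_ne_natAdd (i : Fin m) (j : Fin n) : Fin.castAdd n i ≠ Fin.natAdd m j := by
  intro h
  have := congrArg Fin.val h
  simp at this
  lia

/-- The vector field `ψ^k ∂/∂x^k + y^β ∂/∂ξ^β` on the odd tangent bundle. -/
def deRham (f : SFun 𝕜 (m + n) (n + m)) : SFun 𝕜 (m + n) (n + m) := fun z =>
  ∑ k : Fin m, oddGen (Fin.natAdd n k) * evenDeriv (Fin.castAdd n k) f z +
    ∑ b : Fin n, (fibrePt z b : 𝕜) • oddDeriv (Fin.castAdd m b) f z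

theorem deRham_liftFun (hU : IsOpen U) {f : SFun 𝕜 m n} (hf : SmoothOn f U)
    (hz : z ∈ tangentDomain n U) : deRham (liftFun f) z = dFun f z := by
  simp only [deRham, dFun, evenDeriv_castAdd_liftFun hU hf hz, oddDeriv_castAdd_liftFun]

theorem contDiff_fibrePt (b : Fin n) :
    ContDiff ℝ ∞ (fun z : Fin (m + n) → ℝ => (fibrePt z b : 𝕜)) :=
  (RCLike.ofRealCLM (K := 𝕜)).contDiff.comp (contDiff_apply ℝ ℝ (Fin.natAdd m b))

theorem SmoothOn.deRham (hU : IsOpen U) {f : SFun 𝕜 (m + n) (n + m)}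
    (hf : SmoothOn f (tangentDomain n U)) : SmoothOn (deRham f) (tangentDomain n U) :=
  (SmoothOn.sum fun _ _ => (smoothOn_const _).mul
    (hf.evenDeriv (isOpen_tangentDomain hU) _)).add
    (SmoothOn.sum fun b _ => SmoothOn.smul (contDiff_fibrePt b).contDiffOn (hf.oddDeriv _))

theorem SmoothOn.dFun (hU : IsOpen U) {f : SFun 𝕜 m n} (hf : SmoothOn f U) :
    SmoothOn (dFun f) (tangentDomain n U) :=
  (SmoothOn.deRham hU (hf.liftFun hU)).congr fun _ hz => (deRham_liftFun hU hf hz).symm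

theorem deRham_congr (hU : IsOpen U) {f g : SFun 𝕜 (m + n) (n + m)}
    (h : Set.EqOn f g (tangentDomain n U)) : Set.EqOn (deRham f) (deRham g) (tangentDomain n U) :=
  fun z hz => by
    simp only [deRham, evenDeriv_congr (isOpen_tangentDomain hU) h _ hz, oddDeriv_apply, h hz]

theorem dFun_congr (hU : IsOpen U) {f g : SFun 𝕜 m n}
    (h : Set.EqOn f g U) : Set.EqOn (dFun f : SFun 𝕜 (m + n) (n + m)) (dFun g) (tangentDomain n U) :=
  fun z hz => by
    simp only [dFun, liftFun_apply, evenDeriv_congr hU h _ hz, oddDeriv_apply, h hz]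

/-- The coefficients ψ^k and y^β stand to the left of the derivatives, so the chain rule passes to d
without signs. -/
theorem deRham_pullback {φ : SuperMap 𝕜 (m + n) (n + m) p' q'} {V : Set (Fin p' → ℝ)}
    (hφ : φ.IsMorphism (tangentDomain n U) V) (hz : z ∈ tangentDomain n U) {f : SFun 𝕜 p' q'}
    (hf : SmoothOn f V) :
    deRham (φ.pullback f) z = ∑ j, deRham (φ.even j) z * φ.pullback (evenDeriv j f) z +
      ∑ b, deRham (φ.odd b) z * φ.pullback (oddDeriv b f) z := by
  simp only [deRham, hφ.evenDeriv_pullback hz hf, hφ.oddDeriv_pullback hz hf, add_mul, mul_add,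
    Finset.sum_mul, Finset.mul_sum, Finset.sum_add_distrib, smul_add, Finset.smul_sum, mul_assoc,
    smul_mul_assoc]
  rw [Finset.sum_comm (s := (Finset.univ : Finset (Fin p'))),
    Finset.sum_comm (s := (Finset.univ : Finset (Fin p'))),
    Finset.sum_comm (s := (Finset.univ : Finset (Fin q'))),
    Finset.sum_comm (s := (Finset.univ : Finset (Fin q')))]
  abel

theorem evenDeriv_natAdd_fibrePt (b c : Fin n) :
    evenDeriv (Fin.natAdd m b) (fun z : Fin (m + n) → ℝ =>
      algebraMap 𝕜 (Grassmann 𝕜 (n + m)) (fibrePt z c : 𝕜)) z = if c = b then 1 else 0 := by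
  have := SuperMap.evenDeriv_coord (𝕜 := 𝕜) (q' := n + m) (Fin.natAdd m c) (Fin.natAdd m b) z
  simp only [Fin.natAdd_inj] at this
  exact this

theorem evenDeriv_castAdd_fibrePt (k : Fin m) (c : Fin n) :
    evenDeriv (Fin.castAdd n k) (fun z : Fin (m + n) → ℝ =>
      algebraMap 𝕜 (Grassmann 𝕜 (n + m)) (fibrePt z c : 𝕜)) z = 0 := by
  have := SuperMap.evenDeriv_coord (𝕜 := 𝕜) (q' := n + m) (Fin.natAdd m c) (Fin.castAdd n k) z
  rw [if_neg (castAdd_ne_natAdd k c).symm] at this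
  exact this

theorem smooth_fibrePt {S : Set (Fin (m + n) → ℝ)} (c : Fin n) :
    SmoothOn (fun z : Fin (m + n) → ℝ =>
      algebraMap 𝕜 (Grassmann 𝕜 (n + m)) (fibrePt z c : 𝕜)) S :=
  SmoothOn.algebraMap (c := fun z => (fibrePt z c : 𝕜)) (contDiff_fibrePt c).contDiffOn

theorem dFun_eq (f : SFun 𝕜 m n) :
    (dFun f : SFun 𝕜 (m + n) (n + m)) = fun z =>
      ∑ k : Fin m, (fun _ => oddGen (Fin.natAdd n k) : SFun 𝕜 (m + n) (n + m)) z *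
        liftFun (evenDeriv k f) z +
      ∑ b : Fin n, algebraMap 𝕜 (Grassmann 𝕜 (n + m)) (fibrePt z b : 𝕜) *
        liftFun (oddDeriv b f) z := by
  funext z
  simp only [dFun, Algebra.smul_def]

theorem deRham_eq (f : SFun 𝕜 (m + n) (n + m)) :
    (deRham f : SFun 𝕜 (m + n) (n + m)) = fun z =>
      ∑ k : Fin m, (fun _ => oddGen (Fin.natAdd n k) : SFun 𝕜 (m + n) (n + m)) z *
        evenDeriv (Fin.castAdd n k) f z +
      ∑ b : Fin n, algebraMap 𝕜 (Grassmann 𝕜 (n + m)) (fibrePt z b : 𝕜) *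
        oddDeriv (Fin.castAdd m b) f z := by
  funext z
  simp only [deRham, Algebra.smul_def]

/-- The derivative of an expression `ψ^k a_k + y^β b_β`. -/
theorem evenDeriv_sum_add_sum {S : Set (Fin (m + n) → ℝ)} (hS : IsOpen S) (hz : z ∈ S)
    {a : Fin m → SFun 𝕜 (m + n) (n + m)} {b : Fin n → SFun 𝕜 (m + n) (n + m)}
    (ha : ∀ k, SmoothOn (a k) S) (hb : ∀ k, SmoothOn (b k) S) (i : Fin (m + n)) :
    evenDeriv i (fun z => ∑ k : Fin m, (fun _ => oddGen (Fin.natAdd n k) :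
      SFun 𝕜 (m + n) (n + m)) z * a k z + ∑ c : Fin n,
        algebraMap 𝕜 (Grassmann 𝕜 (n + m)) (fibrePt z c : 𝕜) * b c z) z =
    ∑ k : Fin m, oddGen (Fin.natAdd n k) * evenDeriv i (a k) z + ∑ c : Fin n,
      (evenDeriv i (fun z : Fin (m + n) → ℝ =>
        algebraMap 𝕜 (Grassmann 𝕜 (n + m)) (fibrePt z c : 𝕜)) z * b c z +
        (fibrePt z c : 𝕜) • evenDeriv i (b c) z) := by
  have h1 : ∀ k, SmoothOn (fun z => (fun _ => oddGen (Fin.natAdd n k) :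
      SFun 𝕜 (m + n) (n + m)) z * a k z) S := fun k => (smoothOn_const _).mul (ha k)
  have h2 : ∀ c, SmoothOn (fun z => algebraMap 𝕜 (Grassmann 𝕜 (n + m)) (fibrePt z c : 𝕜) *
      b c z) S := fun c => (smooth_fibrePt c).mul (hb c)
  rw [evenDeriv_add hS (SmoothOn.sum fun k _ => h1 k) (SmoothOn.sum fun k _ => h2 k) hz,
    evenDeriv_sum hS (fun k _ => h1 k) hz, evenDeriv_sum hS (fun k _ => h2 k) hz]
  congr 1
  · refine Finset.sum_congr rfl fun k _ => ?_
    rw [evenDeriv_mul hS (smoothOn_const _) (ha k) hz, evenDeriv_const, zero_mul, zero_add]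
  · refine Finset.sum_congr rfl fun c _ => ?_
    rw [evenDeriv_mul hS (smooth_fibrePt c) (hb c) hz, Algebra.smul_def]

theorem evenDeriv_castAdd_dFun (hU : IsOpen U) {f : SFun 𝕜 m n} (hf : SmoothOn f U)
    (hz : z ∈ tangentDomain n U) (k : Fin m) :
    evenDeriv (Fin.castAdd n k) (dFun f) z = dFun (evenDeriv k f) z := by
  rw [dFun_eq, evenDeriv_sum_add_sum (isOpen_tangentDomain hU) hz
    (fun l => (hf.evenDeriv hU l).liftFun hU) (fun b => (hf.oddDeriv b).liftFun hU)]
  simp only [dFun, evenDeriv_castAdd_fibrePt, zero_mul, zero_add,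
    evenDeriv_castAdd_liftFun hU (hf.evenDeriv hU _) hz,
    evenDeriv_castAdd_liftFun hU (hf.oddDeriv _) hz]
  simp only [liftFun_apply, evenDeriv_comm hU hf hz k, evenDeriv_oddDeriv hU hf hz k]

/-- The differential is linear in the fibre coordinates, so its fibre derivatives are functions of
the base. This makes the Jacobian of the induced transformation block triangular and gives
transformed fibre derivatives coefficients from the base. -/
theorem evenDeriv_natAdd_dFun (hU : IsOpen U) {f : SFun 𝕜 m n} (hf : SmoothOn f U)
    (hz : z ∈ tangentDomain n U) (b : Fin n) :
    evenDeriv (Fin.natAdd m b) (dFun f) z = liftFun (oddDeriv b f) z := by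
  rw [dFun_eq, evenDeriv_sum_add_sum (isOpen_tangentDomain hU) hz
    (fun l => (hf.evenDeriv hU l).liftFun hU) (fun b => (hf.oddDeriv b).liftFun hU)]
  simp [evenDeriv_natAdd_fibrePt, evenDeriv_natAdd_liftFun hU (hf.evenDeriv hU _) hz,
    evenDeriv_natAdd_liftFun hU (hf.oddDeriv _) hz]

theorem oddDeriv_castAdd_dFun (hU : IsOpen U) {f : SFun 𝕜 m n} (hf : SmoothOn f U)
    (hz : z ∈ tangentDomain n U) (c : Fin n) :
    oddDeriv (Fin.castAdd m c) (dFun f) z = -dFun (oddDeriv c f) z := by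
  rw [oddDeriv_apply, dFun, dFun, map_add, map_sum, map_sum, neg_add, ← Finset.sum_neg_distrib,
    ← Finset.sum_neg_distrib]
  congr 1
  · refine Finset.sum_congr rfl fun k _ => ?_
    rw [leftDer_oddGen_mul, if_neg (castAdd_ne_natAdd c k), zero_sub, liftFun_apply,
      leftDer_castAdd_liftₐ, liftFun_apply, evenDeriv_oddDeriv hU hf hz, oddDeriv_apply]
  · refine Finset.sum_congr rfl fun b _ => ?_
    rw [map_smul, liftFun_apply, leftDer_castAdd_liftₐ, liftFun_apply, oddDeriv_apply,
      oddDeriv_apply, oddDeriv_apply, leftDer_comm, map_neg, smul_neg]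

theorem oddDeriv_natAdd_dFun (f : SFun 𝕜 m n) (k : Fin m) :
    oddDeriv (Fin.natAdd n k) (dFun f) z = liftFun (evenDeriv k f) z := by
  rw [oddDeriv_apply, dFun, map_add, map_sum, map_sum]
  simp only [leftDer_oddGen_mul, map_smul, liftFun_apply, leftDer_natAdd_liftₐ, mul_zero,
    smul_zero, sub_zero, Finset.sum_const_zero, add_zero, Fin.natAdd_inj]
  simp

theorem sum_sum_eq_zero_of_antisymm {ι : Type*} [Fintype ι] {q : ℕ}
    (a : ι → ι → Grassmann 𝕜 q) (h : ∀ i j, a i j = -a j i) : ∑ i, ∑ j, a i j = 0 := by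
  apply eq_zero_of_eq_neg
  conv_lhs => rw [Finset.sum_comm]
  rw [← Finset.sum_neg_distrib]
  refine Finset.sum_congr rfl fun i _ => ?_
  rw [← Finset.sum_neg_distrib]
  exact Finset.sum_congr rfl fun j _ => h j i

/-- In d(df) the terms ψψ∂∂ vanish because the ψ anticommute while the derivatives in x commute, the
terms yy∂∂ for the opposite reason, and the two kinds of mixed terms cancel because d anticommutes
with ∂/∂ξ. -/
theorem deRham_dFun (hU : IsOpen U) {f : SFun 𝕜 m n} (hf : SmoothOn f U)
    (hz : z ∈ tangentDomain n U) : deRham (dFun f) z = 0 := by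
  simp only [deRham, evenDeriv_castAdd_dFun hU hf hz, oddDeriv_castAdd_dFun hU hf hz]
  simp only [dFun, mul_add, smul_neg, smul_add, neg_add, Finset.sum_add_distrib, Finset.mul_sum,
    Finset.smul_sum, ← Finset.sum_neg_distrib, mul_smul_comm]
  have h1 : ∑ l : Fin m, ∑ k : Fin m, (oddGen (Fin.natAdd n l) : Grassmann 𝕜 (n + m)) *
      (oddGen (Fin.natAdd n k) * liftFun (evenDeriv k (evenDeriv l f)) z) = 0 := by
    refine sum_sum_eq_zero_of_antisymm _ fun l k => ?_
    rw [← mul_assoc, mul_oddGen, gradeInv_oddGen, liftFun_apply, liftFun_apply,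
      evenDeriv_comm hU hf hz]
    noncomm_ring
  have h2 : ∑ c : Fin n, ∑ b : Fin n, -((fibrePt z c : 𝕜) • (fibrePt z b : 𝕜) •
      (liftFun (oddDeriv b (oddDeriv c f)) z : Grassmann 𝕜 (n + m))) = 0 := by
    refine sum_sum_eq_zero_of_antisymm _ fun c b => ?_
    rw [neg_neg, smul_comm, liftFun_apply, liftFun_apply, oddDeriv_apply, oddDeriv_apply,
      leftDer_comm, map_neg, smul_neg, smul_neg, neg_neg]
    rfl
  rw [h1, h2, zero_add, add_zero, Finset.sum_comm, ← Finset.sum_add_distrib]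
  refine Finset.sum_eq_zero fun c _ => ?_
  rw [← Finset.sum_add_distrib]
  refine Finset.sum_eq_zero fun k _ => ?_
  rw [liftFun_apply, liftFun_apply, evenDeriv_oddDeriv hU hf hz, add_neg_cancel]

theorem gradeInv_dFun (hU : IsOpen U) {f : SFun 𝕜 m n} (hf : SmoothOn f U)
    (hz : z ∈ tangentDomain n U) :
    gradeInv (dFun f z : Grassmann 𝕜 (n + m)) = -dFun (fun x => gradeInv (f x)) z := by
  simp only [dFun, map_add, map_sum, map_mul, map_smul, gradeInv_oddGen, liftFun_apply,
    gradeInv_liftₐ, gradeInv_evenDeriv hU hf hz, oddDeriv_apply, leftDer_gradeInv, map_neg,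
    smul_neg, Finset.sum_neg_distrib, neg_mul, neg_add, neg_neg]

theorem dFun_const_smul (hU : IsOpen U) {f : SFun 𝕜 m n} (hf : SmoothOn f U)
    (hz : z ∈ tangentDomain n U) (c : 𝕜) :
    (dFun (fun x => c • f x) z : Grassmann 𝕜 (n + m)) = c • dFun f z := by
  simp only [dFun, liftFun_apply, evenDeriv_const_smul hU hf hz, oddDeriv_apply, map_smul,
    mul_smul_comm, smul_add, Finset.smul_sum, smul_smul, mul_comm c]

theorem isRealElt_liftFun (hU : IsOpen U) {f : SFun 𝕜 m n} (hf : SmoothOn f U)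
    (hr : ∀ x ∈ U, IsRealElt (f x)) (hz : z ∈ tangentDomain n U) : IsRealElt (liftFun f z) := by
  rw [← pullback_bundleProj hU hz hf]
  exact (isMorphism_bundleProj hU).isRealElt_pullback hz hf hr

theorem isRealElt_dFun (hU : IsOpen U) {f : SFun 𝕜 m n} (hf : SmoothOn f U)
    (hr : ∀ x ∈ U, IsRealElt (f x)) (hz : z ∈ tangentDomain n U) :
    IsRealElt (dFun f z : Grassmann 𝕜 (n + m)) :=
  (IsRealElt.sum fun k _ => (isRealElt_liftFun hU (hf.evenDeriv hU k)
    (fun _ hx => isRealElt_evenDeriv hU hf hr hx k) hz).oddGen_mul _).add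
    (IsRealElt.sum fun b _ => (isRealElt_liftFun hU (hf.oddDeriv b)
      (fun x hx => (hr x hx).leftDer b) hz).smul _)

namespace SuperMap

@[simp] theorem oddTangent_even_castAdd (φ : SuperMap 𝕜 m n m n) (i : Fin m) :
    φ.oddTangent.even (Fin.castAdd n i) = liftFun (φ.even i) := by simp [oddTangent]

@[simp] theorem oddTangent_even_natAdd (φ : SuperMap 𝕜 m n m n) (a : Fin n) :
    φ.oddTangent.even (Fin.natAdd m a) = dFun (φ.odd a) := by simp [oddTangent]

@[simp] theorem oddTangent_odd_castAdd (φ : SuperMap 𝕜 m n m n) (a : Fin n) :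
    φ.oddTangent.odd (Fin.castAdd m a) = liftFun (φ.odd a) := by simp [oddTangent]

@[simp] theorem oddTangent_odd_natAdd (φ : SuperMap 𝕜 m n m n) (i : Fin m) :
    φ.oddTangent.odd (Fin.natAdd n i) = dFun (φ.even i) := by simp [oddTangent]

theorem basePt_bodyMap_oddTangent (φ : SuperMap 𝕜 m n m n) (z : Fin (m + n) → ℝ) :
    basePt (φ.oddTangent.bodyMap z) = φ.bodyMap (basePt z) :=
  funext fun i => by
    rw [basePt, bodyMap, bodyMap, oddTangent_even_castAdd, liftFun_apply, body_liftₐ]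

theorem IsMorphism.oddTangent (hφ : φ.IsMorphism U V) :
    φ.oddTangent.IsMorphism (tangentDomain n U) (tangentDomain n V) where
  isOpen_source := isOpen_tangentDomain hφ.isOpen_source
  isOpen_target := isOpen_tangentDomain hφ.isOpen_target
  smooth_even i := by
    refine Fin.addCases (fun i => ?_) (fun a => ?_) i
    · rw [oddTangent_even_castAdd]; exact (hφ.smooth_even i).liftFun hφ.isOpen_source
    · rw [oddTangent_even_natAdd]; exact (hφ.smooth_odd a).dFun hφ.isOpen_source
  smooth_odd i := by
    refine Fin.addCases (fun i => ?_) (fun a => ?_) i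
    · rw [oddTangent_odd_castAdd]; exact (hφ.smooth_odd i).liftFun hφ.isOpen_source
    · rw [oddTangent_odd_natAdd]; exact (hφ.smooth_even a).dFun hφ.isOpen_source
  real_even i z hz := by
    refine Fin.addCases (fun i => ?_) (fun a => ?_) i
    · rw [oddTangent_even_castAdd]
      exact isRealElt_liftFun hφ.isOpen_source (hφ.smooth_even i) (hφ.real_even i) hz
    · rw [oddTangent_even_natAdd]
      exact isRealElt_dFun hφ.isOpen_source (hφ.smooth_odd a) (hφ.real_odd a) hz
  real_odd i z hz := by
    refine Fin.addCases (fun i => ?_) (fun a => ?_) i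
    · rw [oddTangent_odd_castAdd]
      exact isRealElt_liftFun hφ.isOpen_source (hφ.smooth_odd i) (hφ.real_odd i) hz
    · rw [oddTangent_odd_natAdd]
      exact isRealElt_dFun hφ.isOpen_source (hφ.smooth_even a) (hφ.real_even a) hz
  parity_even i z hz := by
    refine Fin.addCases (fun i => ?_) (fun a => ?_) i
    · rw [oddTangent_even_castAdd, hasParity_zero_iff, liftFun_apply, gradeInv_liftₐ,
        hφ.gradeInv_even hz]
    · rw [oddTangent_even_natAdd, hasParity_zero_iff,
        gradeInv_dFun hφ.isOpen_source (hφ.smooth_odd a) hz,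
        dFun_congr hφ.isOpen_source (g := fun x => (-1 : 𝕜) • φ.odd a x)
          (fun x hx => (hφ.gradeInv_odd hx a).trans (neg_one_smul 𝕜 _).symm) hz,
        dFun_const_smul hφ.isOpen_source (hφ.smooth_odd a) hz, neg_one_smul, neg_neg]
  parity_odd i z hz := by
    refine Fin.addCases (fun i => ?_) (fun a => ?_) i
    · rw [oddTangent_odd_castAdd, hasParity_one_iff, liftFun_apply, gradeInv_liftₐ,
        hφ.gradeInv_odd hz, map_neg]
    · rw [oddTangent_odd_natAdd, hasParity_one_iff,
        gradeInv_dFun hφ.isOpen_source (hφ.smooth_even a) hz,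
        dFun_congr hφ.isOpen_source (fun x hx => hφ.gradeInv_even hx a) hz]
  mapsTo z hz := by
    rw [mem_tangentDomain, basePt_bodyMap_oddTangent]
    exact hφ.mapsTo hz

/-- The transformation covers the change of base coordinates: its composite with the projection
equals the projection followed by `φ`, and both sides are pullbacks along this one map. -/
theorem IsMorphism.oddTangent_pullback_liftFun (hφ : φ.IsMorphism U V)
    (hz : z ∈ tangentDomain n U) {f : SFun 𝕜 m n} (hf : SmoothOn f V) :
    φ.oddTangent.pullback (liftFun f) z = liftFun (φ.pullback f) z := by
  have hT := hφ.oddTangent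
  have hU := hφ.isOpen_source
  have hV := hφ.isOpen_target
  rw [hT.pullback_congr hz (fun y hy => (pullback_bundleProj hV hy hf).symm),
    hT.pullback_pullback (isMorphism_bundleProj hV) hz hf,
    ← pullback_bundleProj hU hz (hφ.smooth_pullback hf),
    (isMorphism_bundleProj hU).pullback_pullback hφ hz hf]
  refine pullback_eq_of_eq (fun i => ?_) (fun j => ?_) f
  · refine (hT.pullback_coord_even hz _).trans ?_
    rw [oddTangent_even_castAdd]
    exact (pullback_bundleProj hU hz (hφ.smooth_even i)).symm
  · refine (hT.pullback_coord_odd hz (Fin.castAdd m j)).trans ?_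
    rw [oddTangent_odd_castAdd]
    exact (pullback_bundleProj hU hz (hφ.smooth_odd j)).symm

/-- By the chain rule d of a pullback is the sum of the d of the components of Φ times pulled-back
derivatives. The d of a base component is a fibre component by definition of Φ, which is the
pullback of ψ or y; the d of a fibre component is zero since d(df) = 0. -/
theorem IsMorphism.oddTangent_pullback_deRham (hφ : φ.IsMorphism U V)
    (hz : z ∈ tangentDomain n U) {f : SFun 𝕜 (m + n) (n + m)}
    (hf : SmoothOn f (tangentDomain n V)) :
    φ.oddTangent.pullback (deRham f) z = deRham (φ.oddTangent.pullback f) z := by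
  have hT := hφ.oddTangent
  have hU := hφ.isOpen_source
  have hV := isOpen_tangentDomain (n := n) hφ.isOpen_target
  have s1 : ∀ k : Fin m, SmoothOn (fun z => (fun _ => oddGen (Fin.natAdd n k) :
      SFun 𝕜 (m + n) (n + m)) z * evenDeriv (Fin.castAdd n k) f z) (tangentDomain n V) :=
    fun k => (smoothOn_const _).mul (hf.evenDeriv hV _)
  have s2 : ∀ b : Fin n, SmoothOn (fun z => algebraMap 𝕜 (Grassmann 𝕜 (n + m)) (fibrePt z b : 𝕜) *
      oddDeriv (Fin.castAdd m b) f z) (tangentDomain n V) :=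
    fun b => (smooth_fibrePt b).mul (hf.oddDeriv _)
  rw [deRham_eq, hT.pullback_add hz (SmoothOn.sum fun k _ => s1 k) (SmoothOn.sum fun k _ => s2 k),
    hT.pullback_sum hz (fun k _ => s1 k), hT.pullback_sum hz (fun k _ => s2 k),
    deRham_pullback hT hz hf, Fin.sum_univ_add, Fin.sum_univ_add]
  have e1 : ∀ k : Fin m, φ.oddTangent.pullback (fun z => (fun _ => oddGen (Fin.natAdd n k) :
      SFun 𝕜 (m + n) (n + m)) z * evenDeriv (Fin.castAdd n k) f z) z =
      dFun (φ.even k) z * φ.oddTangent.pullback (evenDeriv (Fin.castAdd n k) f) z := fun k => by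
    rw [hT.pullback_mul hz (smoothOn_const _) (hf.evenDeriv hV _), ← oddTangent_odd_natAdd]
    congr 1
    exact hT.pullback_coord_odd hz (Fin.natAdd n k)
  have e2 : ∀ b : Fin n, φ.oddTangent.pullback (fun z =>
      algebraMap 𝕜 (Grassmann 𝕜 (n + m)) (fibrePt z b : 𝕜) * oddDeriv (Fin.castAdd m b) f z) z =
      dFun (φ.odd b) z * φ.oddTangent.pullback (oddDeriv (Fin.castAdd m b) f) z := fun b => by
    rw [hT.pullback_mul hz (smooth_fibrePt b) (hf.oddDeriv _), ← oddTangent_even_natAdd]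
    congr 1
    exact hT.pullback_coord_even hz (Fin.natAdd m b)
  simp only [e1, e2, oddTangent_even_castAdd, oddTangent_even_natAdd, oddTangent_odd_castAdd,
    oddTangent_odd_natAdd, deRham_liftFun hU (hφ.smooth_even _) hz,
    deRham_liftFun hU (hφ.smooth_odd _) hz, deRham_dFun hU (hφ.smooth_even _) hz,
    deRham_dFun hU (hφ.smooth_odd _) hz, zero_mul, Finset.sum_const_zero, add_zero]

theorem IsMorphism.oddTangent_pullback_dFun (hφ : φ.IsMorphism U V)
    (hz : z ∈ tangentDomain n U) {f : SFun 𝕜 m n} (hf : SmoothOn f V) :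
    φ.oddTangent.pullback (dFun f) z = dFun (φ.pullback f) z := by
  have hU := hφ.isOpen_source
  have hV := hφ.isOpen_target
  rw [hφ.oddTangent.pullback_congr hz (fun y hy => (deRham_liftFun hV hf hy).symm),
    hφ.oddTangent_pullback_deRham hz (hf.liftFun hV),
    deRham_congr hU (fun y hy => hφ.oddTangent_pullback_liftFun hy hf) hz,
    deRham_liftFun hU (hφ.smooth_pullback hf) hz]

/-- Base components compose because Φ covers `φ`, fibre components because the pullback commutes
with the differential. -/
theorem IsMorphism.oddTangent_comp (hφ : φ.IsMorphism U V) (hχ : χ.IsMorphism V W) :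
    (χ.oddTangent.comp φ.oddTangent).EqOver (χ.comp φ).oddTangent (tangentDomain n U) := by
  constructor
  · intro i z hz
    refine Fin.addCases (fun i => ?_) (fun a => ?_) i
    · rw [oddTangent_even_castAdd]
      refine Eq.trans ?_ (hφ.oddTangent_pullback_liftFun hz (hχ.smooth_even i))
      rw [← oddTangent_even_castAdd]; rfl
    · rw [oddTangent_even_natAdd]
      refine Eq.trans ?_ (hφ.oddTangent_pullback_dFun hz (hχ.smooth_odd a))
      rw [← oddTangent_even_natAdd]; rfl
  · intro i z hz
    refine Fin.addCases (fun i => ?_) (fun a => ?_) i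
    · rw [oddTangent_odd_castAdd]
      refine Eq.trans ?_ (hφ.oddTangent_pullback_liftFun hz (hχ.smooth_odd i))
      rw [← oddTangent_odd_castAdd]; rfl
    · rw [oddTangent_odd_natAdd]
      refine Eq.trans ?_ (hφ.oddTangent_pullback_dFun hz (hχ.smooth_even a))
      rw [← oddTangent_odd_natAdd]; rfl

theorem EqOver.oddTangent (hU : IsOpen U) (h : φ.EqOver χ U) :
    φ.oddTangent.EqOver χ.oddTangent (tangentDomain n U) := by
  constructor
  · intro i z hz
    refine Fin.addCases (fun i => ?_) (fun a => ?_) i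
    · rw [oddTangent_even_castAdd, oddTangent_even_castAdd, liftFun_apply, liftFun_apply, h.1 i hz]
    · rw [oddTangent_even_natAdd, oddTangent_even_natAdd, dFun_congr hU (h.2 a) hz]
  · intro i z hz
    refine Fin.addCases (fun i => ?_) (fun a => ?_) i
    · rw [oddTangent_odd_castAdd, oddTangent_odd_castAdd, liftFun_apply, liftFun_apply, h.2 i hz]
    · rw [oddTangent_odd_natAdd, oddTangent_odd_natAdd, dFun_congr hU (h.1 a) hz]

theorem oddTangent_id : (SuperMap.id 𝕜 m n).oddTangent.EqOver (SuperMap.id 𝕜 (m + n) (n + m)) Set.univ := by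
  constructor
  · intro i z _
    refine Fin.addCases (fun i => ?_) (fun a => ?_) i
    · rw [oddTangent_even_castAdd, liftFun_apply]
      exact AlgHom.commutes _ _
    · rw [oddTangent_even_natAdd]
      simp [dFun, liftFun_apply, SuperMap.id, oddDeriv_apply, evenDeriv_const, leftDer_oddGen,
        apply_ite (liftₐ 𝕜 m n), Algebra.algebraMap_eq_smul_one, fibrePt]
  · intro i z _
    refine Fin.addCases (fun i => ?_) (fun a => ?_) i
    · rw [oddTangent_odd_castAdd, liftFun_apply]
      exact liftₐ_oddGen i
    · rw [oddTangent_odd_natAdd]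
      simp only [dFun, liftFun_apply, evenDeriv_coord, oddDeriv_apply]
      simp [SuperMap.id, apply_ite (liftₐ 𝕜 m n)]

/-- `χ` is an inverse of the coordinate change `φ`. -/
structure IsInverse (φ χ : SuperMap 𝕜 p' q' p' q') (U V : Set (Fin p' → ℝ)) : Prop where
  morphism : φ.IsMorphism U V
  morphism_inv : χ.IsMorphism V U
  left_inv : (χ.comp φ).EqOver (SuperMap.id 𝕜 p' q') U
  right_inv : (φ.comp χ).EqOver (SuperMap.id 𝕜 p' q') V

theorem isCoordChange_iff {φ : SuperMap 𝕜 p' q' p' q'} {U V : Set (Fin p' → ℝ)} :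
    φ.IsCoordChange U V ↔ ∃ χ, φ.IsInverse χ U V :=
  ⟨fun ⟨h, χ, h1, h2, h3⟩ => ⟨χ, h, h1, h2, h3⟩, fun ⟨χ, h⟩ => ⟨h.1, χ, h.2, h.3, h.4⟩⟩

theorem IsInverse.symm {φ χ : SuperMap 𝕜 p' q' p' q'} {U V : Set (Fin p' → ℝ)}
    (h : φ.IsInverse χ U V) : χ.IsInverse φ V U := ⟨h.2, h.1, h.4, h.3⟩

theorem IsInverse.pullback_pullback {φ χ : SuperMap 𝕜 p' q' p' q'} {U V : Set (Fin p' → ℝ)}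
    (h : φ.IsInverse χ U V) {x : Fin p' → ℝ} (hx : x ∈ U) {f : SFun 𝕜 p' q'} (hf : SmoothOn f U) :
    φ.pullback (χ.pullback f) x = f x := by
  rw [h.1.pullback_pullback h.2 hx hf,
    pullback_eq_of_eq (fun i => h.3.1 i hx) (fun j => h.3.2 j hx),
    pullback_id h.1.isOpen_source hx hf]

theorem IsInverse.bodyMap_bodyMap {φ χ : SuperMap 𝕜 p' q' p' q'} {U V : Set (Fin p' → ℝ)}
    (h : φ.IsInverse χ U V) {x : Fin p' → ℝ} (hx : x ∈ U) :
    χ.bodyMap (φ.bodyMap x) = x := by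
  rw [← h.1.bodyMap_comp h.2 hx]
  funext i
  rw [bodyMap, h.3.1 i hx]
  simp [SuperMap.id]

theorem IsInverse.oddTangent (h : φ.IsInverse χ U V) :
    φ.oddTangent.IsInverse χ.oddTangent (tangentDomain n U) (tangentDomain n V) := by
  have key : ∀ {φ χ : SuperMap 𝕜 m n m n} {U V : Set (Fin m → ℝ)}, φ.IsInverse χ U V →
      (χ.oddTangent.comp φ.oddTangent).EqOver (SuperMap.id 𝕜 (m + n) (n + m))
        (tangentDomain n U) := fun h =>
    have h1 := h.1.oddTangent_comp h.2
    have h2 := EqOver.oddTangent h.1.isOpen_source h.3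
    ⟨fun i z hz => (h1.1 i hz).trans ((h2.1 i hz).trans (oddTangent_id.1 i trivial)),
      fun i z hz => (h1.2 i hz).trans ((h2.2 i hz).trans (oddTangent_id.2 i trivial))⟩
  exact ⟨h.1.oddTangent, h.2.oddTangent, key h, key h.symm⟩

end SuperMap

end OddTangentBundle

/-! ### The commutative ring of even elements. -/

section EvenPart

variable {𝕜 : Type*} [RCLike 𝕜] {q : ℕ}

/-- The commutative ring of even elements of the Grassmann algebra. -/
def EvenPart (𝕜 : Type*) [RCLike 𝕜] (q : ℕ) : Type _ :=
  ↥(AlgHom.equalizer (gradeInv (𝕜 := 𝕜) (q := q)) (AlgHom.id 𝕜 (Grassmann 𝕜 q))).toSubring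

instance : CommRing (EvenPart 𝕜 q) :=
  { (inferInstance : Ring ↥(AlgHom.equalizer (gradeInv (𝕜 := 𝕜) (q := q))
      (AlgHom.id 𝕜 (Grassmann 𝕜 q))).toSubring) with
    mul_comm := fun a b => Subtype.ext (mul_comm_of_even a.2 b.1) }

namespace EvenPart

/-- The inclusion of the even elements. -/
def val : EvenPart 𝕜 q →+* Grassmann 𝕜 q :=
  (AlgHom.equalizer (gradeInv (𝕜 := 𝕜) (q := q)) (AlgHom.id 𝕜 (Grassmann 𝕜 q))).toSubring.subtype

theorem gradeInv_val (a : EvenPart 𝕜 q) : gradeInv (val a) = val a := a.2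

theorem val_injective : Function.Injective (val : EvenPart 𝕜 q → Grassmann 𝕜 q) :=
  Subtype.val_injective

/-- The even part of an element. -/
def proj (w : Grassmann 𝕜 q) : EvenPart 𝕜 q :=
  ⟨(2 : 𝕜)⁻¹ • (w + gradeInv w), by
    change gradeInv ((2 : 𝕜)⁻¹ • (w + gradeInv w)) = (2 : 𝕜)⁻¹ • (w + gradeInv w)
    rw [map_smul, map_add, gradeInv_gradeInv, add_comm]⟩

theorem val_proj {w : Grassmann 𝕜 q} (h : gradeInv w = w) : val (proj w) = w := by
  change (2 : 𝕜)⁻¹ • (w + gradeInv w) = w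
  rw [h, ← two_smul 𝕜 w, inv_smul_smul₀ two_ne_zero]

/-- The element is its body, a nonzero scalar, plus its soul, which is nilpotent. -/
theorem isUnit_of_body_ne_zero {a : EvenPart 𝕜 q} (h : body (val a) ≠ 0) : IsUnit a := by
  let c : EvenPart 𝕜 q := proj (algebraMap 𝕜 _ (body (val a)))
  let c' : EvenPart 𝕜 q := proj (algebraMap 𝕜 _ (body (val a))⁻¹)
  have hv : ∀ r : 𝕜, val (proj (algebraMap 𝕜 (Grassmann 𝕜 q) r)) = algebraMap 𝕜 _ r :=
    fun r => val_proj (AlgHom.commutes _ _)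
  have hc : IsUnit c := IsUnit.of_mul_eq_one c' (val_injective (by
    rw [map_mul, map_one, hv, hv, ← map_mul, mul_inv_cancel₀ h, map_one]))
  have hs : IsNilpotent (a - c) := ⟨q + 1, val_injective (by
    rw [map_pow, map_sub, map_zero, hv]
    refine eq_zero_of_mem_orderGE (Nat.lt_succ_self q) ?_
    have := prod_mem_orderGE (l := List.replicate (q + 1) (soul (val a))) (by
      intro w hw
      rw [List.eq_of_mem_replicate hw]
      exact body_soul _)
    rwa [List.prod_replicate, List.length_replicate] at this)⟩
  have := hs.isUnit_add_left_of_commute hc (Commute.all _ _)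
  rwa [add_sub_cancel] at this

end EvenPart

end EvenPart

/-! ### Determinants over the even part and the Berezinian. -/

section SuperMatrix

open EvenPart Matrix

set_option linter.unusedSectionVars false

variable {𝕜 : Type*} [RCLike 𝕜] {q : ℕ} {ι κ l : Type*} [Fintype ι] [DecidableEq ι] [Fintype κ]
  [DecidableEq κ] [Fintype l] [DecidableEq l]

/-- All entries are even. -/
def EvenMat (M : Matrix ι κ (Grassmann 𝕜 q)) : Prop := ∀ i j, gradeInv (M i j) = M i j

/-- All entries are odd. -/
def OddMat (M : Matrix ι κ (Grassmann 𝕜 q)) : Prop := ∀ i j, gradeInv (M i j) = -M i j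

theorem EvenMat.mul {M : Matrix ι κ (Grassmann 𝕜 q)} {N : Matrix κ l (Grassmann 𝕜 q)}
    (hM : EvenMat M) (hN : EvenMat N) : EvenMat (M * N) := fun i j => by
  simp only [Matrix.mul_apply, map_sum, map_mul, hM i _, hN _ j]

theorem EvenMat.mul_odd {M : Matrix ι κ (Grassmann 𝕜 q)} {N : Matrix κ l (Grassmann 𝕜 q)}
    (hM : EvenMat M) (hN : OddMat N) : OddMat (M * N) := fun i j => by
  simp only [Matrix.mul_apply, map_sum, map_mul, hM i _, hN _ j, mul_neg, Finset.sum_neg_distrib]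

theorem OddMat.mul {M : Matrix ι κ (Grassmann 𝕜 q)} {N : Matrix κ l (Grassmann 𝕜 q)}
    (hM : OddMat M) (hN : OddMat N) : EvenMat (M * N) := fun i j => by
  simp only [Matrix.mul_apply, map_sum, map_mul, hM i _, hN _ j, mul_neg, neg_mul, neg_neg]

theorem EvenMat.add {M N : Matrix ι κ (Grassmann 𝕜 q)} (hM : EvenMat M) (hN : EvenMat N) :
    EvenMat (M + N) := fun i j => by simp only [Matrix.add_apply, map_add, hM i j, hN i j]

theorem EvenMat.sub {M N : Matrix ι κ (Grassmann 𝕜 q)} (hM : EvenMat M) (hN : EvenMat N) :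
    EvenMat (M - N) := fun i j => by simp only [Matrix.sub_apply, map_sub, hM i j, hN i j]

theorem OddMat.neg {M : Matrix ι κ (Grassmann 𝕜 q)} (hM : OddMat M) : OddMat (-M) :=
  fun i j => by simp only [Matrix.neg_apply, map_neg, hM i j]

theorem evenMat_one : EvenMat (1 : Matrix ι ι (Grassmann 𝕜 q)) := fun i j => by
  rw [Matrix.one_apply]
  split_ifs <;> simp

theorem EvenMat.map_val_map_proj {M : Matrix ι κ (Grassmann 𝕜 q)} (hM : EvenMat M) :
    (M.map proj).map val = M := by
  ext i j
  exact val_proj (hM i j)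

theorem map_val_injective :
    Function.Injective fun M : Matrix ι κ (EvenPart 𝕜 q) => M.map val :=
  Matrix.map_injective val_injective

theorem map_val_mul (M : Matrix ι κ (EvenPart 𝕜 q)) (N : Matrix κ l (EvenPart 𝕜 q)) :
    (M * N).map val = M.map val * N.map val := Matrix.map_mul

theorem EvenMat.map_proj_mul {M : Matrix ι κ (Grassmann 𝕜 q)} {N : Matrix κ l (Grassmann 𝕜 q)}
    (hM : EvenMat M) (hN : EvenMat N) : (M * N).map proj = M.map proj * N.map proj :=
  map_val_injective (by
    simp only [map_val_mul, hM.map_val_map_proj, hN.map_val_map_proj,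
      (hM.mul hN).map_val_map_proj])

theorem map_proj_one : (1 : Matrix ι ι (Grassmann 𝕜 q)).map proj = 1 :=
  map_val_injective (by
    simp only [evenMat_one.map_val_map_proj, Matrix.map_one val (map_zero val) (map_one val)])

/-- The determinant of a matrix with even entries. -/
def evenDet (M : Matrix ι ι (Grassmann 𝕜 q)) : EvenPart 𝕜 q := (M.map proj).det

theorem EvenMat.evenDet_mul {M N : Matrix ι ι (Grassmann 𝕜 q)} (hM : EvenMat M) (hN : EvenMat N) :
    evenDet (M * N) = evenDet M * evenDet N := by
  rw [evenDet, hM.map_proj_mul hN, Matrix.det_mul, evenDet, evenDet]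

theorem evenDet_one : evenDet (1 : Matrix ι ι (Grassmann 𝕜 q)) = 1 := by
  rw [evenDet, map_proj_one, Matrix.det_one]

theorem evenDet_submatrix (e : ι ≃ κ) (M : Matrix κ κ (Grassmann 𝕜 q)) :
    evenDet (M.submatrix e e) = evenDet M := by
  rw [evenDet, ← Matrix.submatrix_map, Matrix.det_submatrix_equiv_self, evenDet]

/-- This links the Leibniz determinant over the noncommutative Grassmann algebra with the
determinant over the commutative even part, where multiplicativity and block formulas are available.
-/
theorem val_evenDet {p : ℕ} {M : Matrix (Fin p) (Fin p) (Grassmann 𝕜 q)} (hM : EvenMat M) :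
    leibnizDet M = val (evenDet M) := by
  rw [evenDet, Matrix.det_apply, leibnizDet, map_sum]
  refine Finset.sum_congr rfl fun σ _ => ?_
  rw [Units.smul_def, map_zsmul]
  congr 1
  rw [← List.prod_ofFn, map_list_prod, List.map_ofFn]
  congr 2
  funext i
  exact (val_proj (hM _ _)).symm

theorem body_val_evenDet {M : Matrix ι ι (Grassmann 𝕜 q)} (hM : EvenMat M) :
    body (val (evenDet M)) = (M.map body).det := by
  have h := RingHom.map_det ((bodyₐ (𝕜 := 𝕜) (q := q)).toRingHom.comp val) (M.map proj)
  refine h.trans ?_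
  congr 1
  ext i j
  change body (val (proj (M i j))) = body (M i j)
  rw [val_proj (hM i j)]

theorem EvenMat.exists_inverse {M : Matrix ι ι (Grassmann 𝕜 q)} (hM : EvenMat M)
    (h : IsUnit (evenDet M)) : ∃ N, EvenMat N ∧ M * N = 1 ∧ N * M = 1 := by
  have h1 : (1 : Matrix ι ι (EvenPart 𝕜 q)).map val = 1 :=
    Matrix.map_one val (map_zero val) (map_one val)
  refine ⟨(M.map proj)⁻¹.map val, fun i j => gradeInv_val ((M.map proj)⁻¹ i j), ?_, ?_⟩
  · have h2 := map_val_mul (M.map proj) (M.map proj)⁻¹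
    rwa [Matrix.mul_nonsing_inv _ h, hM.map_val_map_proj, h1, eq_comm] at h2
  · have h2 := map_val_mul (M.map proj)⁻¹ (M.map proj)
    rwa [Matrix.nonsing_inv_mul _ h, hM.map_val_map_proj, h1, eq_comm] at h2

theorem evenDet_fromBlocks_zero {a : Matrix ι ι (Grassmann 𝕜 q)} (b : Matrix ι κ (Grassmann 𝕜 q))
    (d : Matrix κ κ (Grassmann 𝕜 q)) :
    evenDet (fromBlocks a b 0 d) = evenDet a * evenDet d := by
  have h0 : (0 : Matrix κ ι (Grassmann 𝕜 q)).map proj = 0 := by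
    ext i j
    exact val_injective (val_proj (map_zero _))
  rw [evenDet, fromBlocks_map, h0, det_fromBlocks_zero₂₁, evenDet, evenDet]

/-- Elimination of the lower left block: the matrix is a lower unitriangular one times a block upper
triangular one with the Schur complement in the corner. -/
theorem EvenMat.evenDet_fromBlocks {a : Matrix ι ι (Grassmann 𝕜 q)}
    {b : Matrix ι κ (Grassmann 𝕜 q)} {c : Matrix κ ι (Grassmann 𝕜 q)}
    {d : Matrix κ κ (Grassmann 𝕜 q)} (ha : EvenMat a) (hb : EvenMat b) (hc : EvenMat c)
    (hd : EvenMat d) {a' : Matrix ι ι (Grassmann 𝕜 q)} (ha' : EvenMat a')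
    (h' : a' * a = 1) :
    evenDet (fromBlocks a b c d) = evenDet a * evenDet (d - c * a' * b) := by
  have e1 : fromBlocks a b c d = fromBlocks 1 0 (c * a') 1 * fromBlocks a b 0 (d - c * a' * b) := by
    rw [fromBlocks_multiply]
    simp [Matrix.mul_assoc, h']
  have hL : EvenMat (fromBlocks (1 : Matrix ι ι (Grassmann 𝕜 q)) 0 (c * a')
      (1 : Matrix κ κ (Grassmann 𝕜 q))) := by
    rintro (i | i) (j | j)
    · exact evenMat_one i j
    · exact map_zero _
    · exact hc.mul ha' i j
    · exact evenMat_one i j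
  have hR : EvenMat (fromBlocks a b 0 (d - c * a' * b)) := by
    rintro (i | i) (j | j)
    · exact ha i j
    · exact hb i j
    · exact map_zero _
    · exact hd.sub ((hc.mul ha').mul hb) i j
  have h0 : (0 : Matrix ι κ (Grassmann 𝕜 q)).map proj = 0 := by
    ext i j
    exact val_injective (val_proj (map_zero _))
  rw [e1, hL.evenDet_mul hR, evenDet_fromBlocks_zero, evenDet, fromBlocks_map, h0,
    det_fromBlocks_zero₁₂, map_proj_one, map_proj_one, det_one, det_one, one_mul, one_mul]

/-- `det (1 + b c)` and `det (1 + c b)` are inverse to each other for odd `b` and `c`. -/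
def OddSwap (𝕜 : Type*) [RCLike 𝕜] (q : ℕ) (ι κ : Type*) [Fintype ι] [DecidableEq ι] [Fintype κ]
    [DecidableEq κ] : Prop :=
  ∀ (b : Matrix ι κ (Grassmann 𝕜 q)) (c : Matrix κ ι (Grassmann 𝕜 q)), OddMat b → OddMat c →
    evenDet (1 + b * c) * evenDet (1 + c * b) = 1

theorem OddSwap.symm (h : OddSwap 𝕜 q ι κ) : OddSwap 𝕜 q κ ι := fun b c hb hc => by
  rw [mul_comm]; exact h c b hc hb

theorem OddSwap.reindex (h : OddSwap 𝕜 q ι κ) (e : κ ≃ l) : OddSwap 𝕜 q ι l :=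
  fun b c hb hc => by
    have := h (b.submatrix id e) (c.submatrix e id) (fun i j => hb _ _) (fun i j => hc _ _)
    have h2 : 1 + c.submatrix e id * b.submatrix id e = (1 + c * b).submatrix e e := by
      rw [Matrix.submatrix_mul c b e id e Function.bijective_id |>.symm]
      ext i j
      simp [Matrix.one_apply]
    rwa [Matrix.submatrix_mul_equiv, Matrix.submatrix_id_id, h2, evenDet_submatrix] at this

/-- Write b = (B β), c = (C; γ), M = 1 + BC and N = 1 + CB. Then 1 + bc = M (1 + M⁻¹βγ), while the
Schur complement of N in 1 + cb is 1 + γ(1 - B N⁻¹ C)β = 1 + γM⁻¹β. The case of B and C disposes of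
M and N, that of M⁻¹β and γ of the rest. -/
theorem OddSwap.sum (h : OddSwap 𝕜 q ι κ) (h1 : OddSwap 𝕜 q ι l) : OddSwap 𝕜 q ι (κ ⊕ l) := by
  intro b c hb hc
  obtain ⟨B, β, rfl⟩ : ∃ B β, b = fromCols B β := ⟨b.toCols₁, b.toCols₂, (fromCols_toCols b).symm⟩
  obtain ⟨C, γ, rfl⟩ : ∃ C γ, c = fromRows C γ := ⟨c.toRows₁, c.toRows₂, (fromRows_toRows c).symm⟩
  have hB : OddMat B := fun i j => hb i (Sum.inl j)
  have hβ : OddMat β := fun i j => hb i (Sum.inr j)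
  have hC : OddMat C := fun i j => hc (Sum.inl i) j
  have hγ : OddMat γ := fun i j => hc (Sum.inr i) j
  have h2 := h B C hB hC
  have hM : EvenMat (1 + B * C) := evenMat_one.add (hB.mul hC)
  have hN : EvenMat (1 + C * B) := evenMat_one.add (hC.mul hB)
  obtain ⟨N', hN', hNN', hN'N⟩ := hN.exists_inverse (IsUnit.of_mul_eq_one _ ((mul_comm _ _).trans h2))
  obtain ⟨M', hM', hMM', hM'M⟩ := hM.exists_inverse (IsUnit.of_mul_eq_one _ h2)
  -- The Woodbury identity for the inverse of 1 + BC.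
  have hinv : M' = 1 - B * N' * C := by
    have e : (1 + B * C) * (1 - B * N' * C) = 1 := by
      have : (1 + B * C) * (1 - B * N' * C) = 1 + B * C - B * ((1 + C * B) * N') * C := by
        simp only [Matrix.add_mul, Matrix.mul_sub, Matrix.mul_add, Matrix.one_mul, Matrix.mul_one,
          Matrix.mul_assoc]
      rw [this, hNN', Matrix.mul_one, add_sub_cancel_right]
    calc M' = M' * ((1 + B * C) * (1 - B * N' * C)) := by rw [e, Matrix.mul_one]
      _ = 1 - B * N' * C := by rw [← Matrix.mul_assoc, hM'M, Matrix.one_mul]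
  have e1 : evenDet (1 + fromCols B β * fromRows C γ) =
      evenDet (1 + B * C) * evenDet (1 + M' * β * γ) := by
    rw [← hM.evenDet_mul (evenMat_one.add ((hM'.mul_odd hβ).mul hγ)), fromCols_mul_fromRows,
      Matrix.mul_add, Matrix.mul_one, ← Matrix.mul_assoc, ← Matrix.mul_assoc, hMM', Matrix.one_mul,
      add_assoc]
  have e2 : evenDet (1 + fromRows C γ * fromCols B β) =
      evenDet (1 + C * B) * evenDet (1 + γ * (M' * β)) := by
    rw [fromRows_mul_fromCols, ← fromBlocks_one, fromBlocks_add, zero_add, zero_add,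
      hN.evenDet_fromBlocks (hC.mul hβ) (hγ.mul hB) (evenMat_one.add (hγ.mul hβ)) hN' hN'N,
      hinv]
    congr 2
    simp only [Matrix.sub_mul, Matrix.mul_sub, Matrix.one_mul, Matrix.mul_assoc]
    abel
  rw [e1, e2, mul_mul_mul_comm, h2, one_mul]
  exact h1 _ γ (hM'.mul_odd hβ) hγ

/-- With t = bc one has cb = -t and t² = 0, so the product is (1 + t)(1 - t) = 1. -/
theorem oddSwap_one_one : OddSwap 𝕜 q (Fin 1) (Fin 1) := by
  intro b c hb hc
  apply val_injective
  have h1 : EvenMat (1 + b * c) := evenMat_one.add (hb.mul hc)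
  have h2 : EvenMat (1 + c * b) := evenMat_one.add (hc.mul hb)
  rw [map_mul, map_one, evenDet, evenDet, det_fin_one, det_fin_one, map_apply, map_apply,
    val_proj (h1 0 0), val_proj (h2 0 0)]
  simp only [Matrix.add_apply, Matrix.one_apply_eq, Matrix.mul_apply, Fin.sum_univ_one]
  have h3 : c 0 0 * b 0 0 = -(b 0 0 * c 0 0) := by
    rw [mul_comm_of_odd (hc 0 0), hb 0 0, neg_mul]
  have h4 : b 0 0 * c 0 0 * (b 0 0 * c 0 0) = 0 := by
    rw [mul_assoc, ← mul_assoc (c 0 0), h3, neg_mul, mul_assoc, SuperMap.mul_self_of_odd (hc 0 0)]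
    simp
  rw [h3]
  generalize b 0 0 * c 0 0 = t at h4 ⊢
  have : (1 + t) * (1 + -t) = 1 - t * t := by noncomm_ring
  rw [this, h4, sub_zero]

theorem oddSwap_fin (h : OddSwap 𝕜 q ι (Fin 1)) (k : ℕ) : OddSwap 𝕜 q ι (Fin k) := by
  induction k with
  | zero =>
    intro b c hb hc
    rw [show b * c = 0 by ext i j; simp [Matrix.mul_apply], add_zero, evenDet_one, one_mul, evenDet,
      det_isEmpty]
  | succ k ih => exact (ih.sum h).reindex finSumFinEquiv

theorem oddSwap (m n : ℕ) : OddSwap 𝕜 q (Fin m) (Fin n) :=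
  oddSwap_fin (oddSwap_fin oddSwap_one_one m).symm n

theorem ring_inverse_eq {R : Type*} [Ring R] {x y : R} (h : x * y = 1) (h' : y * x = 1) :
    Ring.inverse x = y := Ring.inverse_unit ⟨x, y, h, h'⟩

/-- The Berezinian of a matrix with the block structure of the differential of the transformation
of the odd tangent bundle. -/
theorem berezinian_eq_one {m n : ℕ}
    {S : Matrix (Fin (m + n) ⊕ Fin (n + m)) (Fin (m + n) ⊕ Fin (n + m)) (Grassmann 𝕜 q)}
    {a : Matrix (Fin m) (Fin m) (Grassmann 𝕜 q)} {d : Matrix (Fin n) (Fin n) (Grassmann 𝕜 q)}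
    {b : Matrix (Fin m) (Fin n) (Grassmann 𝕜 q)} {c : Matrix (Fin n) (Fin m) (Grassmann 𝕜 q)}
    {x : Matrix (Fin m) (Fin n) (Grassmann 𝕜 q)} {y : Matrix (Fin m) (Fin m) (Grassmann 𝕜 q)}
    {u : Matrix (Fin n) (Fin n) (Grassmann 𝕜 q)} {v : Matrix (Fin n) (Fin m) (Grassmann 𝕜 q)}
    (ha : EvenMat a) (hd : EvenMat d) (hx : EvenMat x) (hv : EvenMat v)
    (hb : OddMat b) (hc : OddMat c) (hy : OddMat y) (hu : OddMat u)
    (hua : IsUnit (evenDet a)) (hud : IsUnit (evenDet d))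
    (hA : S.toBlocks₁₁.submatrix finSumFinEquiv finSumFinEquiv = fromBlocks a x 0 d)
    (hB : S.toBlocks₁₂.submatrix finSumFinEquiv finSumFinEquiv = fromBlocks b y 0 c)
    (hC : S.toBlocks₂₁.submatrix finSumFinEquiv finSumFinEquiv = fromBlocks c u 0 b)
    (hD : S.toBlocks₂₂.submatrix finSumFinEquiv finSumFinEquiv = fromBlocks d v 0 a) :
    berezinian S = 1 := by
  obtain ⟨a', ha', haa', ha'a⟩ := ha.exists_inverse hua
  obtain ⟨d', hd', hdd', hd'd⟩ := hd.exists_inverse hud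
  set e₁ : Fin m ⊕ Fin n ≃ Fin (m + n) := finSumFinEquiv
  set e₂ : Fin n ⊕ Fin m ≃ Fin (n + m) := finSumFinEquiv
  have hD' : S.toBlocks₂₂ = (fromBlocks d v 0 a).submatrix e₂.symm e₂.symm := by
    rw [← hD]; simp
  -- The inverse of a block upper triangular matrix; the corner entry is forced.
  have hinv : Ring.inverse S.toBlocks₂₂ =
      (fromBlocks d' (-(d' * v * a')) 0 a').submatrix e₂.symm e₂.symm := by
    rw [hD']
    refine ring_inverse_eq ?_ ?_
    · rw [Matrix.submatrix_mul_equiv, fromBlocks_multiply]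
      simp only [Matrix.mul_zero, Matrix.zero_mul, add_zero, zero_add, hdd', haa', Matrix.mul_neg,
        ← Matrix.mul_assoc, Matrix.one_mul, neg_add_cancel, neg_zero, zero_add, fromBlocks_one,
        Matrix.submatrix_one_equiv]
    · rw [Matrix.submatrix_mul_equiv, fromBlocks_multiply]
      simp only [Matrix.mul_zero, Matrix.zero_mul, add_zero, zero_add, hd'd, ha'a, Matrix.neg_mul,
        Matrix.mul_assoc, Matrix.mul_one, add_neg_cancel, fromBlocks_one,
        Matrix.submatrix_one_equiv]
  -- All four blocks of `S` are block upper triangular, hence so is the Schur complement. The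
  -- corner, which contains `x`, `y`, `u` and `v`, does not enter its determinant.
  have hQ : (S.toBlocks₁₁ - S.toBlocks₁₂ * Ring.inverse S.toBlocks₂₂ * S.toBlocks₂₁).submatrix e₁ e₁ =
      fromBlocks (a - b * d' * c)
        (x - (b * d' * u + (b * (-(d' * v * a')) + y * a') * b)) 0 (d - c * a' * b) := by
    have hsub : ∀ A B : Matrix (Fin (m + n)) (Fin (m + n)) (Grassmann 𝕜 q),
        (A - B).submatrix e₁ e₁ = A.submatrix e₁ e₁ - B.submatrix e₁ e₁ := fun _ _ => rfl
    rw [hsub, hinv, ← Matrix.submatrix_mul_equiv _ _ e₁ e₂ e₁,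
      ← Matrix.submatrix_mul_equiv _ _ e₁ e₂ e₂, hC]
    simp only [hA, hB, Matrix.submatrix_submatrix, Equiv.symm_comp_self,
      Matrix.submatrix_id_id, fromBlocks_multiply]
    simp only [Matrix.mul_zero, Matrix.zero_mul, add_zero, zero_add]
    rw [sub_eq_add_neg, fromBlocks_neg, fromBlocks_add]
    simp only [← sub_eq_add_neg, sub_zero]
  have hevQ : EvenMat (fromBlocks (a - b * d' * c)
        (x - (b * d' * u + (b * (-(d' * v * a')) + y * a') * b)) 0 (d - c * a' * b)) := by
    have hodd : ∀ {k l : ℕ} {M : Matrix (Fin k) (Fin l) (Grassmann 𝕜 q)}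
        {r : ℕ} {N : Matrix (Fin l) (Fin r) (Grassmann 𝕜 q)}, OddMat M → EvenMat N →
          OddMat (M * N) := fun hM hN i j => by
      simp only [Matrix.mul_apply, map_sum, map_mul, hM i _, hN _ j, neg_mul,
        Finset.sum_neg_distrib]
    have hneg : EvenMat (-(d' * v * a')) := fun i j => by
      rw [Matrix.neg_apply, map_neg, (hd'.mul hv).mul ha' i j]
    have h3 : OddMat (b * (-(d' * v * a')) + y * a') := fun i j => by
      rw [Matrix.add_apply, map_add, hodd hb hneg i j, hodd hy ha' i j, neg_add]
    rintro (i | i) (j | j)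
    · exact ha.sub ((hodd hb hd').mul hc) i j
    · exact hx.sub (((hodd hb hd').mul hu).add (h3.mul hb)) i j
    · exact map_zero _
    · exact hd.sub ((hodd hc ha').mul hb) i j
  have hevD : EvenMat (fromBlocks d v 0 a) := by
    rintro (i | i) (j | j)
    · exact hd i j
    · exact hv i j
    · exact map_zero _
    · exact ha i j
  have hback : ∀ {k : ℕ} {ι : Type} (e : ι ≃ Fin k) {M : Matrix (Fin k) (Fin k) (Grassmann 𝕜 q)}
      {N : Matrix ι ι (Grassmann 𝕜 q)}, M.submatrix e e = N → EvenMat N → EvenMat M :=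
    fun e M N h hN i j => by
      have := hN (e.symm i) (e.symm j)
      rw [← h] at this
      simpa using this
  rw [berezinian, val_evenDet (hback e₁ hQ hevQ), val_evenDet (hback e₂ hD hevD),
    ← evenDet_submatrix e₁, hQ, ← evenDet_submatrix e₂ S.toBlocks₂₂, hD, evenDet_fromBlocks_zero,
    evenDet_fromBlocks_zero]
  -- After extraction of the factors `a` and `d`, the two diagonal blocks are 1 + βγ and 1 + γβ for
  -- the odd matrices β = a⁻¹b and γ = -d⁻¹c, so `oddSwap` applies.
  have f1 : a - b * d' * c = a * (1 + a' * b * (-(d' * c))) := by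
    rw [Matrix.mul_add, Matrix.mul_one, ← Matrix.mul_assoc, ← Matrix.mul_assoc, haa',
      Matrix.one_mul, Matrix.mul_neg, ← Matrix.mul_assoc, sub_eq_add_neg]
  have f2 : d - c * a' * b = d * (1 + -(d' * c) * (a' * b)) := by
    rw [Matrix.mul_add, Matrix.mul_one, ← Matrix.mul_assoc, Matrix.mul_neg, ← Matrix.mul_assoc d,
      hdd', Matrix.one_mul, Matrix.neg_mul, ← Matrix.mul_assoc, sub_eq_add_neg]
  have o1 : OddMat (a' * b) := ha'.mul_odd hb
  have o2 : OddMat (-(d' * c)) := (hd'.mul_odd hc).neg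
  have key : evenDet (a - b * d' * c) * evenDet (d - c * a' * b) = evenDet d * evenDet a := by
    rw [f1, f2, ha.evenDet_mul (evenMat_one.add (o1.mul o2)),
      hd.evenDet_mul (evenMat_one.add (o2.mul o1)), mul_mul_mul_comm, oddSwap m n _ _ o1 o2, mul_one,
      mul_comm]
  rw [key]
  exact Ring.mul_inverse_cancel _ ((hud.mul hua).map val)

end SuperMatrix

/-! ### The Jacobian of a coordinate change and of its odd tangent. -/

section JacobianOfOddTangent

open EvenPart Matrix

variable {𝕜 : Type*} [RCLike 𝕜] {m n p q : ℕ}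

namespace SuperMap

variable {φ χ : SuperMap 𝕜 p q p q} {U V : Set (Fin p → ℝ)} {x : Fin p → ℝ}

theorem IsMorphism.evenMat_evenDeriv_even (hφ : φ.IsMorphism U V) (hx : x ∈ U) :
    EvenMat (Matrix.of fun i j => evenDeriv i (φ.even j) x) := fun i j => by
  rw [of_apply, gradeInv_evenDeriv hφ.isOpen_source (hφ.smooth_even j) hx,
    evenDeriv_congr hφ.isOpen_source (fun y hy => hφ.gradeInv_even hy j) i hx]

theorem IsMorphism.oddMat_evenDeriv_odd (hφ : φ.IsMorphism U V) (hx : x ∈ U) :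
    OddMat (Matrix.of fun i j => evenDeriv i (φ.odd j) x) := fun i j => by
  rw [of_apply, gradeInv_evenDeriv hφ.isOpen_source (hφ.smooth_odd j) hx,
    evenDeriv_congr hφ.isOpen_source (g := fun x => (-1 : 𝕜) • φ.odd j x)
      (fun y hy => (hφ.gradeInv_odd hy j).trans (neg_one_smul 𝕜 _).symm) i hx,
    evenDeriv_const_smul hφ.isOpen_source (hφ.smooth_odd j) hx, neg_one_smul]

theorem IsMorphism.oddMat_oddDeriv_even (hφ : φ.IsMorphism U V) (hx : x ∈ U) :
    OddMat (Matrix.of fun i j => oddDeriv i (φ.even j) x) := fun i j => by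
  have := leftDer_gradeInv i (φ.even j x)
  rw [hφ.gradeInv_even hx] at this
  exact (neg_eq_iff_eq_neg.2 this).symm

theorem IsMorphism.evenMat_oddDeriv_odd (hφ : φ.IsMorphism U V) (hx : x ∈ U) :
    EvenMat (Matrix.of fun i j => oddDeriv i (φ.odd j) x) := fun i j => by
  have := leftDer_gradeInv i (φ.odd j x)
  rw [hφ.gradeInv_odd hx, map_neg, neg_inj] at this
  exact this.symm

/-- The chain rule for the inverse map, read at vanishing odd variables: the terms through odd
components have odd factors without body, so the diagonal blocks are invertible separately. -/
theorem IsInverse.body_evenDeriv_mul (h : φ.IsInverse χ U V) (hx : x ∈ U) :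
    (Matrix.of fun i j => body (evenDeriv i (φ.even j) x)) *
      (Matrix.of fun i j => body (evenDeriv i (χ.even j) (φ.bodyMap x))) = 1 := by
  ext i k
  have hU := h.1.isOpen_source
  have h1 := evenDeriv_congr hU (h.3.1 k) i hx
  have h2 := h.1.evenDeriv_pullback hx (h.2.smooth_even k) i
  have h3 : evenDeriv i ((SuperMap.id 𝕜 p q).even k) x = if k = i then 1 else 0 :=
    evenDeriv_coord k i x
  have h4 : body (evenDeriv i (φ.pullback (χ.even k)) x) = if k = i then 1 else 0 := by
    refine (congrArg body (h1.trans h3)).trans ?_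
    split_ifs <;> simp
  rw [h2] at h4
  simp only [body_add, body_sum, body_mul] at h4
  rw [Finset.sum_eq_zero (s := Finset.univ) (f := fun b => body (evenDeriv i (φ.odd b) x) * _)
    fun b _ => by
      have := body_eq_zero_of_odd (h.1.oddMat_evenDeriv_odd hx i b)
      rw [of_apply] at this
      rw [this, zero_mul],
    add_zero] at h4
  rw [Matrix.mul_apply, Matrix.one_apply]
  simp only [of_apply, eq_comm (a := i)]
  rw [← h4]
  refine Finset.sum_congr rfl fun j _ => ?_
  rw [h.1.body_pullback hx ((h.2.smooth_even k).evenDeriv h.2.isOpen_source j)]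

theorem IsInverse.body_oddDeriv_mul (h : φ.IsInverse χ U V) (hx : x ∈ U) :
    (Matrix.of fun i j => body (oddDeriv i (φ.odd j) x)) *
      (Matrix.of fun i j => body (oddDeriv i (χ.odd j) (φ.bodyMap x))) = 1 := by
  ext i k
  have h1 : oddDeriv i (φ.pullback (χ.odd k)) x = leftDer i (oddGen k) :=
    congrArg (leftDer i) (h.3.2 k hx)
  have h2 := h.1.oddDeriv_pullback hx (h.2.smooth_odd k) i
  have h4 := congrArg body (h2.symm.trans (h1.trans (leftDer_oddGen i k)))
  simp only [body_add, body_sum, body_mul] at h4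
  rw [Finset.sum_eq_zero (s := Finset.univ) (f := fun b => body (oddDeriv i (φ.even b) x) * _)
    fun b _ => by
      have := body_eq_zero_of_odd (h.1.oddMat_oddDeriv_even hx i b)
      rw [of_apply] at this
      rw [this, zero_mul],
    zero_add] at h4
  rw [Matrix.mul_apply, Matrix.one_apply]
  simp only [of_apply]
  refine Eq.trans (Finset.sum_congr rfl fun j _ => ?_) (h4.trans ?_)
  · rw [h.1.body_pullback hx ((h.2.smooth_odd k).oddDeriv j)]
  · split_ifs <;> simp_all

theorem IsMorphism.ofReal_orientationDet (hφ : φ.IsMorphism U V) (hx : x ∈ U) :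
    (φ.orientationDet x : 𝕜) = (Matrix.of fun i j => body (evenDeriv i (φ.even j) x)).det *
      (Matrix.of fun i j => body (oddDeriv i (φ.odd j) x)).det := by
  rw [orientationDet, RCLike.ofReal_mul]
  have hdet : ∀ {k : ℕ} (M : Matrix (Fin k) (Fin k) ℝ),
      ((M.det : ℝ) : 𝕜) = (M.map fun r => (r : 𝕜)).det := fun M =>
    RingHom.map_det (algebraMap ℝ 𝕜) M
  rw [hdet, hdet]
  congr 2
  · ext i j
    exact (isRealElt_evenDeriv hφ.isOpen_source (hφ.smooth_even j) (hφ.real_even j) hx i).body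
  · ext i j
    exact ((hφ.real_odd j x hx).leftDer i).body

theorem IsInverse.orientationDet_ne_zero (h : φ.IsInverse χ U V) (hx : x ∈ U) :
    φ.orientationDet x ≠ 0 := fun h0 => by
  have h1 := h.1.ofReal_orientationDet hx
  rw [h0, RCLike.ofReal_zero, eq_comm, mul_eq_zero] at h1
  exact h1.elim (Matrix.det_ne_zero_of_right_inverse (h.body_evenDeriv_mul hx))
    (Matrix.det_ne_zero_of_right_inverse (h.body_oddDeriv_mul hx))

end SuperMap

/-- The induced transformation of the odd tangent bundle has Berezinian one. -/
theorem SuperMap.IsInverse.berezinian_oddTangent {φ χ : SuperMap 𝕜 m n m n}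
    {U V : Set (Fin m → ℝ)} (h : φ.IsInverse χ U V) {z : Fin (m + n) → ℝ}
    (hz : z ∈ tangentDomain n U) : berezinian (φ.oddTangent.jacobian z) = 1 := by
  have hU := h.1.isOpen_source
  have hsub := h.1.smooth_even
  have hsubo := h.1.smooth_odd
  have hx : basePt z ∈ U := hz
  have hT := h.oddTangent (n := n)
  let L : Grassmann 𝕜 n →ₐ[𝕜] Grassmann 𝕜 (n + m) := liftₐ 𝕜 m n
  have hev : ∀ {k l : ℕ} {M : Matrix (Fin k) (Fin l) (Grassmann 𝕜 n)}, EvenMat M →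
      EvenMat (M.map L) := fun hM i j => by
    rw [map_apply, gradeInv_liftₐ, hM i j]
  have hod : ∀ {k l : ℕ} {M : Matrix (Fin k) (Fin l) (Grassmann 𝕜 n)}, OddMat M →
      OddMat (M.map L) := fun hM i j => by
    rw [map_apply, gradeInv_liftₐ, hM i j, map_neg]
  have hun : ∀ {k : ℕ} {M : Matrix (Fin k) (Fin k) (Grassmann 𝕜 n)}, EvenMat M →
      (M.map body).det ≠ 0 → IsUnit (evenDet (M.map L)) := fun hM hd => by
    refine isUnit_of_body_ne_zero ?_
    rw [body_val_evenDet (hev hM)]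
    convert hd using 2
    ext i j
    exact body_liftₐ _
  -- The blocks of the Jacobian of `φ` occur twice, since ∂Y/∂y = ∂Ξ/∂ξ, ∂Ψ/∂ψ = ∂X/∂x, ∂Y/∂ψ =
  -- ∂Ξ/∂x and ∂Ψ/∂y = ∂X/∂ξ. The derivatives of fibre components along the base fill the corners.
  refine berezinian_eq_one
    (a := (Matrix.of fun i j => evenDeriv i (φ.even j) (basePt z)).map L)
    (b := (Matrix.of fun i j => evenDeriv i (φ.odd j) (basePt z)).map L)
    (c := (Matrix.of fun i j => oddDeriv i (φ.even j) (basePt z)).map L)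
    (d := (Matrix.of fun i j => oddDeriv i (φ.odd j) (basePt z)).map L)
    (x := Matrix.of fun i j => evenDeriv (Fin.castAdd n i) (dFun (φ.odd j)) z)
    (y := Matrix.of fun i j => evenDeriv (Fin.castAdd n i) (dFun (φ.even j)) z)
    (u := Matrix.of fun i j => oddDeriv (Fin.castAdd m i) (dFun (φ.odd j)) z)
    (v := Matrix.of fun i j => oddDeriv (Fin.castAdd m i) (dFun (φ.even j)) z)
    (hev (h.1.evenMat_evenDeriv_even hx)) (hev (h.1.evenMat_oddDeriv_odd hx))
    (fun i j => by simpa using hT.1.evenMat_evenDeriv_even hz (Fin.castAdd n i) (Fin.natAdd m j))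
    (fun i j => by simpa using hT.1.evenMat_oddDeriv_odd hz (Fin.castAdd m i) (Fin.natAdd n j))
    (hod (h.1.oddMat_evenDeriv_odd hx)) (hod (h.1.oddMat_oddDeriv_even hx))
    (fun i j => by simpa using hT.1.oddMat_evenDeriv_odd hz (Fin.castAdd n i) (Fin.natAdd n j))
    (fun i j => by simpa using hT.1.oddMat_oddDeriv_even hz (Fin.castAdd m i) (Fin.natAdd m j))
    (hun (h.1.evenMat_evenDeriv_even hx)
      (Matrix.det_ne_zero_of_right_inverse (h.body_evenDeriv_mul hx)))
    (hun (h.1.evenMat_oddDeriv_odd hx)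
      (Matrix.det_ne_zero_of_right_inverse (h.body_oddDeriv_mul hx))) ?_ ?_ ?_ ?_
  · ext (i | i) (j | j) <;>
      simp [toBlocks₁₁, jacobian, evenDeriv_castAdd_liftFun hU (hsub _) hz,
        evenDeriv_natAdd_liftFun hU (hsub _) hz, evenDeriv_natAdd_dFun hU (hsubo _) hz, L,
        liftFun_apply]
  · ext (i | i) (j | j) <;>
      simp [toBlocks₁₂, jacobian, evenDeriv_castAdd_liftFun hU (hsubo _) hz,
        evenDeriv_natAdd_liftFun hU (hsubo _) hz, evenDeriv_natAdd_dFun hU (hsub _) hz, L,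
        liftFun_apply]
  · ext (i | i) (j | j) <;>
      simp [toBlocks₂₁, jacobian, oddDeriv_castAdd_liftFun, oddDeriv_natAdd_liftFun,
        oddDeriv_natAdd_dFun, L, liftFun_apply]
  · ext (i | i) (j | j) <;>
      simp [toBlocks₂₂, jacobian, oddDeriv_castAdd_liftFun, oddDeriv_natAdd_liftFun,
        oddDeriv_natAdd_dFun, L, liftFun_apply]

end JacobianOfOddTangent

/-! ### A norm on the Grassmann algebra. -/

section CoefficientNorm

variable {𝕜 : Type*} [RCLike 𝕜] {q q' : ℕ}

/-- The sum of the absolute values of the coefficients. -/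
def coeffNorm (w : Grassmann 𝕜 q) : ℝ := ∑ A, ‖coeff A w‖

theorem coeffNorm_nonneg (w : Grassmann 𝕜 q) : 0 ≤ coeffNorm w :=
  Finset.sum_nonneg fun _ _ => norm_nonneg _

theorem norm_coeff_le_coeffNorm (A : Finset (Fin q)) (w : Grassmann 𝕜 q) :
    ‖coeff A w‖ ≤ coeffNorm w :=
  Finset.single_le_sum (f := fun A => ‖coeff A w‖) (fun _ _ => norm_nonneg _) (Finset.mem_univ A)

theorem coeffNorm_zero : coeffNorm (0 : Grassmann 𝕜 q) = 0 := by simp [coeffNorm]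

theorem coeffNorm_add_le (u w : Grassmann 𝕜 q) : coeffNorm (u + w) ≤ coeffNorm u + coeffNorm w := by
  rw [coeffNorm, coeffNorm, coeffNorm, ← Finset.sum_add_distrib]
  exact Finset.sum_le_sum fun A _ => by rw [coeff_add]; exact norm_add_le _ _

theorem coeffNorm_smul (c : 𝕜) (w : Grassmann 𝕜 q) : coeffNorm (c • w) = ‖c‖ * coeffNorm w := by
  simp only [coeffNorm, coeff_smul, norm_mul, Finset.mul_sum]

theorem coeffNorm_sum_le {ι : Type*} (s : Finset ι) (f : ι → Grassmann 𝕜 q) :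
    coeffNorm (∑ i ∈ s, f i) ≤ ∑ i ∈ s, coeffNorm (f i) :=
  Finset.le_sum_of_subadditive _ coeffNorm_zero.le coeffNorm_add_le s f

theorem exists_coeffNorm_linear_le (l : Grassmann 𝕜 q →ₗ[𝕜] Grassmann 𝕜 q') :
    ∃ C, 0 ≤ C ∧ ∀ w, coeffNorm (l w) ≤ C * coeffNorm w := by
  refine ⟨∑ A, coeffNorm (l (monomialBasis 𝕜 q A)),
    Finset.sum_nonneg fun _ _ => coeffNorm_nonneg _, fun w => ?_⟩
  rw [linear_apply_eq_sum]
  refine (coeffNorm_sum_le _ _).trans ?_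
  rw [Finset.sum_mul]
  refine Finset.sum_le_sum fun A _ => ?_
  rw [coeffNorm_smul, mul_comm]
  exact mul_le_mul_of_nonneg_left (norm_coeff_le_coeffNorm A w) (coeffNorm_nonneg _)

theorem exists_coeffNorm_mul_le (𝕜 : Type*) [RCLike 𝕜] (q : ℕ) :
    ∃ C, 0 ≤ C ∧ ∀ u w : Grassmann 𝕜 q, coeffNorm (u * w) ≤ C * (coeffNorm u * coeffNorm w) := by
  choose C hC h using fun A => exists_coeffNorm_linear_le (LinearMap.mulLeft 𝕜 (monomialBasis 𝕜 q A))
  refine ⟨∑ A, C A, Finset.sum_nonneg fun A _ => hC A, fun u w => ?_⟩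
  have : u * w = ∑ A, coeff A u • (monomialBasis 𝕜 q A * w) := by
    conv_lhs => rw [← sum_coeff_smul u, Finset.sum_mul]
    simp only [smul_mul_assoc]
  rw [this]
  refine (coeffNorm_sum_le _ _).trans ?_
  rw [Finset.sum_mul]
  refine Finset.sum_le_sum fun A _ => ?_
  rw [coeffNorm_smul]
  calc ‖coeff A u‖ * coeffNorm (monomialBasis 𝕜 q A * w)
      ≤ coeffNorm u * (C A * coeffNorm w) :=
        mul_le_mul (norm_coeff_le_coeffNorm A u) (h A w) (coeffNorm_nonneg _) (coeffNorm_nonneg _)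
    _ = _ := by ring

end CoefficientNorm

/-! ### Growth along the fibres, locally uniformly over the base. -/

section Growth

variable {𝕜 : Type*} [RCLike 𝕜] {m n : ℕ} {U V : Set (Fin m → ℝ)}
  {f g : SFun 𝕜 (m + n) (n + m)} {s t : ℤ}

theorem one_le_one_add_norm_fibrePt (z : Fin (m + n) → ℝ) : 1 ≤ 1 + ‖fibrePt z‖ := by simp

theorem one_add_norm_fibrePt_pos (z : Fin (m + n) → ℝ) : 0 < 1 + ‖fibrePt z‖ := by positivity

/-- The values of `g` are bounded by a multiple of `(1 + |y|) ^ s`, locally uniformly over `U`. -/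
def HasGrowth (U : Set (Fin m → ℝ)) (s : ℤ) (g : SFun 𝕜 (m + n) (n + m)) : Prop :=
  ∀ L ⊆ U, IsCompact L → ∃ C : ℝ, 0 ≤ C ∧
    ∀ z, basePt z ∈ L → coeffNorm (g z) ≤ C * (1 + ‖fibrePt z‖) ^ s

theorem HasGrowth.congr (h : HasGrowth U s f) (he : Set.EqOn g f (tangentDomain n U)) :
    HasGrowth U s g := fun L hL hc => by
  obtain ⟨C, hC, h⟩ := h L hL hc
  exact ⟨C, hC, fun z hz => by rw [he (hL hz)]; exact h z hz⟩

theorem HasGrowth.weaken (h : HasGrowth U s f) (hst : s ≤ t) : HasGrowth U t f := fun L hL hc => by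
  obtain ⟨C, hC, h⟩ := h L hL hc
  exact ⟨C, hC, fun z hz => (h z hz).trans (mul_le_mul_of_nonneg_left
    (zpow_le_zpow_right₀ (one_le_one_add_norm_fibrePt z) hst) hC)⟩

theorem HasGrowth.add (hf : HasGrowth U s f) (hg : HasGrowth U s g) :
    HasGrowth U s (fun z => f z + g z) := fun L hL hc => by
  obtain ⟨C, hC, hf⟩ := hf L hL hc
  obtain ⟨D, hD, hg⟩ := hg L hL hc
  refine ⟨C + D, add_nonneg hC hD, fun z hz => (coeffNorm_add_le _ _).trans ?_⟩
  rw [add_mul]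
  exact add_le_add (hf z hz) (hg z hz)

theorem hasGrowth_zero : HasGrowth U s (fun _ => 0 : SFun 𝕜 (m + n) (n + m)) := fun _ _ _ =>
  ⟨0, le_rfl, fun _ _ => by simp [coeffNorm_zero]⟩

theorem HasGrowth.mul (hf : HasGrowth U s f) (hg : HasGrowth U t g) :
    HasGrowth U (s + t) (fun z => f z * g z) := fun L hL hc => by
  obtain ⟨K, hK, hmul⟩ := exists_coeffNorm_mul_le 𝕜 (n + m)
  obtain ⟨C, hC, hf⟩ := hf L hL hc
  obtain ⟨D, hD, hg⟩ := hg L hL hc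
  refine ⟨K * (C * D), by positivity, fun z hz => (hmul _ _).trans ?_⟩
  rw [zpow_add₀ (one_add_norm_fibrePt_pos z).ne', mul_assoc K]
  refine mul_le_mul_of_nonneg_left ?_ hK
  rw [mul_mul_mul_comm]
  exact mul_le_mul (hf z hz) (hg z hz) (coeffNorm_nonneg _) (by positivity)

theorem HasGrowth.linear (hf : HasGrowth U s f)
    (l : Grassmann 𝕜 (n + m) →ₗ[𝕜] Grassmann 𝕜 (n + m)) : HasGrowth U s (fun z => l (f z)) :=
  fun L hL hc => by
    obtain ⟨K, hK, hl⟩ := exists_coeffNorm_linear_le l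
    obtain ⟨C, hC, hf⟩ := hf L hL hc
    refine ⟨K * C, by positivity, fun z hz => (hl _).trans ?_⟩
    rw [mul_assoc]
    exact mul_le_mul_of_nonneg_left (hf z hz) hK

theorem HasGrowth.const_smul (hf : HasGrowth U s f) (c : 𝕜) :
    HasGrowth U s (fun z => c • f z) := hf.linear (LinearMap.lsmul 𝕜 (Grassmann 𝕜 (n + m)) c)

theorem HasGrowth.sum {ι : Type*} {S : Finset ι} {F : ι → SFun 𝕜 (m + n) (n + m)}
    (h : ∀ i ∈ S, HasGrowth U s (F i)) : HasGrowth U s (fun z => ∑ i ∈ S, F i z) := by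
  classical
  induction S using Finset.induction_on with
  | empty => simpa using hasGrowth_zero
  | insert a S ha ih =>
    simp only [Finset.sum_insert ha]
    exact (h a (Finset.mem_insert_self a S)).add
      (ih fun i hi => h i (Finset.mem_insert_of_mem hi))

theorem hasGrowth_const (w : Grassmann 𝕜 (n + m)) :
    HasGrowth U 0 (fun _ => w : SFun 𝕜 (m + n) (n + m)) := fun _ _ _ =>
  ⟨coeffNorm w, coeffNorm_nonneg w, fun _ _ => by simp⟩

/-- `g` and its derivatives of order at most `l` are bounded by multiples of `(1 + |y|) ^ s`, locally
uniformly over `U`. -/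
def HasGrowthUpTo (U : Set (Fin m → ℝ)) (s : ℤ) : ℕ → SFun 𝕜 (m + n) (n + m) → Prop
  | 0, g => HasGrowth U s g
  | l + 1, g => HasGrowth U s g ∧ ∀ i, HasGrowthUpTo U s l (evenDeriv i g)

namespace HasGrowthUpTo

variable {l : ℕ}

theorem hasGrowth (h : HasGrowthUpTo U s l f) : HasGrowth U s f := by
  cases l with
  | zero => exact h
  | succ l => exact h.1

theorem congr (hU : IsOpen U) (h : HasGrowthUpTo U s l f)
    (he : Set.EqOn g f (tangentDomain n U)) : HasGrowthUpTo U s l g := by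
  induction l generalizing f g with
  | zero => exact HasGrowth.congr h he
  | succ l ih =>
    exact ⟨h.1.congr he, fun i => ih (h.2 i) (evenDeriv_congr (isOpen_tangentDomain hU) he i)⟩

theorem weaken (h : HasGrowthUpTo U s l f) (hst : s ≤ t) : HasGrowthUpTo U t l f := by
  induction l generalizing f with
  | zero => exact HasGrowth.weaken h hst
  | succ l ih => exact ⟨h.1.weaken hst, fun i => ih (h.2 i)⟩

theorem of_succ (h : HasGrowthUpTo U s (l + 1) f) : HasGrowthUpTo U s l f := by
  induction l generalizing f with
  | zero => exact h.1
  | succ l ih => exact ⟨h.1, fun i => ih (h.2 i)⟩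

theorem add (hU : IsOpen U) (hf : SmoothOn f (tangentDomain n U))
    (hg : SmoothOn g (tangentDomain n U)) (h : HasGrowthUpTo U s l f)
    (h' : HasGrowthUpTo U s l g) : HasGrowthUpTo U s l (fun z => f z + g z) := by
  have hT := isOpen_tangentDomain (n := n) hU
  induction l generalizing f g with
  | zero => exact HasGrowth.add h h'
  | succ l ih =>
    exact ⟨h.1.add h'.1, fun i => (ih (hf.evenDeriv hT i) (hg.evenDeriv hT i) (h.2 i) (h'.2 i)).congr
      hU fun z hz => evenDeriv_add hT hf hg hz i⟩

theorem zero : HasGrowthUpTo U s l (fun _ => 0 : SFun 𝕜 (m + n) (n + m)) := by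
  induction l with
  | zero => exact hasGrowth_zero
  | succ l ih =>
    refine ⟨hasGrowth_zero, fun i => ?_⟩
    rwa [show evenDeriv i (fun _ => 0 : SFun 𝕜 (m + n) (n + m)) = fun _ => 0 from
      funext fun z => evenDeriv_const i 0]

theorem const (w : Grassmann 𝕜 (n + m)) :
    HasGrowthUpTo U 0 l (fun _ => w : SFun 𝕜 (m + n) (n + m)) := by
  cases l with
  | zero => exact hasGrowth_const w
  | succ l =>
    refine ⟨hasGrowth_const w, fun i => ?_⟩
    rw [show evenDeriv i (fun _ => w : SFun 𝕜 (m + n) (n + m)) = fun _ => 0 from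
      funext fun z => evenDeriv_const i w]
    exact zero

theorem sum (hU : IsOpen U) {ι : Type*} {S : Finset ι} {F : ι → SFun 𝕜 (m + n) (n + m)}
    (hF : ∀ i ∈ S, SmoothOn (F i) (tangentDomain n U)) (h : ∀ i ∈ S, HasGrowthUpTo U s l (F i)) :
    HasGrowthUpTo U s l (fun z => ∑ i ∈ S, F i z) := by
  classical
  induction S using Finset.induction_on with
  | empty => simpa using zero
  | insert a S ha ih =>
    simp only [Finset.sum_insert ha]
    exact (h a (Finset.mem_insert_self a S)).add hU (hF a (Finset.mem_insert_self a S))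
      (SmoothOn.sum fun i hi => hF i (Finset.mem_insert_of_mem hi))
      (ih (fun i hi => hF i (Finset.mem_insert_of_mem hi))
        fun i hi => h i (Finset.mem_insert_of_mem hi))

theorem mul (hU : IsOpen U) (hf : SmoothOn f (tangentDomain n U))
    (hg : SmoothOn g (tangentDomain n U)) (h : HasGrowthUpTo U s l f)
    (h' : HasGrowthUpTo U t l g) : HasGrowthUpTo U (s + t) l (fun z => f z * g z) := by
  have hT := isOpen_tangentDomain (n := n) hU
  induction l generalizing f g with
  | zero => exact HasGrowth.mul h h'
  | succ l ih =>
    refine ⟨h.1.mul h'.1, fun i => ?_⟩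
    exact ((ih (hf.evenDeriv hT i) hg (h.2 i) h'.of_succ).add hU ((hf.evenDeriv hT i).mul hg)
      (hf.mul (hg.evenDeriv hT i)) (ih hf (hg.evenDeriv hT i) h.of_succ (h'.2 i))).congr hU
      fun z hz => evenDeriv_mul hT hf hg hz i

theorem linear (hU : IsOpen U) (hf : SmoothOn f (tangentDomain n U))
    (h : HasGrowthUpTo U s l f) (L : Grassmann 𝕜 (n + m) →ₗ[𝕜] Grassmann 𝕜 (n + m)) :
    HasGrowthUpTo U s l (fun z => L (f z)) := by
  have hT := isOpen_tangentDomain (n := n) hU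
  induction l generalizing f with
  | zero => exact HasGrowth.linear h L
  | succ l ih =>
    exact ⟨h.1.linear L, fun i => (ih (hf.evenDeriv hT i) (h.2 i)).congr hU
      fun z hz => (linear_evenDeriv hT hf hz L i).symm⟩

/-- A compact set in `U` meets `K` in a compact subset of `V`, where the bound is given; elsewhere
the function and its derivatives vanish. -/
theorem extend {K : Set (Fin m → ℝ)} (hK : IsCompact K) (hKV : K ⊆ V)
    (hU : IsOpen U) (h0 : ∀ z, basePt z ∈ U \ K → f z = 0) (h : HasGrowthUpTo V s l f) :
    HasGrowthUpTo U s l f := by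
  have key : ∀ {f : SFun 𝕜 (m + n) (n + m)}, (∀ z, basePt z ∈ U \ K → f z = 0) →
      HasGrowth V s f → HasGrowth U s f := fun h0 h L hL hc => by
    obtain ⟨C, hC, h⟩ := h (L ∩ K) (Set.inter_subset_right.trans hKV) (hc.inter hK)
    refine ⟨C, hC, fun z hz => ?_⟩
    by_cases hzK : basePt z ∈ K
    · exact h z ⟨hz, hzK⟩
    · rw [h0 z ⟨hL hz, hzK⟩, coeffNorm_zero]
      positivity
  have hO : IsOpen (tangentDomain n (U \ K)) :=
    isOpen_tangentDomain (hU.sdiff hK.isClosed)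
  induction l generalizing f with
  | zero => exact key h0 h
  | succ l ih =>
    refine ⟨key h0 h.1, fun i => ih (fun z hz => ?_) (h.2 i)⟩
    rw [evenDeriv_congr (g := fun _ => 0) hO h0 i hz, evenDeriv_const]

end HasGrowthUpTo

theorem hasGrowth_liftFun {f : SFun 𝕜 m n} (hf : SmoothOn f U) : HasGrowth U 0 (liftFun f) :=
  fun L hL hc => by
    obtain ⟨K, hK, hl⟩ := exists_coeffNorm_linear_le (liftₐ 𝕜 m n).toLinearMap
    have hcont : ContinuousOn (fun x => coeffNorm (f x)) L :=
      continuousOn_finsetSum _ fun A _ => ((hf A).continuousOn.mono hL).norm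
    obtain ⟨C, hC⟩ := hc.bddAbove_image hcont
    refine ⟨K * max C 0, by positivity, fun z hz => ?_⟩
    rw [zpow_zero, mul_one]
    exact (hl _).trans (mul_le_mul_of_nonneg_left
      ((hC (Set.mem_image_of_mem _ hz)).trans (le_max_left _ _)) hK)

theorem hasGrowthUpTo_liftFun (hU : IsOpen U) {f : SFun 𝕜 m n} (hf : SmoothOn f U) (l : ℕ) :
    HasGrowthUpTo U 0 l (liftFun f) := by
  induction l generalizing f with
  | zero => exact hasGrowth_liftFun hf
  | succ l ih =>
    refine ⟨hasGrowth_liftFun hf, fun i => Fin.addCases (fun k => ?_) (fun b => ?_) i⟩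
    · exact (ih (hf.evenDeriv hU k)).congr hU fun z hz => evenDeriv_castAdd_liftFun hU hf hz k
    · exact HasGrowthUpTo.zero.congr hU fun z hz => evenDeriv_natAdd_liftFun hU hf hz b

theorem hasGrowth_fibrePt (b : Fin n) : HasGrowth U 1 (fun z : Fin (m + n) → ℝ =>
    algebraMap 𝕜 (Grassmann 𝕜 (n + m)) (fibrePt z b : 𝕜)) := fun _ _ _ => by
  refine ⟨coeffNorm (1 : Grassmann 𝕜 (n + m)), coeffNorm_nonneg _, fun z _ => ?_⟩
  beta_reduce
  rw [Algebra.algebraMap_eq_smul_one, coeffNorm_smul, zpow_one, mul_comm]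
  refine mul_le_mul_of_nonneg_left ?_ (coeffNorm_nonneg _)
  rw [RCLike.norm_ofReal]
  exact (norm_le_pi_norm (fibrePt z) b).trans (by simp)

theorem hasGrowth_dFun (hU : IsOpen U) {f : SFun 𝕜 m n} (hf : SmoothOn f U) :
    HasGrowth U 1 (dFun f) := by
  rw [dFun_eq]
  exact (HasGrowth.sum fun k _ => ((hasGrowth_const _).mul
    (hasGrowth_liftFun (hf.evenDeriv hU k))).weaken zero_le_one).add
      (HasGrowth.sum fun b _ => (hasGrowth_fibrePt b).mul (hasGrowth_liftFun (hf.oddDeriv b)))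

theorem hasGrowthUpTo_dFun (hU : IsOpen U) {f : SFun 𝕜 m n} (hf : SmoothOn f U) (l : ℕ) :
    HasGrowthUpTo U 1 l (dFun f) := by
  induction l generalizing f with
  | zero => exact hasGrowth_dFun hU hf
  | succ l ih =>
    refine ⟨hasGrowth_dFun hU hf, fun i => Fin.addCases (fun k => ?_) (fun b => ?_) i⟩
    · exact (ih (hf.evenDeriv hU k)).congr hU fun z hz => evenDeriv_castAdd_dFun hU hf hz k
    · exact ((hasGrowthUpTo_liftFun hU (hf.oddDeriv b) l).weaken zero_le_one).congr hU
        fun z hz => evenDeriv_natAdd_dFun hU hf hz b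

/-- All derivatives decrease faster than any power of `|y|`. -/
def IsSchwartzOn (U : Set (Fin m → ℝ)) (f : SFun 𝕜 (m + n) (n + m)) : Prop :=
  ∀ (l : ℕ) (s : ℤ), HasGrowthUpTo U s l f

/-- The weights |y|^k are converted into powers of 1 + |y|, which are multiplicative and invertible;
this is what makes the calculus of growth exponents work. -/
theorem RapidlyDecreasing.hasGrowth (h : RapidlyDecreasing U f) (s : ℤ) : HasGrowth U s f := by
  -- It is enough to treat the exponent -|s|, which is at most `s`.
  refine HasGrowth.weaken (s := -(s.natAbs : ℤ)) (fun L hL hc => ?_) (by omega)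
  set k := s.natAbs
  choose C hC using fun A => h L hL hc A k 0
  choose D hD using fun A => h L hL hc A 0 0
  refine ⟨∑ A, 2 ^ k * (max (C A) 0 + max (D A) 0), Finset.sum_nonneg fun A _ => by positivity,
    fun z hz => ?_⟩
  rw [coeffNorm, Finset.sum_mul]
  refine Finset.sum_le_sum fun A _ => ?_
  have h1 := hC A z hz
  have h2 := hD A z hz
  rw [norm_iteratedFDeriv_zero] at h1 h2
  rw [zpow_neg, zpow_natCast, ← div_eq_mul_inv, le_div_iff₀ (by positivity)]
  -- The larger of 1 and |y| is at least half of 1 + |y|.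
  have h3 : (1 + ‖fibrePt z‖) ^ k ≤ 2 ^ k * (1 + ‖fibrePt z‖ ^ k) := by
    rcases le_total 1 ‖fibrePt z‖ with h | h
    · calc (1 + ‖fibrePt z‖) ^ k ≤ (2 * ‖fibrePt z‖) ^ k := by gcongr; linarith
        _ ≤ _ := by rw [mul_pow]; gcongr; linarith
    · calc (1 + ‖fibrePt z‖) ^ k ≤ 2 ^ k := by gcongr; linarith
        _ ≤ _ := by
          have : 0 ≤ ‖fibrePt z‖ ^ k := by positivity
          nlinarith [pow_pos (zero_lt_two (α := ℝ)) k]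
  calc ‖coeff A (f z)‖ * (1 + ‖fibrePt z‖) ^ k
      ≤ ‖coeff A (f z)‖ * (2 ^ k * (1 + ‖fibrePt z‖ ^ k)) := by gcongr
    _ = 2 ^ k * (‖fibrePt z‖ ^ k * ‖coeff A (f z)‖ + ‖fibrePt z‖ ^ 0 * ‖coeff A (f z)‖) := by ring
    _ ≤ _ := by
      gcongr
      · exact h1.trans (le_max_left _ _)
      · exact h2.trans (le_max_left _ _)

theorem RapidlyDecreasing.evenDeriv (hU : IsOpen U) (hf : SmoothOn f (tangentDomain n U))
    (h : RapidlyDecreasing U f) (i : Fin (m + n)) : RapidlyDecreasing U (evenDeriv i f) :=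
  fun L hL hc A k l => by
    obtain ⟨C, hC⟩ := h L hL hc A k (l + 1)
    refine ⟨C * ‖(Pi.single i 1 : Fin (m + n) → ℝ)‖, fun z hz => ?_⟩
    simp only [coeff_evenDeriv]
    have hcd := (hf.contDiffAt (isOpen_tangentDomain hU) (hL hz) A).fderiv_right
      (m := (∞ : WithTop ℕ∞)) (by simp)
    have := norm_iteratedFDeriv_clm_apply_const (c := (Pi.single i 1 : Fin (m + n) → ℝ)) hcd
      (n := l) (by exact_mod_cast le_top)
    rw [norm_iteratedFDeriv_fderiv] at this
    calc _ ≤ ‖fibrePt z‖ ^ k * (‖(Pi.single i 1 : Fin (m + n) → ℝ)‖ *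
          ‖iteratedFDeriv ℝ (l + 1) (fun z' => coeff A (f z')) z‖) := by gcongr
      _ = (‖fibrePt z‖ ^ k * ‖iteratedFDeriv ℝ (l + 1) (fun z' => coeff A (f z')) z‖) *
          ‖(Pi.single i 1 : Fin (m + n) → ℝ)‖ := by ring
      _ ≤ _ := by gcongr; exact hC z hz

theorem RapidlyDecreasing.isSchwartzOn (hU : IsOpen U) (hf : SmoothOn f (tangentDomain n U))
    (h : RapidlyDecreasing U f) : IsSchwartzOn U f := fun l s => by
  induction l generalizing f with
  | zero => exact h.hasGrowth s
  | succ l ih => exact ⟨h.hasGrowth s, fun i =>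
      ih (hf.evenDeriv (isOpen_tangentDomain hU) i) (h.evenDeriv hU hf i)⟩

/-- The differential is the sum of its partial derivatives times the coordinate projections, which
have norm at most 1 for the supremum norm. This allows a return from iterated partial derivatives to
`iteratedFDeriv`. -/
theorem norm_iteratedFDeriv_succ_le {p : ℕ} {h : (Fin p → ℝ) → 𝕜} {z : Fin p → ℝ}
    (hh : ContDiffAt ℝ ∞ h z) (l : ℕ) : ‖iteratedFDeriv ℝ (l + 1) h z‖ ≤
      ∑ i, ‖iteratedFDeriv ℝ l (fun z' => fderiv ℝ h z' (Pi.single i 1)) z‖ := by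
  let π : Fin p → 𝕜 →L[ℝ] ((Fin p → ℝ) →L[ℝ] 𝕜) := fun i =>
    ContinuousLinearMap.smulRightL ℝ (Fin p → ℝ) 𝕜 (ContinuousLinearMap.proj i)
  have hπ : ∀ i, ‖π i‖ ≤ 1 := fun i => by
    refine ContinuousLinearMap.opNorm_le_bound _ zero_le_one fun c => ?_
    refine ContinuousLinearMap.opNorm_le_bound _ (by positivity) fun v => ?_
    change ‖v i • c‖ ≤ _
    rw [norm_smul, one_mul, mul_comm]
    gcongr
    exact norm_le_pi_norm v i
  have h1 : fderiv ℝ h = fun z' => ∑ i, π i (fderiv ℝ h z' (Pi.single i 1)) := by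
    funext z'
    refine ContinuousLinearMap.ext fun v => ?_
    rw [_root_.sum_apply]
    conv_lhs => rw [← Finset.univ_sum_single v, map_sum]
    refine Finset.sum_congr rfl fun i _ => ?_
    change _ = v i • fderiv ℝ h z' (Pi.single i 1)
    rw [← map_smul, ← Pi.single_smul, smul_eq_mul, mul_one]
  have h2 : ∀ i, ContDiffAt ℝ ∞ (fun z' => fderiv ℝ h z' (Pi.single i 1)) z := fun i =>
    (hh.fderiv_right (m := (∞ : WithTop ℕ∞)) (by simp)).clm_apply contDiffAt_const
  have hl : (l : WithTop ℕ∞) ≤ ∞ := by exact_mod_cast le_top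
  have h3 : iteratedFDeriv ℝ l (fderiv ℝ h) z =
      ∑ i, iteratedFDeriv ℝ l (π i ∘ fun z' => fderiv ℝ h z' (Pi.single i 1)) z := by
    conv_lhs => rw [h1]
    exact iteratedFDeriv_fun_sum_apply (f := fun i => π i ∘ fun z' => fderiv ℝ h z' (Pi.single i 1))
      fun i _ => (((π i).contDiff.contDiffAt.comp z (h2 i)).of_le hl)
  rw [← norm_iteratedFDeriv_fderiv, h3]
  refine (norm_sum_le _ _).trans (Finset.sum_le_sum fun i _ => ?_)
  refine ((π i).norm_iteratedFDeriv_comp_left (h2 i) hl).trans ?_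
  exact mul_le_of_le_one_left (norm_nonneg _) (hπ i)

theorem IsSchwartzOn.evenDeriv (h : IsSchwartzOn U f) (i : Fin (m + n)) :
    IsSchwartzOn U (evenDeriv i f) := fun l s => (h (l + 1) s).2 i

theorem IsSchwartzOn.rapidlyDecreasing (hU : IsOpen U) (hf : SmoothOn f (tangentDomain n U))
    (h : IsSchwartzOn U f) : RapidlyDecreasing U f := fun L hL hc A k l => by
  induction l generalizing f with
  | zero =>
    obtain ⟨C, hC, h⟩ := h 0 (-(k : ℤ)) L hL hc
    refine ⟨C, fun z hz => ?_⟩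
    rw [norm_iteratedFDeriv_zero]
    have h1 := (norm_coeff_le_coeffNorm A _).trans (h z hz)
    rw [zpow_neg, zpow_natCast, ← div_eq_mul_inv, le_div_iff₀ (by positivity)] at h1
    refine le_trans ?_ h1
    rw [mul_comm]
    gcongr
    simp
  | succ l ih =>
    choose C hC using fun i => ih (hf.evenDeriv (isOpen_tangentDomain hU) i) (h.evenDeriv i)
    refine ⟨∑ i, C i, fun z hz => ?_⟩
    have h1 := norm_iteratedFDeriv_succ_le
      (hf.contDiffAt (isOpen_tangentDomain hU) (hL hz) A) l
    simp only [← coeff_evenDeriv] at h1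
    refine (mul_le_mul_of_nonneg_left h1 (by positivity)).trans ?_
    rw [Finset.mul_sum]
    exact Finset.sum_le_sum fun i _ => hC i z hz

/-! ### Coordinate changes preserve decay. -/

section Pullback

variable {φ χ : SuperMap 𝕜 m n m n}

theorem SuperMap.IsMorphism.hasGrowthUpTo_even (hφ : φ.IsMorphism U V) (l : ℕ)
    (i : Fin (m + n)) : HasGrowthUpTo U 1 l (φ.oddTangent.even i) :=
  Fin.addCases (fun i => by
    rw [SuperMap.oddTangent_even_castAdd]
    exact (hasGrowthUpTo_liftFun hφ.isOpen_source (hφ.smooth_even i) l).weaken zero_le_one)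
    (fun a => by
      rw [SuperMap.oddTangent_even_natAdd]
      exact hasGrowthUpTo_dFun hφ.isOpen_source (hφ.smooth_odd a) l) i

theorem SuperMap.IsMorphism.hasGrowthUpTo_odd (hφ : φ.IsMorphism U V) (l : ℕ)
    (i : Fin (n + m)) : HasGrowthUpTo U 1 l (φ.oddTangent.odd i) :=
  Fin.addCases (fun i => by
    rw [SuperMap.oddTangent_odd_castAdd]
    exact (hasGrowthUpTo_liftFun hφ.isOpen_source (hφ.smooth_odd i) l).weaken zero_le_one)
    (fun a => by
      rw [SuperMap.oddTangent_odd_natAdd]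
      exact hasGrowthUpTo_dFun hφ.isOpen_source (hφ.smooth_even a) l) i

/-- The fibre components are differentials, of growth exponent 1. The estimate is needed for the
inverse transformation, where it becomes a lower bound for the new fibre coordinate. -/
theorem SuperMap.IsMorphism.exists_norm_fibrePt_bodyMap_le (hφ : φ.IsMorphism U V)
    {L : Set (Fin m → ℝ)} (hL : L ⊆ U) (hc : IsCompact L) :
    ∃ C : ℝ, 0 < C ∧ ∀ z : Fin (m + n) → ℝ, basePt z ∈ L →
      1 + ‖fibrePt (φ.oddTangent.bodyMap z)‖ ≤ C * (1 + ‖fibrePt z‖) := by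
  choose C hC h using fun i => (hφ.hasGrowthUpTo_even 0 i).hasGrowth L hL hc
  refine ⟨1 + ∑ i, C i, by have := Finset.sum_nonneg fun i (_ : i ∈ Finset.univ) => hC i; linarith,
    fun z hz => ?_⟩
  have h1 : ‖fibrePt (φ.oddTangent.bodyMap z)‖ ≤ (∑ i, C i) * (1 + ‖fibrePt z‖) := by
    refine (pi_norm_le_iff_of_nonneg (mul_nonneg (Finset.sum_nonneg fun i _ => hC i)
      (by positivity))).2 fun b => ?_
    rw [Real.norm_eq_abs]
    refine (RCLike.abs_re_le_norm _).trans ?_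
    rw [← coeff_empty]
    refine (norm_coeff_le_coeffNorm _ _).trans ((h _ z hz).trans ?_)
    rw [zpow_one]
    exact mul_le_mul_of_nonneg_right (Finset.single_le_sum (f := C) (fun i _ => hC i)
      (Finset.mem_univ _)) (by positivity)
  have := norm_nonneg (fibrePt z)
  linarith

/-- Linear growth of the inverse gives 1 + |y| ≤ D (1 + |Y|) over compact sets, so decrease in Y is
decrease in y. -/
theorem SuperMap.IsInverse.hasGrowth_comp_bodyMap (h : φ.IsInverse χ U V)
    {f : SFun 𝕜 (m + n) (n + m)} (hf : ∀ s, HasGrowth V s f) (s : ℤ) :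
    HasGrowth U s (fun z => f (φ.oddTangent.bodyMap z)) := by
  refine HasGrowth.weaken (s := -(s.natAbs : ℤ)) (fun L hL hc => ?_) (by omega)
  set k := s.natAbs
  have hL' : φ.bodyMap '' L ⊆ V := by
    rintro _ ⟨x, hx, rfl⟩
    exact h.1.mapsTo (hL hx)
  have hc' : IsCompact (φ.bodyMap '' L) :=
    hc.image_of_continuousOn (h.1.contDiffOn_bodyMap.continuousOn.mono hL)
  obtain ⟨C, hC, hf⟩ := hf (-(k : ℤ)) _ hL' hc'
  obtain ⟨D, hD, hχ⟩ := h.2.exists_norm_fibrePt_bodyMap_le hL' hc'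
  refine ⟨C * D ^ k, by positivity, fun z hz => ?_⟩
  have hm : basePt (φ.oddTangent.bodyMap z) ∈ φ.bodyMap '' L := by
    rw [SuperMap.basePt_bodyMap_oddTangent]
    exact Set.mem_image_of_mem _ hz
  refine (hf _ hm).trans ?_
  have h1 := hχ _ hm
  rw [h.oddTangent.bodyMap_bodyMap (show z ∈ tangentDomain n U from hL hz)] at h1
  rw [mul_assoc]
  refine mul_le_mul_of_nonneg_left ?_ hC
  rw [zpow_neg, zpow_neg, zpow_natCast, zpow_natCast, ← div_eq_mul_inv,
    le_div_iff₀ (by positivity), inv_mul_le_iff₀ (by positivity), mul_comm, ← mul_pow]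
  gcongr

theorem HasGrowth.list_prod {F : List (SFun 𝕜 (m + n) (n + m))} (h : ∀ f ∈ F, HasGrowth U 1 f) :
    HasGrowth U F.length (fun z => (F.map fun f => f z).prod) := by
  induction F with
  | nil => simpa using hasGrowth_const 1
  | cons a F ih =>
    have := (h a List.mem_cons_self).mul (ih fun f hf => h f (List.mem_cons_of_mem _ hf))
    rw [List.length_cons, Nat.cast_succ, add_comm]
    simpa using this

theorem SuperMap.IsMorphism.hasGrowth_oddMonomial (hφ : φ.IsMorphism U V)
    (A : Finset (Fin (n + m))) :
    HasGrowth U ((n + m : ℕ) : ℤ) (fun z => φ.oddTangent.oddMonomial A z) := by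
  have := HasGrowth.list_prod (U := U) (F := (A.sort (· ≤ ·)).map φ.oddTangent.odd) (by
    intro f hf
    obtain ⟨j, _, rfl⟩ := List.mem_map.1 hf
    exact (hφ.hasGrowthUpTo_odd 0 j).hasGrowth)
  refine HasGrowth.weaken (this.congr fun z _ => ?_) ?_
  · beta_reduce
    rw [List.map_map]; rfl
  · rw [List.length_map, Finset.length_sort]
    exact_mod_cast (Finset.card_le_univ A).trans (by simp)

/-- The soul as a linear map. -/
def soulₗ : Grassmann 𝕜 (n + m) →ₗ[𝕜] Grassmann 𝕜 (n + m) :=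
  LinearMap.id - (Algebra.linearMap 𝕜 (Grassmann 𝕜 (n + m))).comp
    (bodyₐ : Grassmann 𝕜 (n + m) →ₐ[𝕜] 𝕜).toLinearMap

theorem HasGrowth.soul {f : SFun 𝕜 (m + n) (n + m)} {s : ℤ} (hf : HasGrowth U s f) :
    HasGrowth U s (fun z => soul (f z)) :=
  hf.linear soulₗ

/-- Souls and odd monomials grow polynomially in y. The exponent `s` being arbitrary, this loss is
compensated by starting from a smaller exponent for `f`. -/
theorem SuperMap.IsInverse.hasGrowth_taylorTerm (h : φ.IsInverse χ U V)
    {f : SFun 𝕜 (m + n) (n + m)} (hf : IsSchwartzOn V f) (k : ℕ) (s : ℤ) :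
    HasGrowth U s (φ.oddTangent.taylorTerm k f) := by
  induction k generalizing f s with
  | zero =>
    have h1 := h.hasGrowth_comp_bodyMap (fun s => hf 0 s)
    have h2 : HasGrowth U s (fun z => ∑ A, (coeff A (f (φ.oddTangent.bodyMap z)) •
        (1 : Grassmann 𝕜 (n + m))) * φ.oddTangent.oddMonomial A z) := by
      refine HasGrowth.sum fun A _ => ?_
      have h3 := (h1 (s - (n + m : ℕ))).linear ((coeffₗ A).smulRight (1 : Grassmann 𝕜 (n + m)))
      have h4 := h3.mul (h.1.hasGrowth_oddMonomial A)
      rwa [sub_add_cancel] at h4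
    refine h2.congr fun z _ => ?_
    rw [SuperMap.taylorTerm_zero, SuperMap.oddSubst_eq_sum]
    simp only [smul_mul_assoc, one_mul]
  | succ k ih =>
    refine HasGrowth.sum fun j _ => ?_
    have := (h.1.hasGrowthUpTo_even 0 j).hasGrowth.soul.mul (ih (hf.evenDeriv j) (s - 1))
    simpa using this

/-- Derivatives of the pullback are controlled by the chain rule: they are combinations of
pulled-back derivatives of `f`, which are again rapidly decreasing, with coefficients of growth
exponent 1. Only the estimate of values uses the Taylor expansion. -/
theorem SuperMap.IsInverse.isSchwartzOn_pullback (h : φ.IsInverse χ U V)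
    {f : SFun 𝕜 (m + n) (n + m)} (hs : SmoothOn f (tangentDomain n V)) (hf : IsSchwartzOn V f) :
    IsSchwartzOn U (φ.oddTangent.pullback f) := fun l s => by
  have hU := h.1.isOpen_source
  have hT := h.1.oddTangent
  have hS := hT.isOpen_source
  have hS' := hT.isOpen_target
  have h0 : ∀ {f : SFun 𝕜 (m + n) (n + m)}, SmoothOn f (tangentDomain n V) → IsSchwartzOn V f →
      ∀ s, HasGrowth U s (φ.oddTangent.pullback f) := fun hs hf s =>
    HasGrowth.congr (HasGrowth.sum fun k _ => (h.hasGrowth_taylorTerm hf k s).const_smul _)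
      fun z hz => hT.pullback_eq_sum hz hs (Nat.lt_succ_self _)
  have hodd : ∀ {f : SFun 𝕜 (m + n) (n + m)}, SmoothOn f (tangentDomain n V) →
      IsSchwartzOn V f → ∀ j, IsSchwartzOn V (oddDeriv j f) := fun hs hf j l s =>
    (hf l s).linear h.1.isOpen_target hs (leftDer j)
  induction l generalizing f s with
  | zero => exact h0 hs hf s
  | succ l ih =>
    refine ⟨h0 hs hf s, fun i => ?_⟩
    have hse : ∀ j, SmoothOn (φ.oddTangent.pullback (evenDeriv j f)) (tangentDomain n U) :=
      fun j => hT.smooth_pullback (hs.evenDeriv hS' j)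
    have hso : ∀ j, SmoothOn (φ.oddTangent.pullback (oddDeriv j f)) (tangentDomain n U) :=
      fun j => hT.smooth_pullback (hs.oddDeriv j)
    have hce : ∀ j, SmoothOn (SuperGeom.evenDeriv i (φ.oddTangent.even j)) (tangentDomain n U) :=
      fun j => (hT.smooth_even j).evenDeriv hS i
    have hco : ∀ j, SmoothOn (SuperGeom.evenDeriv i (φ.oddTangent.odd j)) (tangentDomain n U) :=
      fun j => (hT.smooth_odd j).evenDeriv hS i
    refine HasGrowthUpTo.congr hU ?_ fun z hz => hT.evenDeriv_pullback hz hs i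
    refine HasGrowthUpTo.add hU (SmoothOn.sum fun j _ => (hce j).mul (hse j))
      (SmoothOn.sum fun j _ => (hco j).mul (hso j))
      (HasGrowthUpTo.sum hU (fun j _ => (hce j).mul (hse j)) fun j _ => ?_)
      (HasGrowthUpTo.sum hU (fun j _ => (hco j).mul (hso j)) fun j _ => ?_)
    · have := ((h.1.hasGrowthUpTo_even (l + 1) j).2 i).mul hU (hce j) (hse j)
        (ih (hs.evenDeriv hS' j) (hf.evenDeriv j) (s - 1))
      simpa using this
    · have := ((h.1.hasGrowthUpTo_odd (l + 1) j).2 i).mul hU (hco j) (hso j)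
        (ih (hs.oddDeriv j) (hodd hs hf j) (s - 1))
      simpa using this

theorem SuperMap.pullback_eq_zero {f : SFun 𝕜 (m + n) (n + m)} {S : Set (Fin m → ℝ)}
    (hS : IsOpen S) (h0 : ∀ z, basePt z ∈ S → f z = 0) {z : Fin (m + n) → ℝ}
    (hz : φ.bodyMap (basePt z) ∈ S) : φ.oddTangent.pullback f z = 0 := by
  have h1 : f =ᶠ[nhds (φ.oddTangent.bodyMap z)] fun _ => 0 := by
    refine Filter.eventuallyEq_of_mem ((isOpen_tangentDomain hS).mem_nhds ?_) h0
    rw [mem_tangentDomain, SuperMap.basePt_bodyMap_oddTangent]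
    exact hz
  rw [SuperMap.pullback_congr_nhds h1, SuperMap.pullback]
  refine Finset.sum_eq_zero fun A _ => Finset.sum_eq_zero fun k _ =>
    Finset.sum_eq_zero fun i _ => ?_
  have : (fun _ : Fin (m + n) → ℝ => coeff A (0 : Grassmann 𝕜 (n + m))) = fun _ => (0 : 𝕜) := by
    simp
  rw [this, iteratedFDeriv_fun_zero]
  simp

theorem SuperMap.IsInverse.isDecayingForm_pullback (h : φ.IsInverse χ U V)
    {f : SFun 𝕜 (m + n) (n + m)} (hf : IsDecayingForm V f) :
    IsDecayingForm U (φ.oddTangent.pullback f) where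
  smooth := h.1.oddTangent.smooth_pullback hf.smooth
  support := by
    obtain ⟨K, hKV, hK, h0⟩ := hf.support
    -- The support is transported by the inverse map.
    refine ⟨χ.bodyMap '' K, ?_, hK.image_of_continuousOn
      (h.2.contDiffOn_bodyMap.continuousOn.mono hKV), fun z hz => ?_⟩
    · rintro _ ⟨x, hx, rfl⟩
      exact h.2.mapsTo (hKV hx)
    · refine SuperMap.pullback_eq_zero (h.1.isOpen_target.sdiff hK.isClosed) h0
        ⟨h.1.mapsTo hz.1, fun hm => hz.2 ⟨_, hm, h.bodyMap_bodyMap hz.1⟩⟩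
  decay := (h.isSchwartzOn_pullback hf.smooth
    (hf.decay.isSchwartzOn h.1.isOpen_target hf.smooth)).rapidlyDecreasing h.1.isOpen_source
      (h.1.oddTangent.smooth_pullback hf.smooth)

end Pullback

end Growth

/-! ### Decaying forms, integrability, and vanishing integrals of derivatives. -/

section DecayingForms

open MeasureTheory Topology

variable {𝕜 : Type*} [RCLike 𝕜] {m n : ℕ} {U V : Set (Fin m → ℝ)}
  {f g : SFun 𝕜 (m + n) (n + m)}

theorem tangentDomain_univ : tangentDomain n (Set.univ : Set (Fin m → ℝ)) = Set.univ := rfl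

namespace IsDecayingForm

theorem isSchwartzOn (hU : IsOpen U) (hf : IsDecayingForm U f) : IsSchwartzOn U f :=
  hf.decay.isSchwartzOn hU hf.smooth

theorem mk_of_isSchwartzOn (hU : IsOpen U) (hs : SmoothOn f (tangentDomain n U))
    {K : Set (Fin m → ℝ)} (hKU : K ⊆ U) (hK : IsCompact K)
    (h0 : ∀ z, basePt z ∈ U \ K → f z = 0) (h : IsSchwartzOn U f) : IsDecayingForm U f :=
  ⟨hs, ⟨K, hKU, hK, h0⟩, h.rapidlyDecreasing hU hs⟩

theorem congr (hU : IsOpen U) (hf : IsDecayingForm U f) (h : Set.EqOn g f (tangentDomain n U)) :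
    IsDecayingForm U g := by
  obtain ⟨K, hKU, hK, h0⟩ := hf.support
  exact mk_of_isSchwartzOn hU (hf.smooth.congr h) hKU hK (fun z hz => (h hz.1).trans (h0 z hz))
    fun l s => (hf.isSchwartzOn hU l s).congr hU h

theorem evenDeriv (hU : IsOpen U) (hf : IsDecayingForm U f) (i : Fin (m + n)) :
    IsDecayingForm U (evenDeriv i f) := by
  obtain ⟨K, hKU, hK, h0⟩ := hf.support
  refine mk_of_isSchwartzOn hU (hf.smooth.evenDeriv (isOpen_tangentDomain hU) i) hKU hK
    (fun z hz => ?_) ((hf.isSchwartzOn hU).evenDeriv i)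
  rw [evenDeriv_congr (g := fun _ => 0) (isOpen_tangentDomain (hU.sdiff hK.isClosed)) h0 i hz,
    evenDeriv_const]

theorem linear (hU : IsOpen U) (hf : IsDecayingForm U f)
    (L : Grassmann 𝕜 (n + m) →ₗ[𝕜] Grassmann 𝕜 (n + m)) :
    IsDecayingForm U (fun z => L (f z)) := by
  obtain ⟨K, hKU, hK, h0⟩ := hf.support
  exact mk_of_isSchwartzOn hU (hf.smooth.linear L) hKU hK
    (fun z hz => by rw [h0 z hz, map_zero]) fun l s => (hf.isSchwartzOn hU l s).linear hU hf.smooth L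

theorem oddDeriv (hU : IsOpen U) (hf : IsDecayingForm U f) (j : Fin (n + m)) :
    IsDecayingForm U (oddDeriv j f) := hf.linear hU (leftDer j)

theorem add (hU : IsOpen U) (hf : IsDecayingForm U f) (hg : IsDecayingForm U g) :
    IsDecayingForm U (fun z => f z + g z) := by
  obtain ⟨K, hKU, hK, h0⟩ := hf.support
  obtain ⟨K', hKU', hK', h0'⟩ := hg.support
  refine mk_of_isSchwartzOn hU (hf.smooth.add hg.smooth) (Set.union_subset hKU hKU')
    (hK.union hK') (fun z hz => ?_) fun l s => (hf.isSchwartzOn hU l s).add hU hf.smooth hg.smooth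
      (hg.isSchwartzOn hU l s)
  rw [h0 z ⟨hz.1, fun h => hz.2 (Or.inl h)⟩, h0' z ⟨hz.1, fun h => hz.2 (Or.inr h)⟩, add_zero]

theorem zero (hU : IsOpen U) : IsDecayingForm U (fun _ => 0 : SFun 𝕜 (m + n) (n + m)) :=
  mk_of_isSchwartzOn hU (smoothOn_const 0) (Set.empty_subset U) isCompact_empty
    (fun _ _ => rfl) fun _ _ => HasGrowthUpTo.zero

theorem sum (hU : IsOpen U) {ι : Type*} {S : Finset ι} {F : ι → SFun 𝕜 (m + n) (n + m)}
    (h : ∀ i ∈ S, IsDecayingForm U (F i)) : IsDecayingForm U (fun z => ∑ i ∈ S, F i z) := by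
  classical
  induction S using Finset.induction_on with
  | empty => simpa using zero hU
  | insert a S ha ih =>
    simp only [Finset.sum_insert ha]
    exact (h a (Finset.mem_insert_self a S)).add hU
      (ih fun i hi => h i (Finset.mem_insert_of_mem hi))

theorem mul_left (hU : IsOpen U) (hs : SmoothOn g (tangentDomain n U))
    (hg : ∀ l, HasGrowthUpTo U 1 l g) (hf : IsDecayingForm U f) :
    IsDecayingForm U (fun z => g z * f z) := by
  obtain ⟨K, hKU, hK, h0⟩ := hf.support
  refine mk_of_isSchwartzOn hU (hs.mul hf.smooth) hKU hK
    (fun z hz => by rw [h0 z hz, mul_zero]) fun l s => ?_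
  have := (hg l).mul hU hs hf.smooth (hf.isSchwartzOn hU l (s - 1))
  simpa using this

theorem liftFun_mul (hU : IsOpen U) {w : SFun 𝕜 m n} (hw : SmoothOn w U)
    (hf : IsDecayingForm U f) : IsDecayingForm U (fun z => liftFun w z * f z) :=
  hf.mul_left hU (hw.liftFun hU) fun l => (hasGrowthUpTo_liftFun hU hw l).weaken zero_le_one

theorem fibrePt_smul (hU : IsOpen U) (hf : IsDecayingForm U f) (b : Fin n) :
    IsDecayingForm U (fun z => (fibrePt z b : 𝕜) • f z) := by
  have hs : SmoothOn (fun z : Fin (m + n) → ℝ =>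
      algebraMap 𝕜 (Grassmann 𝕜 (n + m)) (fibrePt z b : 𝕜)) (tangentDomain n U) :=
    SmoothOn.algebraMap (contDiff_fibrePt b).contDiffOn
  refine (hf.mul_left hU hs fun l => ?_).congr hU fun z _ => Algebra.smul_def _ _
  cases l with
  | zero => exact hasGrowth_fibrePt b
  | succ l =>
    refine ⟨hasGrowth_fibrePt b, fun i => Fin.addCases (fun k => ?_) (fun c => ?_) i⟩
    · exact HasGrowthUpTo.zero.congr hU fun z _ => evenDeriv_castAdd_fibrePt _ b
    · exact ((HasGrowthUpTo.const (if b = c then 1 else 0)).weaken zero_le_one).congr hU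
        fun z _ => evenDeriv_natAdd_fibrePt c b

theorem deRham (hU : IsOpen U) (hf : IsDecayingForm U f) : IsDecayingForm U (deRham f) :=
  (sum hU fun _ _ => (hf.evenDeriv hU _).linear hU (LinearMap.mulLeft 𝕜 _)).add hU
    (sum hU fun b _ => (hf.oddDeriv hU _).fibrePt_smul hU b)

/-- Extension by zero of a decaying form. -/
theorem extend (hU : IsOpen U) (hf : IsDecayingForm U f) :
    IsDecayingForm Set.univ (Set.indicator (tangentDomain n U) f) := by
  obtain ⟨K, hKU, hK, h0⟩ := hf.support
  have heq : Set.EqOn ((tangentDomain n U).indicator f) f (tangentDomain n U) :=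
    fun z hz => Set.indicator_of_mem hz f
  have hz0 : ∀ z, basePt z ∈ Set.univ \ K → (tangentDomain n U).indicator f z = 0 := fun z hz => by
    by_cases h : z ∈ tangentDomain n U
    · rw [heq h]
      exact h0 z ⟨h, hz.2⟩
    · exact Set.indicator_of_notMem h f
  refine mk_of_isSchwartzOn isOpen_univ (fun A => ?_) (Set.subset_univ K) hK hz0
    fun l s => ((hf.isSchwartzOn hU l s).congr hU heq).extend hK hKU isOpen_univ hz0
  rw [tangentDomain_univ, contDiffOn_univ, contDiff_iff_contDiffAt]
  intro z
  -- Over `K` the extension coincides near the point with `f`; off `K`, which is closed, it is zero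
  -- near the point.
  by_cases hz : basePt z ∈ K
  · exact (hf.smooth.congr heq).contDiffAt (isOpen_tangentDomain hU) (hKU hz) A
  · refine contDiffAt_const (c := (0 : 𝕜)) |>.congr_of_eventuallyEq ?_
    refine Filter.eventuallyEq_of_mem ((isOpen_tangentDomain (n := n)
      hK.isClosed.isOpen_compl).mem_nhds hz) fun y hy => ?_
    rw [hz0 y ⟨trivial, hy⟩, ← coeffₗ_apply, map_zero]

/-- Over the bounded support in x, decay of order `m + n + 1` in y dominates a power of 1 + |z|
whose exponent exceeds the dimension. -/
theorem integrable_coeff (hf : IsDecayingForm Set.univ f) (A : Finset (Fin (n + m))) :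
    Integrable (fun z => coeff A (f z)) := by
  obtain ⟨K, hKU, hK, h0⟩ := hf.support
  obtain ⟨C, hC, h⟩ := (hf.isSchwartzOn isOpen_univ 0 (-((m + n + 1 : ℕ) : ℤ))) K hKU hK
  obtain ⟨R, hR⟩ := hK.isBounded.exists_norm_le
  have hcont : Continuous fun z => coeff A (f z) := by
    have := (hf.smooth A).continuousOn
    rwa [tangentDomain_univ, continuousOn_univ] at this
  have hint := integrable_one_add_norm (E := Fin (m + n) → ℝ) (μ := volume)
    (r := ((m + n + 1 : ℕ) : ℝ)) (by simp)
  refine (hint.const_mul (C * (1 + max R 0) ^ (m + n + 1))).mono' hcont.aestronglyMeasurable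
    (Filter.Eventually.of_forall fun z => ?_)
  by_cases hz : basePt z ∈ K
  · refine (norm_coeff_le_coeffNorm A _).trans ((h z hz).trans ?_)
    rw [mul_assoc]
    refine mul_le_mul_of_nonneg_left ?_ hC
    rw [Real.rpow_neg (by positivity), Real.rpow_natCast, zpow_neg, zpow_natCast,
      ← div_eq_mul_inv, inv_eq_one_div, div_le_div_iff₀ (by positivity) (by positivity), one_mul,
      ← mul_pow]
    gcongr
    have h1 : ‖z‖ ≤ max R 0 + ‖fibrePt z‖ := by
      refine (pi_norm_le_iff_of_nonneg (by positivity)).2 fun i =>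
        Fin.addCases (fun k => ?_) (fun b => ?_) i
      · exact ((norm_le_pi_norm (basePt z) k).trans ((hR _ hz).trans (le_max_left R 0))).trans
          (by simp)
      · exact (norm_le_pi_norm (fibrePt z) b).trans (by simp)
    nlinarith [norm_nonneg (fibrePt z), le_max_right R 0]
  · rw [h0 z ⟨trivial, hz⟩, ← coeffₗ_apply, map_zero, norm_zero]
    positivity

theorem integrableOn_coeff (hU : IsOpen U) (hf : IsDecayingForm U f) (A : Finset (Fin (n + m))) :
    IntegrableOn (fun z => coeff A (f z)) (tangentDomain n U) := by
  refine ((hf.extend hU).integrable_coeff A).integrableOn.congr_fun (fun z hz => ?_)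
    (isOpen_tangentDomain hU).measurableSet
  beta_reduce
  rw [Set.indicator_of_mem hz]

/-- Integration by parts against the constant function 1. -/
theorem integral_coeff_evenDeriv_univ (hf : IsDecayingForm Set.univ f) (A : Finset (Fin (n + m)))
    (i : Fin (m + n)) : ∫ z, coeff A (SuperGeom.evenDeriv i f z) = 0 := by
  have h1 := hf.integrable_coeff A
  have h2 := (hf.evenDeriv isOpen_univ i).integrable_coeff A
  have := integral_bilinear_hasLineDerivAt_right_eq_neg_left_of_integrable (μ := volume)
    (f := fun _ : Fin (m + n) → ℝ => (1 : ℝ)) (f' := fun _ => 0) (g := fun z => coeff A (f z))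
    (g' := fun z => coeff A (SuperGeom.evenDeriv i f z)) (v := Pi.single i 1)
    (B := ContinuousLinearMap.lsmul ℝ ℝ) (by simp) (by simpa using h2) (by simpa using h1)
    (fun z _ => (hasFDerivAt_const (1 : ℝ) z).hasLineDerivAt _) (fun z _ => by
      rw [coeff_evenDeriv]
      exact (hf.smooth.differentiableAt isOpen_univ
        (Set.mem_univ z) A).hasFDerivAt.hasLineDerivAt _)
  simpa using this

theorem berezinIntegral_evenDeriv (hU : IsOpen U) (hf : IsDecayingForm U f) (i : Fin (m + n)) :
    berezinIntegral U (SuperGeom.evenDeriv i f) = 0 := by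
  have hT := isOpen_tangentDomain (n := n) hU
  rw [← (hf.extend hU).integral_coeff_evenDeriv_univ Finset.univ i, berezinIntegral]
  obtain ⟨K, hKU, hK, h0⟩ := hf.support
  have h1 : ∀ z, basePt z ∈ Kᶜ → (tangentDomain n U).indicator f z = 0 := fun z hz => by
    by_cases h : z ∈ tangentDomain n U
    · rw [Set.indicator_of_mem h]
      exact h0 z ⟨h, hz⟩
    · exact Set.indicator_of_notMem h f
  rw [← setIntegral_eq_integral_of_forall_compl_eq_zero (s := tangentDomain n U)
    (f := fun z => coeff Finset.univ (SuperGeom.evenDeriv i ((tangentDomain n U).indicator f) z))]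
  · refine setIntegral_congr_fun hT.measurableSet fun z hz => ?_
    rw [topCoeff, evenDeriv_congr hT (fun y hy => Set.indicator_of_mem hy f) i hz]
  · intro z hz
    rw [evenDeriv_congr (g := fun _ => 0) (isOpen_tangentDomain hK.isClosed.isOpen_compl) h1 i
      (fun h => hz (hKU h)), evenDeriv_const, ← coeffₗ_apply, map_zero]

theorem berezinIntegral_add (hU : IsOpen U) (hf : IsDecayingForm U f) (hg : IsDecayingForm U g) :
    berezinIntegral U (fun z => f z + g z) = berezinIntegral U f + berezinIntegral U g := by
  simp only [berezinIntegral, topCoeff]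
  rw [← integral_add
    (hf.integrableOn_coeff hU Finset.univ) (hg.integrableOn_coeff hU Finset.univ)]
  exact integral_congr_ae (Filter.Eventually.of_forall fun z => coeff_add _ _ _)

theorem berezinIntegral_sum (hU : IsOpen U) {ι : Type*} {S : Finset ι}
    {F : ι → SFun 𝕜 (m + n) (n + m)} (h : ∀ i ∈ S, IsDecayingForm U (F i)) :
    berezinIntegral U (fun z => ∑ i ∈ S, F i z) = ∑ i ∈ S, berezinIntegral U (F i) := by
  simp only [berezinIntegral, topCoeff]
  rw [← integral_finsetSum _ fun i hi => (h i hi).integrableOn_coeff hU Finset.univ]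
  exact integral_congr_ae (Filter.Eventually.of_forall fun z => coeff_sum _ _ _)

end IsDecayingForm

theorem berezinIntegral_congr (hU : IsOpen U) (h : Set.EqOn f g (tangentDomain n U)) :
    berezinIntegral U f = berezinIntegral U g :=
  setIntegral_congr_fun (isOpen_tangentDomain hU).measurableSet fun z hz => by
    rw [topCoeff, topCoeff, h hz]

/-- A left derivative in a generator contains no monomial with that generator, so not the top one.
-/
theorem topCoeff_oddDeriv (f : SFun 𝕜 (m + n) (n + m)) (j : Fin (n + m)) :
    topCoeff (oddDeriv j f) = 0 := funext fun _ => coeff_leftDer_of_mem (Finset.mem_univ j) _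

theorem berezinIntegral_oddDeriv (f : SFun 𝕜 (m + n) (n + m)) (j : Fin (n + m)) :
    berezinIntegral U (oddDeriv j f) = 0 := by
  rw [berezinIntegral, topCoeff_oddDeriv]
  simp

namespace IsDecayingForm

theorem berezinIntegral_liftFun_mul_evenDeriv (hU : IsOpen U) {w : SFun 𝕜 m n} (hw : SmoothOn w U)
    (hf : IsDecayingForm U f) (b : Fin n) :
    berezinIntegral U (fun z => liftFun w z * SuperGeom.evenDeriv (Fin.natAdd m b) f z) = 0 := by
  rw [← (hf.liftFun_mul hU hw).berezinIntegral_evenDeriv hU (Fin.natAdd m b)]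
  refine berezinIntegral_congr hU fun z hz => ?_
  rw [evenDeriv_mul (isOpen_tangentDomain hU) (hw.liftFun hU) hf.smooth hz,
    evenDeriv_natAdd_liftFun hU hw hz, zero_mul, zero_add]

theorem berezinIntegral_liftFun_mul_oddDeriv (w : SFun 𝕜 m n) (f : SFun 𝕜 (m + n) (n + m))
    (k : Fin m) :
    berezinIntegral U (fun z => liftFun w z * SuperGeom.oddDeriv (Fin.natAdd n k) f z) = 0 := by
  -- The lifted coefficient does not depend on ψ, so it can be moved under the odd derivative; this
  -- applies the involution to it, which is compensated beforehand.
  rw [← berezinIntegral_oddDeriv (U := U)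
    (fun z => liftFun (fun x => gradeInv (w x)) z * f z) (Fin.natAdd n k)]
  congr 1
  funext z
  rw [oddDeriv_apply, oddDeriv_apply, leftDer_mul, liftFun_apply, liftFun_apply,
    leftDer_natAdd_liftₐ, zero_mul, zero_add, gradeInv_liftₐ, gradeInv_gradeInv]

/-- The field d is divergence free: ψ^k does not depend on x nor y^β on ξ, so both summands are
total derivatives. -/
theorem berezinIntegral_deRham (hU : IsOpen U) (hf : IsDecayingForm U f) :
    berezinIntegral U (SuperGeom.deRham f) = 0 := by
  have h1 : ∀ k : Fin m, IsDecayingForm U (fun z => oddGen (Fin.natAdd n k) *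
      SuperGeom.evenDeriv (Fin.castAdd n k) f z) := fun k =>
    (hf.evenDeriv hU _).linear hU (LinearMap.mulLeft 𝕜 _)
  have h2 : ∀ b : Fin n, IsDecayingForm U (fun z => (fibrePt z b : 𝕜) •
      SuperGeom.oddDeriv (Fin.castAdd m b) f z) := fun b => (hf.oddDeriv hU _).fibrePt_smul hU b
  unfold SuperGeom.deRham
  rw [berezinIntegral_add hU (sum hU fun k _ => h1 k) (sum hU fun b _ => h2 b),
    berezinIntegral_sum hU fun k _ => h1 k, berezinIntegral_sum hU fun b _ => h2 b,
    Finset.sum_eq_zero, Finset.sum_eq_zero, add_zero]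
  · intro b _
    rw [← berezinIntegral_oddDeriv (U := U) (fun z => (fibrePt z b : 𝕜) • f z) (Fin.castAdd m b)]
    congr 1
    funext z
    rw [oddDeriv_apply, oddDeriv_apply, map_smul]
  · intro k _
    have := (hf.linear hU (LinearMap.mulLeft 𝕜 (oddGen (Fin.natAdd n k)))).berezinIntegral_evenDeriv
      hU (Fin.castAdd n k)
    rw [← this]
    exact berezinIntegral_congr hU fun z hz =>
      linear_evenDeriv (isOpen_tangentDomain hU) hf.smooth hz (LinearMap.mulLeft 𝕜 _) _

end IsDecayingForm

end DecayingForms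

/-! ### Odd derivatives integrate to zero in other coordinates. -/

section Invariance

open MeasureTheory Topology

variable {𝕜 : Type*} [RCLike 𝕜] {m n : ℕ} {U V : Set (Fin m → ℝ)}
  {f g : SFun 𝕜 (m + n) (n + m)} {φ χ : SuperMap 𝕜 m n m n} {σ : (Fin m → ℝ) → 𝕜}

/-- `σ` is locally constant over `U`. -/
def LocConstOn (σ : (Fin m → ℝ) → 𝕜) (U : Set (Fin m → ℝ)) : Prop :=
  ∀ x ∈ U, ∀ᶠ x' in 𝓝 x, σ x' = σ x

theorem LocConstOn.contDiffOn (hσ : LocConstOn σ U) : ContDiffOn ℝ ∞ σ U := fun x hx =>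
  (contDiffAt_const.congr_of_eventuallyEq (hσ x hx)).contDiffWithinAt

theorem LocConstOn.evenDeriv_smul (hσ : LocConstOn σ U) (hU : IsOpen U)
    (hf : SmoothOn f (tangentDomain n U)) {z : Fin (m + n) → ℝ} (hz : z ∈ tangentDomain n U)
    (i : Fin (m + n)) :
    evenDeriv i (fun z => σ (basePt z) • f z) z = σ (basePt z) • evenDeriv i f z := by
  rw [← evenDeriv_const_smul (isOpen_tangentDomain hU) hf hz]
  refine evenDeriv_congr_nhds ?_ i
  filter_upwards [continuous_basePt.continuousAt.eventually (hσ _ hz)] with y hy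
  rw [hy]

theorem liftFun_smul (σ : (Fin m → ℝ) → 𝕜) (w : SFun 𝕜 m n) (z : Fin (m + n) → ℝ) :
    liftFun (fun x => σ x • w x) z = σ (basePt z) • liftFun w z := by
  rw [liftFun_apply, map_smul, liftFun_apply]

theorem IsDecayingForm.locConst_smul (hU : IsOpen U) (hσ : LocConstOn σ U)
    (hf : IsDecayingForm U f) : IsDecayingForm U (fun z => σ (basePt z) • f z) := by
  refine (hf.liftFun_mul hU (SmoothOn.smul hσ.contDiffOn (smoothOn_const 1))).congr hU
    fun z _ => ?_
  beta_reduce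
  rw [liftFun_smul, smul_mul_assoc, liftFun_apply, map_one, one_mul]

namespace SuperMap.IsInverse

theorem berezinIntegral_add (h : φ.IsInverse χ U V) (hσ : LocConstOn σ U)
    (hf : IsDecayingForm V f) (hg : IsDecayingForm V g) :
    berezinIntegral U (fun z => σ (basePt z) • φ.oddTangent.pullback (fun y => f y + g y) z) =
      berezinIntegral U (fun z => σ (basePt z) • φ.oddTangent.pullback f z) +
        berezinIntegral U (fun z => σ (basePt z) • φ.oddTangent.pullback g z) := by
  have hU := h.1.isOpen_source
  rw [← IsDecayingForm.berezinIntegral_add hU ((h.isDecayingForm_pullback hf).locConst_smul hU hσ)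
    ((h.isDecayingForm_pullback hg).locConst_smul hU hσ)]
  refine berezinIntegral_congr hU fun z hz => ?_
  beta_reduce
  rw [h.1.oddTangent.pullback_add hz hf.smooth hg.smooth, smul_add]

theorem berezinIntegral_sum (h : φ.IsInverse χ U V) (hσ : LocConstOn σ U) {ι : Type*}
    {S : Finset ι} {F : ι → SFun 𝕜 (m + n) (n + m)} (hF : ∀ i ∈ S, IsDecayingForm V (F i)) :
    berezinIntegral U (fun z => σ (basePt z) • φ.oddTangent.pullback (fun y => ∑ i ∈ S, F i y) z) =
      ∑ i ∈ S, berezinIntegral U (fun z => σ (basePt z) • φ.oddTangent.pullback (F i) z) := by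
  have hU := h.1.isOpen_source
  rw [← IsDecayingForm.berezinIntegral_sum hU fun i hi =>
    (h.isDecayingForm_pullback (hF i hi)).locConst_smul hU hσ]
  refine berezinIntegral_congr hU fun z hz => ?_
  beta_reduce
  rw [h.1.oddTangent.pullback_sum hz fun i hi => (hF i hi).smooth, Finset.smul_sum]

/-- Derivatives along the fibres of the other trivialization have vanishing integral. -/
theorem berezinIntegral_vertical (h : φ.IsInverse χ U V) (hσ : LocConstOn σ U)
    (hf : IsDecayingForm U f) {u : Fin n → SFun 𝕜 m n} {v : Fin m → SFun 𝕜 m n}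
    (hu : ∀ b, SmoothOn (u b) V) (hv : ∀ k, SmoothOn (v k) V)
    (hg : Set.EqOn g (fun z =>
      ∑ b, liftFun (u b) z * χ.oddTangent.pullback (evenDeriv (Fin.natAdd m b) f) z +
      ∑ k, liftFun (v k) z * χ.oddTangent.pullback (oddDeriv (Fin.natAdd n k) f) z)
      (tangentDomain n V)) :
    berezinIntegral U (fun z => σ (basePt z) • φ.oddTangent.pullback g z) = 0 := by
  have hU := h.1.isOpen_source
  have hV := h.1.isOpen_target
  have hT := h.1.oddTangent
  have hS := hT.isOpen_source
  have hi := h.oddTangent (n := n)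
  have hse : ∀ b, SmoothOn (χ.oddTangent.pullback (evenDeriv (Fin.natAdd m b) f))
      (tangentDomain n V) := fun b => hi.2.smooth_pullback (hf.smooth.evenDeriv hS _)
  have hso : ∀ k, SmoothOn (χ.oddTangent.pullback (oddDeriv (Fin.natAdd n k) f))
      (tangentDomain n V) := fun k => hi.2.smooth_pullback (hf.smooth.oddDeriv _)
  have hwu : ∀ b, SmoothOn (fun x => σ x • φ.pullback (u b) x) U := fun b =>
    SmoothOn.smul hσ.contDiffOn (h.1.smooth_pullback (hu b))
  have hwv : ∀ k, SmoothOn (fun x => σ x • φ.pullback (v k) x) U := fun k =>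
    SmoothOn.smul hσ.contDiffOn (h.1.smooth_pullback (hv k))
  -- The coefficients pull back to functions of the base, and the locally constant sign is absorbed
  -- into them.
  have key : Set.EqOn (fun z => σ (basePt z) • φ.oddTangent.pullback g z) (fun z =>
      ∑ b, liftFun (fun x => σ x • φ.pullback (u b) x) z * evenDeriv (Fin.natAdd m b) f z +
      ∑ k, liftFun (fun x => σ x • φ.pullback (v k) x) z * oddDeriv (Fin.natAdd n k) f z)
      (tangentDomain n U) := fun z hz => by
    beta_reduce
    rw [hT.pullback_congr hz hg, hT.pullback_add hz
      (SmoothOn.sum fun b _ => ((hu b).liftFun hV).mul (hse b))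
      (SmoothOn.sum fun k _ => ((hv k).liftFun hV).mul (hso k)),
      hT.pullback_sum hz fun b _ => ((hu b).liftFun hV).mul (hse b),
      hT.pullback_sum hz fun k _ => ((hv k).liftFun hV).mul (hso k), smul_add, Finset.smul_sum,
      Finset.smul_sum]
    congr 1
    · refine Finset.sum_congr rfl fun b _ => ?_
      rw [hT.pullback_mul hz ((hu b).liftFun hV) (hse b), h.1.oddTangent_pullback_liftFun hz (hu b),
        hi.pullback_pullback hz (hf.smooth.evenDeriv hS _), liftFun_smul, smul_mul_assoc]
    · refine Finset.sum_congr rfl fun k _ => ?_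
      rw [hT.pullback_mul hz ((hv k).liftFun hV) (hso k), h.1.oddTangent_pullback_liftFun hz (hv k),
        hi.pullback_pullback hz (hf.smooth.oddDeriv _), liftFun_smul, smul_mul_assoc]
  have d1 := fun b => (hf.evenDeriv hU (Fin.natAdd m b)).liftFun_mul hU (hwu b)
  have d2 := fun k => (hf.oddDeriv hU (Fin.natAdd n k)).liftFun_mul hU (hwv k)
  rw [berezinIntegral_congr hU key, IsDecayingForm.berezinIntegral_add hU
    (IsDecayingForm.sum hU fun b _ => d1 b) (IsDecayingForm.sum hU fun k _ => d2 k),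
    IsDecayingForm.berezinIntegral_sum hU fun b _ => d1 b,
    IsDecayingForm.berezinIntegral_sum hU fun k _ => d2 k, Finset.sum_eq_zero, Finset.sum_eq_zero,
    add_zero]
  · exact fun k _ => IsDecayingForm.berezinIntegral_liftFun_mul_oddDeriv _ _ _
  · exact fun b _ => hf.berezinIntegral_liftFun_mul_evenDeriv hU (hwu b) b

/-- With `f` written as the pullback under `χ` of its own pullback, the chain rule expresses ∂/∂y^a
by fibre derivatives in the coordinates over `U`; the coefficients are the derivatives of the
components of `χ` in ξ^a. -/
theorem berezinIntegral_evenDeriv_natAdd (h : φ.IsInverse χ U V) (hσ : LocConstOn σ U)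
    (hf : IsDecayingForm V f) (a : Fin n) :
    berezinIntegral U (fun z => σ (basePt z) •
      φ.oddTangent.pullback (evenDeriv (Fin.natAdd m a) f) z) = 0 := by
  have hV := h.1.isOpen_target
  have hi := h.oddTangent (n := n)
  have hf' := h.isDecayingForm_pullback hf
  refine h.berezinIntegral_vertical hσ hf' (u := fun b => oddDeriv a (χ.odd b))
    (v := fun k => oddDeriv a (χ.even k)) (fun b => (h.2.smooth_odd b).oddDeriv a)
    (fun k => (h.2.smooth_even k).oddDeriv a) fun z hz => ?_
  rw [evenDeriv_congr (isOpen_tangentDomain hV)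
    (fun y hy => (hi.symm.pullback_pullback hy hf.smooth).symm) _ hz,
    hi.2.evenDeriv_pullback hz hf'.smooth, Fin.sum_univ_add, Fin.sum_univ_add]
  simp only [oddTangent_even_castAdd, oddTangent_even_natAdd, oddTangent_odd_castAdd,
    oddTangent_odd_natAdd, evenDeriv_natAdd_liftFun hV (h.2.smooth_even _) hz,
    evenDeriv_natAdd_liftFun hV (h.2.smooth_odd _) hz,
    evenDeriv_natAdd_dFun hV (h.2.smooth_even _) hz,
    evenDeriv_natAdd_dFun hV (h.2.smooth_odd _) hz, zero_mul, Finset.sum_const_zero, zero_add]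

/-- As for ∂/∂y^a; the coefficients are now the derivatives of the components of `χ` in x^k. -/
theorem berezinIntegral_oddDeriv_natAdd (h : φ.IsInverse χ U V) (hσ : LocConstOn σ U)
    (hf : IsDecayingForm V f) (k : Fin m) :
    berezinIntegral U (fun z => σ (basePt z) •
      φ.oddTangent.pullback (oddDeriv (Fin.natAdd n k) f) z) = 0 := by
  have hV := h.1.isOpen_target
  have hi := h.oddTangent (n := n)
  have hf' := h.isDecayingForm_pullback hf
  refine h.berezinIntegral_vertical hσ hf' (u := fun b => evenDeriv k (χ.odd b))
    (v := fun j => evenDeriv k (χ.even j)) (fun b => (h.2.smooth_odd b).evenDeriv hV k)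
    (fun j => (h.2.smooth_even j).evenDeriv hV k) fun z hz => ?_
  have : oddDeriv (Fin.natAdd n k) f z = oddDeriv (Fin.natAdd n k)
      (χ.oddTangent.pullback (φ.oddTangent.pullback f)) z := by
    rw [oddDeriv_apply, oddDeriv_apply, hi.symm.pullback_pullback hz hf.smooth]
  rw [this, hi.2.oddDeriv_pullback hz hf'.smooth, Fin.sum_univ_add, Fin.sum_univ_add]
  simp only [oddTangent_even_castAdd, oddTangent_even_natAdd, oddTangent_odd_castAdd,
    oddTangent_odd_natAdd, oddDeriv_natAdd_liftFun, oddDeriv_natAdd_dFun, zero_mul,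
    Finset.sum_const_zero, zero_add]

/-- The field d commutes with the pullback, and with the sign, which is locally constant; in its own
coordinates it integrates to zero. -/
theorem berezinIntegral_deRham (h : φ.IsInverse χ U V) (hσ : LocConstOn σ U)
    (hf : IsDecayingForm V f) :
    berezinIntegral U (fun z => σ (basePt z) • φ.oddTangent.pullback (deRham f) z) = 0 := by
  have hU := h.1.isOpen_source
  have hf' := h.isDecayingForm_pullback hf
  rw [← (hf'.locConst_smul hU hσ).berezinIntegral_deRham hU]
  refine berezinIntegral_congr hU fun z hz => ?_
  beta_reduce
  rw [h.1.oddTangent_pullback_deRham hz hf.smooth, deRham, deRham]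
  simp only [hσ.evenDeriv_smul hU hf'.smooth hz, oddDeriv_apply, map_smul, smul_add,
    Finset.smul_sum, mul_smul_comm, smul_comm (σ (basePt z))]

/-- A derivative along the base would not transform into base-independent terms directly. Instead
∂/∂ξ^a is the commutator of ∂/∂y^a and d, and both a y-derivative and a value of d integrate to
zero. -/
theorem berezinIntegral_oddDeriv_castAdd (h : φ.IsInverse χ U V) (hσ : LocConstOn σ U)
    (hf : IsDecayingForm V f) (a : Fin n) :
    berezinIntegral U (fun z => σ (basePt z) •
      φ.oddTangent.pullback (oddDeriv (Fin.castAdd m a) f) z) = 0 := by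
  have hV := h.1.isOpen_target
  have hS := isOpen_tangentDomain (n := n) hV
  have h1 : Set.EqOn (evenDeriv (Fin.natAdd m a) (deRham f))
      (fun z => oddDeriv (Fin.castAdd m a) f z + deRham (evenDeriv (Fin.natAdd m a) f) z)
      (tangentDomain n V) := fun z hz => by
    beta_reduce
    rw [deRham_eq f, evenDeriv_sum_add_sum hS hz (fun k => hf.smooth.evenDeriv hS _)
      (fun b => hf.smooth.oddDeriv _), deRham, Finset.sum_add_distrib]
    simp only [evenDeriv_natAdd_fibrePt, evenDeriv_oddDeriv hS hf.smooth hz,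
      evenDeriv_comm hS hf.smooth hz (Fin.natAdd m a)]
    simp only [ite_mul, one_mul, zero_mul, Finset.sum_ite_eq', Finset.mem_univ, if_true]
    abel
  have h2 := h.berezinIntegral_evenDeriv_natAdd hσ (hf.deRham hV) a
  have h3 := h.berezinIntegral_add hσ (hf.oddDeriv hV (Fin.castAdd m a))
    ((hf.evenDeriv hV (Fin.natAdd m a)).deRham hV)
  rw [h.berezinIntegral_deRham hσ (hf.evenDeriv hV (Fin.natAdd m a)), add_zero] at h3
  rw [← h3, ← h2]
  refine berezinIntegral_congr h.1.isOpen_source fun z hz => ?_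
  beta_reduce
  rw [h.1.oddTangent.pullback_congr hz h1]

theorem berezinIntegral_oddDeriv (h : φ.IsInverse χ U V) (hσ : LocConstOn σ U)
    (hf : IsDecayingForm V f) (j : Fin (n + m)) :
    berezinIntegral U (fun z => σ (basePt z) • φ.oddTangent.pullback (oddDeriv j f) z) = 0 :=
  Fin.addCases (fun a => h.berezinIntegral_oddDeriv_castAdd hσ hf a)
    (fun k => h.berezinIntegral_oddDeriv_natAdd hσ hf k) j

/-- Only the top coefficient of a form contributes to its integral in other coordinates. -/
theorem berezinIntegral_eq_top (h : φ.IsInverse χ U V) (hσ : LocConstOn σ U)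
    (hf : IsDecayingForm V f) :
    berezinIntegral U (fun z => σ (basePt z) • φ.oddTangent.pullback f z) =
      berezinIntegral U (fun z => σ (basePt z) • φ.oddTangent.pullback
        (fun y => topCoeff f y • monomialBasis 𝕜 (n + m) Finset.univ) z) := by
  have hV := h.1.isOpen_target
  let F : Finset (Fin (n + m)) → SFun 𝕜 (m + n) (n + m) := fun A y =>
    coeff A (f y) • monomialBasis 𝕜 (n + m) A
  have hF : ∀ A ∈ Finset.univ, IsDecayingForm V (F A) := fun A _ =>
    hf.linear hV ((coeffₗ A).smulRight (monomialBasis 𝕜 (n + m) A))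
  have h1 : f = fun y => ∑ A, F A y := funext fun y => (sum_coeff_smul (f y)).symm
  conv_lhs => rw [h1]
  rw [h.berezinIntegral_sum hσ hF, Finset.sum_eq_single Finset.univ]
  · rfl
  · intro A _ hA
    obtain ⟨j, hj⟩ : ∃ j, j ∉ A := by
      by_contra! h
      exact hA (Finset.eq_univ_of_forall h)
    -- A monomial without the generator `j` is the derivative in `j` of `oddGen j` times itself.
    have h2 := h.berezinIntegral_oddDeriv hσ ((hF A (Finset.mem_univ A)).linear hV
      (LinearMap.mulLeft 𝕜 (oddGen j))) j
    have h3 : oddDeriv j (fun z => LinearMap.mulLeft 𝕜 (oddGen j) (F A z)) = F A := by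
      funext z
      rw [oddDeriv_apply, LinearMap.mulLeft_apply, mul_smul_comm, map_smul,
        leftDer_oddGen_mul_monomialBasis hj]
    rwa [h3] at h2
  · exact fun h => (h (Finset.mem_univ _)).elim

end SuperMap.IsInverse

end Invariance

/-! ### The top coefficient of a transformed top monomial. -/

section TopCoefficient

variable {𝕜 : Type*} [RCLike 𝕜] {q : ℕ}

/-- The part of degree one. -/
def linearPart (w : Grassmann 𝕜 q) : Grassmann 𝕜 q :=
  ExteriorAlgebra.ι 𝕜 fun i => body (leftDer i w)

theorem sub_linearPart_mem_orderGE {w : Grassmann 𝕜 q} (h : body w = 0) :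
    w - linearPart w ∈ orderGE 2 := by
  rw [mem_orderGE_succ]
  refine ⟨?_, fun j => mem_orderGE_one.2 ?_⟩
  · rw [linearPart, ι_eq_sum, sub_eq_add_neg, ← neg_one_smul 𝕜, body_add, body_smul, body_sum, h]
    simp [body_smul, body_oddGen]
  · rw [map_sub, linearPart, ι_eq_sum, map_sum, sub_eq_add_neg, ← neg_one_smul 𝕜, body_add,
      body_smul, body_sum]
    simp only [map_smul, leftDer_oddGen, body_smul]
    rw [Finset.sum_eq_single j]
    · simp
    · intro b _ hb
      simp [hb.symm, ← bodyₐ_apply]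
    · simp

theorem body_linearPart (w : Grassmann 𝕜 q) : body (linearPart w) = 0 := by
  rw [linearPart, ι_eq_sum, body_sum]
  simp [body_smul, body_oddGen]

/-- Each factor without body agrees with its linear part up to order 2, so replacing one factor in a
product raises the order by one. -/
theorem prod_sub_prod_linearPart_mem_orderGE {l : List (Grassmann 𝕜 q)}
    (h : ∀ w ∈ l, body w = 0) : l.prod - (l.map linearPart).prod ∈ orderGE (l.length + 1) := by
  induction l with
  | nil => simp
  | cons a l ih =>
    have hl := fun w hw => h w (List.mem_cons_of_mem a hw)
    have ha := h a List.mem_cons_self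
    rw [List.prod_cons, List.map_cons, List.prod_cons, List.length_cons,
      show a * l.prod - linearPart a * (l.map linearPart).prod = (a - linearPart a) * l.prod +
        linearPart a * (l.prod - (l.map linearPart).prod) by noncomm_ring]
    refine Submodule.add_mem _ ?_ ?_
    · have := mul_mem_orderGE (sub_linearPart_mem_orderGE ha) (prod_mem_orderGE hl)
      rwa [add_comm 2] at this
    · have := mul_mem_orderGE (mem_orderGE_one.2 (body_linearPart a)) (ih hl)
      rwa [add_comm 1] at this

/-- The coefficient is an alternating form in the vectors and equals 1 on the standard basis. -/
theorem coeff_univ_prod_ι (v : Fin q → Fin q → 𝕜) :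
    coeff Finset.univ (List.ofFn fun j => ExteriorAlgebra.ι 𝕜 (v j)).prod = (Matrix.of v).det := by
  let F : (Fin q → 𝕜) [⋀^Fin q]→ₗ[𝕜] 𝕜 :=
    (coeffₗ Finset.univ).compAlternatingMap (ExteriorAlgebra.ιMulti 𝕜 q)
  have h1 := F.eq_smul_basis_det (Pi.basisFun 𝕜 (Fin q))
  have h2 : F (Pi.basisFun 𝕜 (Fin q)) = 1 := by
    change coeff Finset.univ (List.ofFn fun j => ExteriorAlgebra.ι 𝕜 (Pi.basisFun 𝕜 (Fin q) j)).prod = 1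
    have := coeff_monomialBasis (𝕜 := 𝕜) (Finset.univ : Finset (Fin q)) Finset.univ
    rw [monomialBasis_eq_prod, Fin.sort_univ, ← List.ofFn_eq_map, if_pos rfl] at this
    simp only [Pi.basisFun_apply]
    exact this
  rw [h2, one_smul] at h1
  have h3 := congrArg (fun G => G v) h1
  beta_reduce at h3
  rw [Pi.basisFun_det_apply] at h3
  exact h3

/-- In a product of `q` elements without body only the linear parts survive, the error having order
above `q`. The transpose arises because the linear part of the `j`-th component is a row for the
determinant of vectors and a column of the Jacobian. -/
theorem SuperMap.coeff_univ_oddMonomial {p : ℕ} (φ : SuperMap 𝕜 p q p q) {z : Fin p → ℝ}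
    (h : ∀ j, body (φ.odd j z) = 0) :
    coeff Finset.univ (φ.oddMonomial Finset.univ z) =
      (Matrix.of fun i j => body (oddDeriv i (φ.odd j) z)).det := by
  have h1 : φ.oddMonomial Finset.univ z = (List.ofFn fun j => φ.odd j z).prod := by
    rw [oddMonomial, Fin.sort_univ, ← List.ofFn_eq_map]
  have h2 := prod_sub_prod_linearPart_mem_orderGE (l := List.ofFn fun j => φ.odd j z) (by
    intro w hw
    obtain ⟨j, rfl⟩ := List.mem_ofFn.1 hw
    exact h j)
  rw [List.length_ofFn] at h2
  rw [h1, sub_eq_zero.1 (eq_zero_of_mem_orderGE (Nat.lt_succ_self q) h2), List.map_ofFn,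
    ← Matrix.det_transpose]
  exact coeff_univ_prod_ι _

/-- The product of all odd components already has order `q`, so it annihilates the nilpotent
corrections in the Taylor expansion of `c`. -/
theorem SuperMap.IsMorphism.pullback_smul_top {p : ℕ} {φ : SuperMap 𝕜 p q p q}
    {U V : Set (Fin p → ℝ)} (hφ : φ.IsMorphism U V) {z : Fin p → ℝ} (hz : z ∈ U)
    {c : (Fin p → ℝ) → 𝕜} (hc : ContDiffOn ℝ ∞ c V) :
    φ.pullback (fun y => c y • monomialBasis 𝕜 q Finset.univ) z =
      c (φ.bodyMap z) • φ.oddMonomial Finset.univ z := by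
  have hs : SmoothOn (fun y => algebraMap 𝕜 (Grassmann 𝕜 q) (c y)) V := SmoothOn.algebraMap hc
  have h1 := hφ.pullback_mul hz hs (smoothOn_const (monomialBasis 𝕜 q Finset.univ))
  simp only [← Algebra.smul_def] at h1
  rw [h1, hφ.pullback_const hz, oddSubst_monomialBasis, Algebra.smul_def, ← sub_eq_zero, ← sub_mul]
  refine eq_zero_of_mem_orderGE (k := 1 + (Finset.univ.sort (· ≤ ·) : List (Fin q)).length)
    (by simp) (mul_mem_orderGE (mem_orderGE_one.2 ?_) ?_)
  · rw [← bodyₐ_apply, map_sub, bodyₐ_apply, bodyₐ_apply, hφ.body_pullback hz hs, body_algebraMap,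
      sub_self]
  · have := prod_mem_orderGE (l := (Finset.univ.sort (· ≤ ·)).map fun j => φ.odd j z) (by
      intro w hw
      obtain ⟨j, _, rfl⟩ := List.mem_map.1 hw
      exact body_eq_zero_of_odd (hφ.gradeInv_odd hz j))
    rwa [List.length_map] at this

end TopCoefficient

/-! ### Ordinary change of variables for the top coefficient. -/

section ChangeOfVariables

open MeasureTheory Topology Matrix

variable {𝕜 : Type*} [RCLike 𝕜] {m n p q : ℕ} {U V : Set (Fin m → ℝ)}
  {f : SFun 𝕜 (m + n) (n + m)} {φ χ : SuperMap 𝕜 m n m n}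

namespace SuperMap

/-- The Jacobian matrix of the underlying map; rows are indexed by the old variables. -/
def bodyJacobian (φ : SuperMap 𝕜 p q p q) (x : Fin p → ℝ) : Matrix (Fin p) (Fin p) ℝ :=
  Matrix.of fun i j => RCLike.re (body (evenDeriv i (φ.even j) x))

theorem IsMorphism.hasFDerivAt_bodyMap {φ : SuperMap 𝕜 p q p q} {U V : Set (Fin p → ℝ)}
    (hφ : φ.IsMorphism U V) {x : Fin p → ℝ} (hx : x ∈ U) :
    HasFDerivAt φ.bodyMap (LinearMap.toContinuousLinearMap (Matrix.toLin' (φ.bodyJacobian x)ᵀ)) x := by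
  refine hasFDerivAt_pi'.2 fun j => ?_
  have h1 := (hφ.smooth_even j).differentiableAt hφ.isOpen_source hx ∅
  have h2 := (RCLike.reCLM (K := 𝕜)).hasFDerivAt.comp x h1.hasFDerivAt
  have h3 : (fun x => φ.bodyMap x j) =
      (RCLike.reCLM : 𝕜 →L[ℝ] ℝ) ∘ fun x => coeff ∅ (φ.even j x) := by
    funext y
    simp [bodyMap, coeff_empty]
  rw [h3]
  convert h2 using 1
  refine ContinuousLinearMap.coe_injective ((Pi.basisFun ℝ (Fin p)).ext fun i => ?_)
  simp [Matrix.toLin'_apply, bodyJacobian, ← coeff_empty, coeff_evenDeriv]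

/-- X does not depend on y and ∂Y/∂y = ∂Ξ/∂ξ, so the Jacobian of (x, y) ↦ (X, Y) is block
triangular. -/
theorem IsMorphism.det_bodyJacobian_oddTangent (hφ : φ.IsMorphism U V) {z : Fin (m + n) → ℝ}
    (hz : z ∈ tangentDomain n U) :
    (φ.oddTangent.bodyJacobian z).det = φ.orientationDet (basePt z) := by
  have hU := hφ.isOpen_source
  rw [← Matrix.det_submatrix_equiv_self finSumFinEquiv, orientationDet,
    ← Matrix.det_fromBlocks_zero₂₁ (A := Matrix.of fun i j =>
      RCLike.re (body (evenDeriv i (φ.even j) (basePt z))))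
      (B := Matrix.of fun i j => RCLike.re (body (evenDeriv (Fin.castAdd n i) (dFun (φ.odd j)) z)))]
  congr 1
  ext (i | i) (j | j) <;>
    simp [bodyJacobian, evenDeriv_castAdd_liftFun hU (hφ.smooth_even _) hz,
      evenDeriv_natAdd_liftFun hU (hφ.smooth_even _) hz,
      evenDeriv_natAdd_dFun hU (hφ.smooth_odd _) hz, liftFun_apply, body_liftₐ, body_zero]

/-- The same two diagonal blocks occur in exchanged order, since ∂Ψ/∂ψ = ∂X/∂x. The odd and the even
determinant of Φ thus coincide, which is why no density is needed. -/
theorem IsMorphism.det_oddDeriv_oddTangent (hφ : φ.IsMorphism U V) {z : Fin (m + n) → ℝ}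
    (hz : z ∈ tangentDomain n U) :
    (Matrix.of fun i j => body (oddDeriv i (φ.oddTangent.odd j) z)).det =
      (φ.orientationDet (basePt z) : 𝕜) := by
  rw [hφ.ofReal_orientationDet hz, mul_comm, ← Matrix.det_submatrix_equiv_self finSumFinEquiv,
    ← Matrix.det_fromBlocks_zero₂₁ (A := Matrix.of fun i j =>
      body (oddDeriv i (φ.odd j) (basePt z)))
      (B := Matrix.of fun i j => body (oddDeriv (Fin.castAdd m i) (dFun (φ.even j)) z))]
  congr 1
  ext (i | i) (j | j) <;>
    simp [oddDeriv_castAdd_liftFun, oddDeriv_natAdd_liftFun, oddDeriv_natAdd_dFun, liftFun_apply,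
      body_liftₐ, body_zero]

theorem IsMorphism.continuousOn_orientationDet {φ : SuperMap 𝕜 p q p q} {U V : Set (Fin p → ℝ)}
    (hφ : φ.IsMorphism U V) : ContinuousOn φ.orientationDet U := by
  have hU := hφ.isOpen_source
  have hdet : ∀ {k : ℕ} {M : (Fin p → ℝ) → Matrix (Fin k) (Fin k) ℝ}, ContinuousOn M U →
      ContinuousOn (fun x => (M x).det) U := fun hM =>
    (continuous_id.matrix_det).comp_continuousOn hM
  refine ContinuousOn.mul (hdet ?_) (hdet ?_)
  · exact continuousOn_pi.2 fun i => continuousOn_pi.2 fun j =>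
      RCLike.continuous_re.comp_continuousOn
        ((hφ.smooth_even j).evenDeriv hU i).body.continuousOn
  · exact continuousOn_pi.2 fun i => continuousOn_pi.2 fun j =>
      RCLike.continuous_re.comp_continuousOn ((hφ.smooth_odd j).oddDeriv i).body.continuousOn

theorem IsInverse.locConstOn_sign_orientationDet (h : φ.IsInverse χ U V) :
    LocConstOn (fun x => ((Real.sign (φ.orientationDet x) : ℝ) : 𝕜)) U := fun x hx => by
  have hc := h.1.continuousOn_orientationDet.continuousAt (h.1.isOpen_source.mem_nhds hx)
  rcases lt_or_gt_of_ne (h.orientationDet_ne_zero hx) with h0 | h0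
  · filter_upwards [hc.eventually (gt_mem_nhds h0)] with y hy
    rw [Real.sign_of_neg hy, Real.sign_of_neg h0]
  · filter_upwards [hc.eventually (lt_mem_nhds h0)] with y hy
    rw [Real.sign_of_pos hy, Real.sign_of_pos h0]

theorem IsInverse.image_bodyMap {φ χ : SuperMap 𝕜 p q p q} {U V : Set (Fin p → ℝ)}
    (h : φ.IsInverse χ U V) : φ.bodyMap '' U = V := by
  refine Set.Subset.antisymm h.1.mapsTo.image_subset fun y hy =>
    ⟨χ.bodyMap y, h.2.mapsTo hy, h.symm.bodyMap_bodyMap hy⟩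

/-- The integral is invariant under coordinate changes up to the orientation sign. -/
theorem IsInverse.berezinIntegral_pullback (h : φ.IsInverse χ U V) (hf : IsDecayingForm V f) :
    berezinIntegral U (fun z => ((Real.sign (φ.orientationDet (basePt z)) : ℝ) : 𝕜) •
      φ.oddTangent.pullback f z) = berezinIntegral V f := by
  have hT := h.1.oddTangent (n := n)
  have hi := h.oddTangent (n := n)
  rw [h.berezinIntegral_eq_top h.locConstOn_sign_orientationDet hf, berezinIntegral,
    berezinIntegral, ← hi.image_bodyMap,
    integral_image_eq_integral_abs_det_fderiv_smul volume hT.isOpen_source.measurableSet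
      (fun z hz => (hT.hasFDerivAt_bodyMap hz).hasFDerivWithinAt)
      (fun x hx y hy hxy => by rw [← hi.bodyMap_bodyMap hx, hxy, hi.bodyMap_bodyMap hy])]
  refine setIntegral_congr_fun hT.isOpen_source.measurableSet fun z hz => ?_
  beta_reduce
  rw [topCoeff, hT.pullback_smul_top hz (c := topCoeff f) (hf.smooth Finset.univ), coeff_smul, coeff_smul,
    φ.oddTangent.coeff_univ_oddMonomial fun j => body_eq_zero_of_odd (hT.gradeInv_odd hz j),
    h.1.det_oddDeriv_oddTangent hz, ContinuousLinearMap.det, LinearMap.coe_toContinuousLinearMap,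
    LinearMap.det_toLin', Matrix.det_transpose, h.1.det_bodyJacobian_oddTangent hz,
    RCLike.real_smul_eq_coe_mul]
  have h0 := h.orientationDet_ne_zero (x := basePt z) hz
  -- The change of variables contributes the absolute value of this determinant, the top monomial
  -- the determinant itself; `σ` makes up the difference.
  have : |φ.orientationDet (basePt z)| =
      Real.sign (φ.orientationDet (basePt z)) * φ.orientationDet (basePt z) := by
    rcases lt_or_gt_of_ne h0 with h1 | h1
    · rw [Real.sign_of_neg h1, abs_of_neg h1]; ring
    · rw [Real.sign_of_pos h1, abs_of_pos h1]; ring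
  rw [this]
  push_cast
  ring

end SuperMap

end ChangeOfVariables

/-! ### Restriction to smaller domains and smooth cutoffs. -/

section Restriction

open MeasureTheory Topology

variable {𝕜 : Type*} [RCLike 𝕜] {m n : ℕ} {U V K : Set (Fin m → ℝ)}
  {f : SFun 𝕜 (m + n) (n + m)}

theorem IsDecayingForm.restrict (hf : IsDecayingForm U f) (hVU : V ⊆ U) (hKV : K ⊆ V)
    (hK : IsCompact K) (h0 : ∀ z, basePt z ∈ U \ K → f z = 0) : IsDecayingForm V f where
  smooth := hf.smooth.mono fun _ hz => hVU hz
  support := ⟨K, hKV, hK, fun z hz => h0 z ⟨hVU hz.1, hz.2⟩⟩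
  decay := fun L hL => hf.decay L (hL.trans hVU)

theorem berezinIntegral_eq_of_subset (hU : IsOpen U) (hVU : V ⊆ U) (hKV : K ⊆ V)
    (h0 : ∀ z, basePt z ∈ U \ K → f z = 0) : berezinIntegral U f = berezinIntegral V f :=
  setIntegral_eq_of_subset_of_forall_sdiff_eq_zero (isOpen_tangentDomain hU).measurableSet
    (fun _ hz => hVU hz) fun z hz => by
      rw [topCoeff, h0 z ⟨hz.1, fun h => hz.2 (hKV h)⟩, ← coeffₗ_apply, map_zero]

theorem exists_smooth_cutoff (hK : IsCompact K) (hU : IsOpen U) (hKU : K ⊆ U) :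
    ∃ (ρ : (Fin m → ℝ) → ℝ) (W L : Set (Fin m → ℝ)), ContDiff ℝ ∞ ρ ∧ IsOpen W ∧ K ⊆ W ∧
      W ⊆ U ∧ IsCompact L ∧ L ⊆ U ∧ (∀ x ∈ W, ρ x = 1) ∧ ∀ x ∉ L, ρ x = 0 := by
  obtain ⟨L, hL, hKL, hLU⟩ := exists_compact_between hK hU hKU
  obtain ⟨ρ, h1, h0, -⟩ := exists_contMDiffMap_one_nhds_of_subset_interior (n := (⊤ : ℕ∞))
    (modelWithCornersSelf ℝ (Fin m → ℝ)) hK.isClosed hKL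
  obtain ⟨W, hW, hKW, hW1⟩ := mem_nhdsSet_iff_exists.1 h1
  exact ⟨ρ, W ∩ U, L, ρ.contMDiff.contDiff, hW.inter hU, Set.subset_inter hKW hKU,
    Set.inter_subset_right, hL, hLU, fun x hx => hW1 hx.1, h0⟩

end Restriction

/-! ### Forms on a supermanifold: multiplication by superfunctions, change of chart, cutoffs. -/

namespace Supermanifold

open MeasureTheory Topology

variable {𝕜 : Type*} [RCLike 𝕜] {m n : ℕ} {M : Type*} [TopologicalSpace M] {I : Type*}
  (S : Supermanifold 𝕜 m n M I) {a b c : I} {f g : I → SFun 𝕜 (m + n) (n + m)}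

/-- The part of the chart `a` that lies in the domain of the chart `b`. -/
def overlap (a b : I) : Set (Fin m → ℝ) := (S.chart a).target ∩ (S.chart a).symm ⁻¹' (S.chart b).source

theorem isOpen_overlap (a b : I) : IsOpen (S.overlap a b) := (S.trans_morphism a b).isOpen_source

/-- The cocycle condition for the charts `a`, `b`, `a`. -/
theorem isInverse_trans (a b : I) :
    (S.trans a b).IsInverse (S.trans b a) (S.overlap a b) (S.overlap b a) := by
  have key : ∀ a b, ((S.trans b a).comp (S.trans a b)).EqOver (SuperMap.id 𝕜 m n)
      (S.overlap a b) := fun a b => by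
    have h1 := S.trans_comp a b a
    have h2 := S.trans_self a
    have hs : ∀ x ∈ S.overlap a b, x ∈ (S.chart a).target ∩
        (S.chart a).symm ⁻¹' ((S.chart b).source ∩ (S.chart a).source) := fun x hx =>
      ⟨hx.1, hx.2, (S.chart a).map_target hx.1⟩
    exact ⟨fun i x hx => (h1.1 i (hs x hx)).trans (h2.1 i hx.1),
      fun j x hx => (h1.2 j (hs x hx)).trans (h2.2 j hx.1)⟩
  exact ⟨S.trans_morphism a b, S.trans_morphism b a, key a b, key b a⟩

theorem symm_bodyMap_trans {x : Fin m → ℝ} (hx : x ∈ S.overlap a b) :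
    (S.chart b).symm ((S.trans a b).bodyMap x) = (S.chart a).symm x := by
  rw [S.trans_body a b x hx, (S.chart b).left_inv hx.2]

/-- A superfunction on `S`, given by its coordinate expressions. -/
structure IsSuperfunction (r : I → SFun 𝕜 m n) : Prop where
  smooth : ∀ a, SmoothOn (r a) (S.chart a).target
  compat : ∀ a b, Set.EqOn (r a) ((S.trans a b).pullback (r b)) (S.overlap a b)

variable {S}

theorem IsSuperfunction.one_sub {r : I → SFun 𝕜 m n} (hr : S.IsSuperfunction r) :
    S.IsSuperfunction fun a x => 1 - r a x where
  smooth a := (smoothOn_const 1).sub (hr.smooth a)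
  compat a b x hx := by
    have hs := (hr.smooth b).mono (show S.overlap b a ⊆ _ from Set.inter_subset_left)
    have h1 := (S.trans_morphism a b).pullback_add hx (smoothOn_const 1)
      (SmoothOn.smul (contDiffOn_const (c := (-1 : 𝕜))) hs)
    simp only [neg_one_smul, ← sub_eq_add_neg] at h1
    beta_reduce
    rw [h1, (S.trans_morphism a b).pullback_const hx, SuperMap.oddSubst_one, sub_eq_add_neg,
      hr.compat a b hx]
    congr 1
    have h2 := (S.trans_morphism a b).pullback_const_smul hx hs (-1)
    simp only [neg_one_smul] at h2
    exact h2.symm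

theorem isSuperfunction_const (c : 𝕜) :
    S.IsSuperfunction fun _ _ => algebraMap 𝕜 (Grassmann 𝕜 n) c where
  smooth _ := smoothOn_const _
  compat a b x hx := by
    rw [(S.trans_morphism a b).pullback_const hx, Algebra.algebraMap_eq_smul_one, map_smul,
      SuperMap.oddSubst_one]

theorem IsDecayingForm.mul {r : I → SFun 𝕜 m n} (hr : S.IsSuperfunction r)
    (hf : S.IsDecayingForm f) : S.IsDecayingForm fun a z => liftFun (r a) z * f a z where
  isForm :=
    { smooth := fun a => ((hr.smooth a).liftFun (S.chart a).open_target).mul (hf.isForm.smooth a)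
      compat := fun a b z hz => by
        have hV := S.isOpen_overlap b a
        have hs := (hr.smooth b).mono (show S.overlap b a ⊆ _ from Set.inter_subset_left)
        have hsf := (hf.isForm.smooth b).mono (show tangentDomain n (S.overlap b a) ⊆ _ from
          fun _ hz => hz.1)
        have hm := S.trans_morphism a b
        beta_reduce
        rw [hm.oddTangent.pullback_mul hz (hs.liftFun hV) hsf, hm.oddTangent_pullback_liftFun hz hs,
          ← hf.isForm.compat a b hz, liftFun_apply, liftFun_apply, ← hr.compat a b hz] }
  support := by
    obtain ⟨K, hK, h0⟩ := hf.support
    exact ⟨K, hK, fun a z hz h => by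
      beta_reduce
      rw [h0 a z hz h, mul_zero]⟩
  decay a := by
    have hO := (S.chart a).open_target
    have h1 := (hf.decay a).isSchwartzOn hO (hf.isForm.smooth a)
    refine IsSchwartzOn.rapidlyDecreasing hO (((hr.smooth a).liftFun hO).mul (hf.isForm.smooth a))
      fun l s => ?_
    have := (hasGrowthUpTo_liftFun hO (hr.smooth a) l).mul hO ((hr.smooth a).liftFun hO)
      (hf.isForm.smooth a) (h1 l s)
    rwa [zero_add] at this

theorem VanishesOff.mul_left {K : Set M} (h : S.VanishesOff f K) (r : I → SFun 𝕜 m n) :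
    S.VanishesOff (fun a z => liftFun (r a) z * f a z) K := fun a z hz hK => by
  beta_reduce
  rw [h a z hz hK, mul_zero]

theorem VanishesOff.image_chart {K : Set M} (h : S.VanishesOff f K) (a : I)
    (z : Fin (m + n) → ℝ) (hz : basePt z ∈ (S.chart a).target \ (S.chart a) '' K) : f a z = 0 :=
  h a z hz.1 fun hm => hz.2 ⟨_, hm, (S.chart a).right_inv hz.1⟩

theorem image_chart_subset_overlap {K : Set M} (ha : K ⊆ (S.chart a).source)
    (hb : K ⊆ (S.chart b).source) : S.chart a '' K ⊆ S.overlap a b := by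
  rintro _ ⟨P, hP, rfl⟩
  refine ⟨(S.chart a).map_source (ha hP), ?_⟩
  rw [Set.mem_preimage, (S.chart a).left_inv (ha hP)]
  exact hb hP

theorem IsDecayingForm.chart {K : Set M} (hf : S.IsDecayingForm f) (hK : IsCompact K)
    (ha : K ⊆ (S.chart a).source) (h0 : S.VanishesOff f K) :
    SuperGeom.IsDecayingForm (S.chart a).target (f a) where
  smooth := hf.isForm.smooth a
  support := ⟨S.chart a '' K, (image_chart_subset_overlap ha ha).trans Set.inter_subset_left,
    hK.image_of_continuousOn ((S.chart a).continuousOn.mono ha), h0.image_chart a⟩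
  decay := hf.decay a

/-- The integral of a form supported in the domains of two charts is the same in both. -/
theorem IsDecayingForm.berezinIntegral_eq {K : Set M} (hS : S.IsOriented)
    (hf : S.IsDecayingForm f) (hK : IsCompact K) (ha : K ⊆ (S.chart a).source)
    (hb : K ⊆ (S.chart b).source) (h0 : S.VanishesOff f K) :
    berezinIntegral (S.chart a).target (f a) = berezinIntegral (S.chart b).target (f b) := by
  have hra := berezinIntegral_eq_of_subset (f := f a) (S.chart a).open_target
    (show S.overlap a b ⊆ _ from Set.inter_subset_left) (image_chart_subset_overlap ha hb)
    (h0.image_chart a)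
  have hrb := berezinIntegral_eq_of_subset (f := f b) (S.chart b).open_target
    (show S.overlap b a ⊆ _ from Set.inter_subset_left) (image_chart_subset_overlap hb ha)
    (h0.image_chart b)
  have hd := (hf.chart hK hb h0).restrict (V := S.overlap b a) Set.inter_subset_left
    (image_chart_subset_overlap hb ha)
    (hK.image_of_continuousOn ((S.chart b).continuousOn.mono hb)) (h0.image_chart b)
  rw [hra, hrb, ← (S.isInverse_trans a b).berezinIntegral_pullback hd]
  refine berezinIntegral_congr (S.isOpen_overlap a b) fun z hz => ?_
  beta_reduce
  rw [hf.isForm.compat a b hz, Real.sign_of_pos (hS a b _ hz), RCLike.ofReal_one, one_smul]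

/-- A superfunction that is one near a given compact set in the domain of a chart and has compact
support there. -/
theorem exists_cutoff [T2Space M] {K : Set M} (hK : IsCompact K) (ha : K ⊆ (S.chart a).source) :
    ∃ (r : I → SFun 𝕜 m n) (W L : Set M), S.IsSuperfunction r ∧ IsOpen W ∧ K ⊆ W ∧ IsCompact L ∧
      L ⊆ (S.chart a).source ∧
      (∀ b, ∀ x ∈ (S.chart b).target, (S.chart b).symm x ∈ W → r b x = 1) ∧
      (∀ b, ∀ x ∈ (S.chart b).target, (S.chart b).symm x ∉ L → r b x = 0) := by
  classical
  obtain ⟨ρ, W, L, hρ, hW, hKW, hWU, hL, hLU, h1, h0⟩ := exists_smooth_cutoff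
    (hK.image_of_continuousOn ((S.chart a).continuousOn.mono ha)) (S.chart a).open_target
    ((image_chart_subset_overlap ha ha).trans Set.inter_subset_left)
  let ρ' : SFun 𝕜 m n := fun x => algebraMap 𝕜 (Grassmann 𝕜 n) (ρ x : 𝕜)
  have hρ' : ∀ O, SmoothOn ρ' O := fun O => SmoothOn.algebraMap
    ((RCLike.ofRealCLM (K := 𝕜)).contDiff.comp hρ).contDiffOn
  -- The bump function is pulled back as a superfunction, so in other charts it may acquire a
  -- nilpotent part. Extension by zero is smooth because `L'` is compact, hence closed in the
  -- Hausdorff space `M`: each chart is covered by its overlap with `a` and the complement of `L'`.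
  let r : I → SFun 𝕜 m n := fun b x => if x ∈ S.overlap b a then (S.trans b a).pullback ρ' x else 0
  let L' : Set M := (S.chart a).symm '' L
  have hL' : IsCompact L' := hL.image_of_continuousOn ((S.chart a).continuousOn_symm.mono hLU)
  have hr : ∀ b, Set.EqOn (r b) ((S.trans b a).pullback ρ') (S.overlap b a) :=
    fun b x hx => if_pos hx
  have hzero : ∀ b, ∀ x ∈ (S.chart b).target, (S.chart b).symm x ∉ L' → r b x = 0 := by
    intro b x hx hn
    by_cases hxa : x ∈ S.overlap b a
    · rw [hr b hxa]
      have hm := S.trans_morphism b a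
      have hn' : (S.trans b a).bodyMap x ∉ L := fun hm' =>
        hn ⟨_, hm', S.symm_bodyMap_trans hxa⟩
      rw [SuperMap.pullback_congr_nhds (g := fun _ => 0) (Filter.eventuallyEq_of_mem
        (hL.isClosed.isOpen_compl.mem_nhds hn') fun y hy => by simp [ρ', h0 y hy]),
        hm.pullback_const hxa, map_zero]
    · exact if_neg hxa
  have hO : ∀ b, IsOpen ((S.chart b).target ∩ (S.chart b).symm ⁻¹' L'ᶜ) := fun b =>
    (S.chart b).isOpen_inter_preimage_symm hL'.isClosed.isOpen_compl
  have hL'a : L' ⊆ (S.chart a).source := by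
    rintro _ ⟨y, hy, rfl⟩
    exact (S.chart a).map_target (hLU hy)
  refine ⟨r, (S.chart a).source ∩ S.chart a ⁻¹' W, L', ⟨fun b => ?_, fun b c x hx => ?_⟩,
    (S.chart a).isOpen_inter_preimage hW, fun P hP => ⟨ha hP, hKW ⟨P, hP, rfl⟩⟩, hL', hL'a, ?_,
    hzero⟩
  · intro A x hx
    refine ContDiffAt.contDiffWithinAt ?_
    by_cases hxa : x ∈ S.overlap b a
    · exact (((S.trans_morphism b a).smooth_pullback (hρ' _)).congr (hr b)).contDiffAt
        (S.isOpen_overlap b a) hxa A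
    · have hx' : x ∈ (S.chart b).target ∩ (S.chart b).symm ⁻¹' L'ᶜ :=
        ⟨hx, fun h => hxa ⟨hx, hL'a h⟩⟩
      exact ((smoothOn_const (0 : Grassmann 𝕜 n)).congr fun y hy => hzero b y hy.1 hy.2).contDiffAt
        (hO b) hx' A
  · have hm := S.trans_morphism b c
    have hy := hm.mapsTo hx
    have hsymm := S.symm_bodyMap_trans hx
    by_cases hxa : x ∈ S.overlap b a
    · have hya : (S.trans b c).bodyMap x ∈ S.overlap c a :=
        ⟨hy.1, by rw [Set.mem_preimage, hsymm]; exact hxa.2⟩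
      have hO1 := (S.isOpen_overlap b c).inter (S.isOpen_overlap b a)
      -- The change from `b` to `c` is restricted to the points lying in `a` as well, where it can
      -- be composed with the change from `c` to `a`.
      have hmr : (S.trans b c).IsMorphism (S.overlap b c ∩ S.overlap b a) (S.overlap c a) :=
        hm.mono hO1 (S.isOpen_overlap c a) Set.inter_subset_left fun y hy =>
          ⟨(hm.mapsTo hy.1).1, by
            rw [Set.mem_preimage, S.symm_bodyMap_trans hy.1]; exact hy.2.2⟩
      have ht := S.trans_comp b c a
      have hxt : x ∈ (S.chart b).target ∩
        (S.chart b).symm ⁻¹' ((S.chart c).source ∩ (S.chart a).source) := ⟨hx.1, hx.2, hxa.2⟩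
      rw [hr b hxa, SuperMap.pullback_congr_nhds (Filter.eventuallyEq_of_mem
        ((S.isOpen_overlap c a).mem_nhds hya) (hr c)),
        hmr.pullback_pullback (S.trans_morphism c a) ⟨hx, hxa⟩ (hρ' _),
        SuperMap.pullback_eq_of_eq (fun i => ht.1 i hxt) (fun j => ht.2 j hxt)]
    · have hn : (S.chart b).symm x ∉ L' := fun h => hxa ⟨hx.1, hL'a h⟩
      have hyn : (S.trans b c).bodyMap x ∈ (S.chart c).target ∩ (S.chart c).symm ⁻¹' L'ᶜ :=
        ⟨hy.1, by rw [Set.mem_preimage, hsymm]; exact hn⟩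
      rw [hzero b x hx.1 hn, SuperMap.pullback_congr_nhds (g := fun _ => 0)
        (Filter.eventuallyEq_of_mem ((hO c).mem_nhds hyn) fun y hy => hzero c y hy.1 hy.2),
        hm.pullback_const hx, map_zero]
  · intro b x hx hxW
    have hxa : x ∈ S.overlap b a := ⟨hx, hxW.1⟩
    have hm := S.trans_morphism b a
    have hxW' : (S.trans b a).bodyMap x ∈ W := by
      rw [S.trans_body b a x hxa]
      exact hxW.2
    rw [hr b hxa, SuperMap.pullback_congr_nhds (g := fun _ => 1) (Filter.eventuallyEq_of_mem
      (hW.mem_nhds hxW') fun y hy => by simp [ρ', h1 y hy]), hm.pullback_const hxa,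
      SuperMap.oddSubst_one]

end Supermanifold

/-! ### Existence and uniqueness of the integral. -/

namespace Supermanifold

variable {𝕜 : Type*} [RCLike 𝕜] {m n : ℕ} {M : Type*} [TopologicalSpace M] {I : Type*}
  {S : Supermanifold 𝕜 m n M I} {f : I → SFun 𝕜 (m + n) (n + m)}

/-- Splitting f = r f + (1 - r) f, the first summand lies in a single chart and is prepended to a
decomposition of the second. -/
theorem IsIntegral.add {r : I → SFun 𝕜 m n} (hr : S.IsSuperfunction r) (hf : S.IsDecayingForm f)
    {a : I} {L : Set M} (hL : IsCompact L) (hLa : L ⊆ (S.chart a).source)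
    (h0 : ∀ b, ∀ x ∈ (S.chart b).target, (S.chart b).symm x ∉ L → r b x = 0) {c : 𝕜}
    (hc : S.IsIntegral (fun b z => liftFun (fun x => 1 - r b x) z * f b z) c) :
    ∃ c', S.IsIntegral f c' := by
  obtain ⟨N, a', g, hg, hsum, -⟩ := hc
  refine ⟨_, N + 1, Fin.cons a a', Fin.cons (fun b z => liftFun (r b) z * f b z) g,
    Fin.forall_fin_succ.2 ⟨?_, fun j => ?_⟩, fun b z hz => ?_, rfl⟩
  · refine ⟨hf.mul hr, L, hLa, hL, fun b z hz hn => ?_⟩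
    rw [Fin.cons_zero, liftFun_apply, h0 b _ hz hn, map_zero, zero_mul]
  · simpa using hg j
  · rw [Fin.sum_univ_succ]
    simp only [Fin.cons_zero, Fin.cons_succ]
    rw [← hsum b z hz, ← add_mul, liftFun_apply, liftFun_apply, ← map_add, add_sub_cancel, map_one,
      one_mul]

/-- Finitely many sets on which a cutoff equals 1 cover the support. Multiplication by 1 - r removes
one of them from the support, so no normalized partition of unity is required. -/
theorem exists_isIntegral [T2Space M] (hf : S.IsDecayingForm f) : ∃ c, S.IsIntegral f c := by
  classical
  choose a ha using S.cover
  choose r W L hr hW hPW hL hLa h1 h0 using fun P : M =>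
    S.exists_cutoff (isCompact_singleton (x := P)) (Set.singleton_subset_iff.2 (ha P))
  -- The induction is over the number of covering sets, with the form and its compact support left
  -- arbitrary, since both change at each step.
  have key : ∀ (t : Finset M) (K : Set M), IsCompact K → K ⊆ ⋃ P ∈ t, W P →
      ∀ f, S.IsDecayingForm f → S.VanishesOff f K → ∃ c, S.IsIntegral f c := by
    intro t
    induction t using Finset.induction_on with
    | empty =>
      intro K _ hKt f _ h
      refine ⟨_, 0, Fin.elim0, Fin.elim0, fun j => j.elim0, fun b z hz => ?_, rfl⟩
      rw [h b z hz fun hm => by simpa using hKt hm]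
      simp
    | insert P t _ ih =>
      intro K hK hKt f hf h
      obtain ⟨c, hc⟩ := ih (K \ W P) (hK.diff (hW P)) (fun x hx => by
        have := hKt hx.1
        rw [Finset.set_biUnion_insert] at this
        exact this.resolve_left hx.2) _ (hf.mul (hr P).one_sub) fun b z hz hn => by
          by_cases hxW : (S.chart b).symm (basePt z) ∈ W P
          · rw [liftFun_apply, h1 P b _ hz hxW, sub_self, map_zero, zero_mul]
          · rw [h b z hz fun hm => hn ⟨hm, hxW⟩, mul_zero]
      exact IsIntegral.add (hr P) hf (hL P) (hLa P) (h0 P) hc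
  obtain ⟨K, hK, h⟩ := hf.support
  obtain ⟨t, -, ht⟩ := hK.elim_nhds_subcover W fun P _ => (hW P).mem_nhds (hPW P rfl)
  exact key t K hK ht f hf h

/-- If forms supported in charts add up to zero, then so do their integrals. -/
theorem sum_berezinIntegral_eq_zero [T2Space M] (hS : S.IsOriented) {ι : Type*} (s : Finset ι) (a : ι → I)
    (g : ι → I → SFun 𝕜 (m + n) (n + m)) (hg : ∀ j ∈ s, S.IsDecayingForm (g j))
    (hsupp : ∀ j ∈ s, S.SupportedInChart (g j) (a j))
    (hsum : ∀ b, ∀ z ∈ tangentDomain n (S.chart b).target, ∑ j ∈ s, g j b z = 0) :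
    ∑ j ∈ s, berezinIntegral (S.chart (a j)).target (g j (a j)) = 0 := by
  classical
  induction s using Finset.induction_on generalizing g with
  | empty => simp
  | insert k s hk ih =>
    have hmem : ∀ {j}, j ∈ s → j ∈ insert k s := Finset.mem_insert_of_mem
    have hkm := Finset.mem_insert_self k s
    choose! K hKa hK hv using hsupp
    -- The cutoff is 1 near the support of the piece `k`, so `r` fixes that piece and 1 - r
    -- annihilates it.
    obtain ⟨r, W, L, hr, hW, hKW, hL, hLa, h1, h0⟩ := S.exists_cutoff (hK k hkm) (hKa k hkm)
    let rg : ι → I → SFun 𝕜 (m + n) (n + m) := fun j b z => liftFun (r b) z * g j b z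
    let sg : ι → I → SFun 𝕜 (m + n) (n + m) := fun j b z => liftFun (fun x => 1 - r b x) z * g j b z
    have hrg : ∀ j ∈ insert k s, S.IsDecayingForm (rg j) := fun j hj => (hg j hj).mul hr
    have hsg : ∀ j ∈ insert k s, S.IsDecayingForm (sg j) := fun j hj => (hg j hj).mul hr.one_sub
    have hrk : ∀ b, ∀ z ∈ tangentDomain n (S.chart b).target, rg k b z = g k b z :=
      fun b z hz => by
        by_cases hm : (S.chart b).symm (basePt z) ∈ K k
        · change liftFun (r b) z * _ = _
          rw [liftFun_apply, h1 b _ hz (hKW hm), map_one, one_mul]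
        · change _ * g k b z = _
          rw [hv k hkm b z hz hm, mul_zero]
    have hadd : ∀ j b z, g j b z = rg j b z + sg j b z := fun j b z => by
      change _ = liftFun (r b) z * _ + liftFun (fun x => 1 - r b x) z * _
      rw [← add_mul, liftFun_apply, liftFun_apply, ← map_add, add_sub_cancel, map_one, one_mul]
    have hrv : ∀ j ∈ insert k s, S.VanishesOff (rg j) (L ∩ K j) := fun j hj b z hz hn => by
      by_cases hm : (S.chart b).symm (basePt z) ∈ K j
      · change liftFun (r b) z * _ = _
        rw [liftFun_apply, h0 b _ hz fun h => hn ⟨h, hm⟩, map_zero, zero_mul]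
      · exact (hv j hj).mul_left r b z hz hm
    have hrL : ∀ j ∈ insert k s, S.VanishesOff (rg j) L := fun j hj b z hz hn =>
      hrv j hj b z hz fun h => hn h.1
    -- The product of `r` with the piece `j` is supported in both charts `a j` and `a k`, so all
    -- these integrals may be computed in `a k`, where the forms add up to zero.
    have e1 : ∀ j ∈ insert k s, berezinIntegral (S.chart (a j)).target (rg j (a j)) =
        berezinIntegral (S.chart (a k)).target (rg j (a k)) := fun j hj =>
      (hrg j hj).berezinIntegral_eq hS (hL.inter (hK j hj))
        (Set.inter_subset_right.trans (hKa j hj)) (Set.inter_subset_left.trans hLa) (hrv j hj)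
    have e2 : ∑ j ∈ insert k s, berezinIntegral (S.chart (a j)).target (rg j (a j)) = 0 := by
      rw [Finset.sum_congr rfl e1, ← SuperGeom.IsDecayingForm.berezinIntegral_sum
        (S.chart (a k)).open_target fun j hj => (hrg j hj).chart hL hLa (hrL j hj),
        berezinIntegral_congr (g := fun _ => 0) (S.chart (a k)).open_target fun z hz => ?_]
      · simp [berezinIntegral, topCoeff, ← coeffₗ_apply]
      · change ∑ j ∈ insert k s, liftFun (r (a k)) z * g j (a k) z = 0
        rw [← Finset.mul_sum, hsum _ z hz, mul_zero]
    have hsk : ∀ b, ∀ z ∈ tangentDomain n (S.chart b).target, sg k b z = 0 := fun b z hz => by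
      have := hadd k b z
      rwa [hrk b z hz, left_eq_add] at this
    -- Multiplied by 1 - r, the piece `k` disappears and the remaining ones still add up to zero;
    -- the induction hypothesis applies.
    have e3 : ∑ j ∈ s, berezinIntegral (S.chart (a j)).target (sg j (a j)) = 0 := by
      refine ih sg (fun j hj => hsg j (hmem hj))
        (fun j hj => ⟨K j, hKa j (hmem hj), hK j (hmem hj), (hv j (hmem hj)).mul_left _⟩)
        fun b z hz => ?_
      have h2 : ∑ j ∈ insert k s, sg j b z = 0 := by
        change ∑ j ∈ insert k s, liftFun (fun x => 1 - r b x) z * g j b z = 0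
        rw [← Finset.mul_sum, hsum b z hz, mul_zero]
      rwa [Finset.sum_insert hk, hsk b z hz, zero_add] at h2
    have e4 : ∑ j ∈ insert k s, berezinIntegral (S.chart (a j)).target (sg j (a j)) = 0 := by
      rw [Finset.sum_insert hk, e3, add_zero, berezinIntegral_congr (g := fun _ => 0)
        (S.chart (a k)).open_target fun z hz => hsk _ z hz]
      simp [berezinIntegral, topCoeff, ← coeffₗ_apply]
    calc ∑ j ∈ insert k s, berezinIntegral (S.chart (a j)).target (g j (a j))
        = ∑ j ∈ insert k s, (berezinIntegral (S.chart (a j)).target (rg j (a j)) +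
            berezinIntegral (S.chart (a j)).target (sg j (a j))) := by
          refine Finset.sum_congr rfl fun j hj => ?_
          rw [← ((hrg j hj).chart (hK j hj) (hKa j hj)
            ((hv j hj).mul_left r)).berezinIntegral_add (S.chart (a j)).open_target
            ((hsg j hj).chart (hK j hj) (hKa j hj) ((hv j hj).mul_left _))]
          exact berezinIntegral_congr (S.chart (a j)).open_target fun z _ => hadd j _ z
      _ = 0 := by rw [Finset.sum_add_distrib, e2, e4, add_zero]

/-- The pieces of one decomposition together with the negatives of those of the other add up to
zero. -/
theorem IsIntegral.unique [T2Space M] (hS : S.IsOriented) {c c' : 𝕜} (h : S.IsIntegral f c)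
    (h' : S.IsIntegral f c') : c = c' := by
  obtain ⟨N, a, g, hg, hsum, rfl⟩ := h
  obtain ⟨N', a', g', hg', hsum', rfl⟩ := h'
  -- The negatives are written as products with the constant superfunction -1, so that they are
  -- decaying forms by the result on products.
  let G : Fin N ⊕ Fin N' → I → SFun 𝕜 (m + n) (n + m) := Sum.elim g fun j b z =>
    liftFun (fun _ => algebraMap 𝕜 (Grassmann 𝕜 n) (-1)) z * g' j b z
  have hG : ∀ j b z, G (Sum.inr j) b z = -g' j b z := fun j b z => by
    change liftFun (fun _ => algebraMap 𝕜 (Grassmann 𝕜 n) (-1)) z * _ = _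
    rw [liftFun_apply, AlgHom.commutes, map_neg, map_one, neg_one_mul]
  have key := sum_berezinIntegral_eq_zero hS Finset.univ (Sum.elim a a') G
    (by
      rintro (j | j) _
      · exact (hg j).1
      · exact (hg' j).1.mul (isSuperfunction_const _))
    (by
      rintro (j | j) _
      · exact (hg j).2
      · obtain ⟨K, hKa, hK, hv⟩ := (hg' j).2
        exact ⟨K, hKa, hK, hv.mul_left _⟩)
    (fun b z hz => by
      rw [Fintype.sum_sum_type]
      simp only [hG, Finset.sum_neg_distrib]
      rw [← hsum' b z hz, hsum b z hz]
      exact add_neg_cancel _)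
  rw [Fintype.sum_sum_type] at key
  have hneg : ∀ j, berezinIntegral (S.chart (a' j)).target (G (Sum.inr j) (a' j)) =
      -berezinIntegral (S.chart (a' j)).target (g' j (a' j)) := fun j => by
    rw [show G (Sum.inr j) (a' j) = fun z => -g' j (a' j) z from funext fun z => hG j _ z]
    simp only [berezinIntegral, topCoeff, ← coeffₗ_apply, map_neg]
    exact MeasureTheory.integral_neg _
  simp only [Sum.elim_inl, Sum.elim_inr, hneg, Finset.sum_neg_distrib] at key
  exact eq_of_sub_eq_zero ((sub_eq_add_neg _ _).trans key)

end Supermanifold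

end SuperGeom

end

theorem mainTheorem2 {𝕜 : Type*} [RCLike 𝕜] (m n : ℕ) :
    -- the induced coordinate change of the odd tangent bundle has Berezinian one
    (∀ (U V : Set (Fin m → ℝ)) (φ : SuperGeom.SuperMap 𝕜 m n m n), φ.IsCoordChange U V →
      φ.oddTangent.IsCoordChange
        (SuperGeom.tangentDomain n U) (SuperGeom.tangentDomain n V) ∧
      ∀ z ∈ SuperGeom.tangentDomain n U,
        SuperGeom.berezinian (φ.oddTangent.jacobian z) = 1) ∧
    -- the integral is unchanged by a coordinate change, up to the orientation sign
    (∀ (U V : Set (Fin m → ℝ)) (φ : SuperGeom.SuperMap 𝕜 m n m n), φ.IsCoordChange U V →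
      ∀ f : SuperGeom.SFun 𝕜 (m + n) (n + m), SuperGeom.IsDecayingForm V f →
        SuperGeom.IsDecayingForm U (φ.oddTangent.pullback f) ∧
        MeasureTheory.IntegrableOn (SuperGeom.topCoeff f) (SuperGeom.tangentDomain n V) ∧
        MeasureTheory.IntegrableOn (SuperGeom.topCoeff (φ.oddTangent.pullback f))
          (SuperGeom.tangentDomain n U) ∧
        SuperGeom.berezinIntegral V f =
          SuperGeom.berezinIntegral U (fun z =>
            ((Real.sign (φ.orientationDet (SuperGeom.basePt z)) : ℝ) : 𝕜) •
              φ.oddTangent.pullback f z)) ∧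
    -- hence on an oriented supermanifold the integral exists and does not depend on coordinates
    (∀ (M : Type*) [TopologicalSpace M] [T2Space M] (I : Type*)
      (S : SuperGeom.Supermanifold 𝕜 m n M I), S.IsOriented →
      ∀ f : I → SuperGeom.SFun 𝕜 (m + n) (n + m), S.IsDecayingForm f →
        ∃! c : 𝕜, S.IsIntegral f c) := by
  refine ⟨fun U V φ h => ?_, fun U V φ h f hf => ?_, fun M _ _ I S hS f hf => ?_⟩
  · obtain ⟨χ, h⟩ := SuperGeom.SuperMap.isCoordChange_iff.1 h
    exact ⟨SuperGeom.SuperMap.isCoordChange_iff.2 ⟨_, h.oddTangent⟩,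
      fun z hz => h.berezinian_oddTangent hz⟩
  · obtain ⟨χ, h⟩ := SuperGeom.SuperMap.isCoordChange_iff.1 h
    have hf' := h.isDecayingForm_pullback hf
    exact ⟨hf', hf.integrableOn_coeff h.1.isOpen_target Finset.univ,
      hf'.integrableOn_coeff h.1.isOpen_source Finset.univ, (h.berezinIntegral_pullback hf).symm⟩
  · obtain ⟨c, hc⟩ := SuperGeom.Supermanifold.exists_isIntegral hf
    exact ⟨c, hc, fun c' hc' => hc'.unique hS hc⟩
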